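/- Let $d,q\ge 1$ be integers, $s\in(0,1]$, $p=q+s$, $C_0\ge 1$, and let $C,C'$ be real numbers, $\kappa>0$ and $H\in\mathbb{R}$. Call $f:\mathbb{R}^d\to\mathbb{R}$ $(p,C_0)$-smooth if it has continuous partial derivatives up to order $q$ and $|\partial^{\boldsymbol j}f(\boldsymbol x)-\partial^{\boldsymbol j}f(\boldsymbol y)|\le C_0\|\boldsymbol x-\boldsymbol y\|^s$ for all $\boldsymbol x,\boldsymbol y\in\mathbb{R}^d$ and all multi-indices with $|\boldsymbol j|_1=q$. Let $\mathcal F(L,\iota,\delta)$ be the class of functions computed by fully connected networks with activation $1/(1+e^{-x})$, $L$ hidden layers, $\iota$ neurons in each hidden layer and an affine output layer, all of whose weights and biases are at most $\delta$ in absolute value. For $k>0$ let $\widetilde{\mathcal F}(1,L,\iota,\delta)$ with the down-scaling $\Phi(\boldsymbol x)=k\boldsymbol x$ be the class of functions $\boldsymbol x\mapsto W g(k\boldsymbol x)+b$ with $g\in\mathcal F(L,\iota,\delta)$ and $W,b\in\mathbb{R}$. Then there are positive constants $C_1,C_2,c_2,c_3,c_6$, depending only on $d,q,s,C_0,C,C',\kappa,H$,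 such that the following holds for all $h\ge 1$ and $k>0$ with $k\ge\kappa$ or $h\le H$. (In particular, for bounded $h$ the constants are independent of $k>0$, and for $k$ bounded away from $0$ they are independent of both $k$ and $h$.) Let $f$ be $(p,C_0)$-smooth with $\|\partial^{\boldsymbol j}f\|_{L^\infty([-2h,2h]^d)}\le C'k^{|\boldsymbol j|_1}$ for $1\le|\boldsymbol j|_1\le q$ and $\|f\|_{L^\infty([-2h,2h]^d)}\le C$. Then for every $M\in\mathbb{N}$ with $$M^{2p}\ge\max\Big\{2c_2\big(\max\{kh,C_1\}\big)^{5q+3},\,c_3,\,2^d,\,12d\Big\}$$ there is $f_{\rm net}\in\widetilde{\mathcal F}(1,L,\iota,\delta)$ with $\Phi(\boldsymbol x)=k\boldsymbol x$ such that $$\|f_{\rm net}-f\|_{\infty,[-h,h]^d}\le\frac{C_2\big(\max\{kh,C_1\}\big)^{5q+3}}{M^{2p}},$$ where $$L=8+\lceil\log_2(\max\{d,q+1\})\rceil,$$ $$\iota=2^d\Big(\max\Big\{\Big(\tbinom{d+q}{d}+d\Big)M^d(2+2d)+d,\;4(q+1)\tbinom{d+q}{d}\Big\}+M^d(2d+2)+12d\Big),$$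 $$\delta=c_6\,e^{6\cdot 2^{2(d+1)+1}dh}\,M^{10p+2d+10}\,\big(\max\{kh,C_1\}\big)^{12}.$$ -/

import Mathlib

noncomputable section

namespace Mscale

/-- The cube `[-r, r]^d`. -/
def cube (d : ℕ) (r : ℝ) : Set (EuclideanSpace ℝ (Fin d)) :=
  {x | ∀ i, x i ∈ Set.Icc (-r) r}

/-- The partial derivative `∂f / ∂x_i`. -/
def partialDeriv {d : ℕ} (i : Fin d) (f : EuclideanSpace ℝ (Fin d) → ℝ) :
    EuclideanSpace ℝ (Fin d) → ℝ :=
  fun x => lineDeriv ℝ f x (EuclideanSpace.single i 1)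

/-- The mixed partial derivative `∂^j f = ∂^{|j|} f / (∂x_1^{j_1} ⋯ ∂x_d^{j_d})` for a
multi-index `j`. -/
def mixedPartial {d : ℕ} (j : Fin d → ℕ) (f : EuclideanSpace ℝ (Fin d) → ℝ) :
    EuclideanSpace ℝ (Fin d) → ℝ :=
  (List.finRange d).foldr (fun i g => (partialDeriv i)^[j i] g) f

/-- `(p, C₀)`-smoothness of `f : ℝ^d → ℝ`, where `p = q + s`: `f` has continuous partial
derivatives up to order `q`, and those of order exactly `q` are Hölder continuous on `ℝ^d` with
exponent `s` and constant `C₀` with respect to the Euclidean norm. -/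
def IsSmoothClass {d : ℕ} (q : ℕ) (s C₀ : ℝ) (f : EuclideanSpace ℝ (Fin d) → ℝ) : Prop :=
  ContDiff ℝ q f ∧
    ∀ j : Fin d → ℕ, ∑ i, j i = q →
      ∀ x y, |mixedPartial j f x - mixedPartial j f y| ≤ C₀ * ‖x - y‖ ^ s

/-- The sigmoid activation function. -/
def act (t : ℝ) : ℝ := 1 / (1 + Real.exp (-t))

/-- Parameters (weight matrices and bias vectors) of `n ≥ 1` successive fully connected hidden
layers, each with `w` neurons, on inputs from `ℝ^D`. -/
inductive HiddenLayers (D w : ℕ) : ℕ → Type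
  | first (A : Matrix (Fin w) (Fin D) ℝ) (b : Fin w → ℝ) : HiddenLayers D w 1
  | next {n : ℕ} (prev : HiddenLayers D w n) (A : Matrix (Fin w) (Fin w) ℝ) (b : Fin w → ℝ) :
      HiddenLayers D w (n + 1)

/-- The output of the last hidden layer: each layer maps `z` to `act (A z + b)`, with `act`
applied to every coordinate. -/
def HiddenLayers.eval {D w : ℕ} :
    {n : ℕ} → HiddenLayers D w n → EuclideanSpace ℝ (Fin D) → Fin w → ℝ
  | _, .first A b, x => fun r => act (∑ c, A r c * x c + b r)
  | _, .next prev A b, x => fun r => act (∑ c, A r c * prev.eval x c + b r)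

/-- All weights and biases of the hidden layers are at most `δ` in absolute value. -/
def HiddenLayers.BoundedBy {D w : ℕ} (δ : ℝ) : {n : ℕ} → HiddenLayers D w n → Prop
  | _, .first A b => (∀ r c, |A r c| ≤ δ) ∧ ∀ r, |b r| ≤ δ
  | _, .next prev A b => prev.BoundedBy δ ∧ (∀ r c, |A r c| ≤ δ) ∧ ∀ r, |b r| ≤ δ

/-- The class `F(L, w, δ)` of functions `ℝ^D → ℝ` computed by standard sigmoid networks with `L`
hidden layers of width `w`, followed by an affine output layer, all of whose parameters are at
most `δ` in absolute value. -/
def netClass (D L w : ℕ) (δ : ℝ) : Set (EuclideanSpace ℝ (Fin D) → ℝ) :=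
  {f | ∃ (H : HiddenLayers D w L) (a : Fin w → ℝ) (a₀ : ℝ),
    H.BoundedBy δ ∧ (∀ r, |a r| ≤ δ) ∧ |a₀| ≤ δ ∧ f = fun x => ∑ r, a r * H.eval x r + a₀}

/-- The feature mapping network class `F̃(N, L, w, δ)` for the feature mapping
`Φ = (Φ_1, …, Φ_N)`, `Φ_i : ℝ^d → ℝ^D`: the functions `x ↦ ∑ i, W_i g_i (Φ_i x) + b` with
`g_i ∈ F(L, w, δ)`, `W ∈ ℝ^{1 × N}` and `b ∈ ℝ`. -/
def featureNetClass {d D N : ℕ}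
    (Φ : Fin N → EuclideanSpace ℝ (Fin d) → EuclideanSpace ℝ (Fin D)) (L w : ℕ) (δ : ℝ) :
    Set (EuclideanSpace ℝ (Fin d) → ℝ) :=
  {f | ∃ (g : Fin N → EuclideanSpace ℝ (Fin D) → ℝ) (W : Fin N → ℝ) (b : ℝ),
    (∀ i, g i ∈ netClass D L w δ) ∧ f = fun x => ∑ i, W i * g i (Φ i x) + b}

/-- The depth `C₄(d, q) = 8 + ⌈log₂ (max {d, q + 1})⌉`. -/
def depth (d q : ℕ) : ℕ := 8 + Nat.clog 2 (max d (q + 1))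

/-- The width `C₅(d, q, M)`. -/
def width (d q M : ℕ) : ℕ :=
  2 ^ d * (max (((d + q).choose d + d) * M ^ d * (2 + 2 * d) + d) (4 * (q + 1) * (d + q).choose d)
    + M ^ d * (2 * d + 2) + 12 * d)

/-- The bound on the parameters, `C₆(d, M, h, B) = c₆ exp(6 · 2^{2(d+1)+1} d h) M^{10p+2d+10} B^{12}`. -/
def paramBound (c₆ p : ℝ) (d M : ℕ) (h B : ℝ) : ℝ :=
  c₆ * Real.exp (6 * 2 ^ (2 * (d + 1) + 1) * d * h) * (M : ℝ) ^ (10 * p + 2 * d + 10) * B ^ 12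

end Mscale

end

/-!
The network is a smooth version of piecewise Taylor approximation. In the coordinate
`u = (x / h + 1) / 2`, which only depends on `k x` and `k h`, the cube `[-h, h]^d` becomes
`[0, 1]^d`. It is divided into `M ^ d` coarse cells, each of which is divided again into `M ^ d`
fine cells. A Taylor polynomial at a corner of a fine cell has error of order
`(1 / M ^ 2) ^ p = M ^ (-2 p)`, so the network has to evaluate, at a given point, the Taylor
polynomial of a nearby fine cell, although a layer of width `O(M ^ d)` cannot have one neuron for
each of the `M ^ (2 d)` fine cells. Four ideas achieve this.

* *Continuity of the fine position.* The position inside a coarse cell jumps at the cell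
  boundaries. The zigzag `fold`, the distance to the nearest even integer after scaling by `M`,
  describes the same position continuously, with the orientation reversed in every other cell. It
  is a sum of `M` ramps per coordinate, and `foldNet` imitates the ramps by logistic neurons
  (`exists_abs_foldNet_sub_le`).
* *Localization with two layers.* The neurons `orthant` are smooth indicators of orthants, and the
  mixed differences `cellWeight` of these over the corners of a cell are smooth indicators of cells.
  The telescoping sum `sum_cellWeight` shows that their total mass is a constant, exponentially
  close to `1`, and `exists_cellTail_le` that the mass away from the point is smaller than any power
  of `1 / M`. Since the steps are not sharp, a bounded number of neighbouring cells share the mass;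
  this does no harm because a Taylor polynomial is accurate on the neighbouring cells as well.
* *Table lookup.* For coarse weights `A i`, fine weights `B j` and a table `e i j` of Taylor
  coefficients, `∑ i, A i * ∑ j, B j * e i j` is the interpolated coefficient. For each fine index
  `j` the sum `∑ i, A i * e i j` is affine in the neurons of one layer (`selected`), so that only
  `M ^ d` products with `B j` remain to be formed (`coefNet`); the number of parameters is
  `M ^ (2 d)`, but the number of neurons is not.
* *Products from neurons.* `n`-th divided differences of the logistic function at a point where its
  `n`-th derivative does not vanish imitate `y ↦ y ^ n` (`exists_ridge`), and polarization turns
  powers into products (`mulNet`, `prodNet`). With `n = 1` this gives approximate identities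
  (`idNet`), which carry the input through the layers and stretch the network to the prescribed
  depth.

Taylor polynomials are indexed by `Sym (Fin (d + 1)) q`, that is, made homogeneous of degree `q` by
an additional coordinate equal to `1`. There are `(d + q).choose d` such monomials, all of them
products of exactly `q` factors. The proof only needs the remainder estimate `IsLocalApprox` for
the table; `exists_isLocalApprox` derives it from the smoothness of `f`.

The network approximates `f / (Λ * B ^ (q + 1))` with `B = max (k * h) 1`, so that all coefficients
are at most `1`, and the outer weight `W` restores the factor. The first layer multiplies `k x` by
`1 / (k * h)`, which is affordable as long as `1 / (k * h) ≤ M ^ (2 * q + 2)`. For smaller `k * h`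
the bound on the gradient of `f` makes the constant `f 0` an approximation of the required accuracy.
-/

noncomputable section

namespace Mscale

/-! ### Powers from divided differences of the logistic function -/

theorem act_eq_sigmoid : act = Real.sigmoid := by
  funext t
  simp [act, Real.sigmoid_def]

theorem contDiff_act {n : WithTop ℕ∞} : ContDiff ℝ n act := by
  rw [act_eq_sigmoid]
  exact contDiff_sigmoid.of_le le_top

theorem act_pos (t : ℝ) : 0 < act t := by
  rw [act_eq_sigmoid]; exact Real.sigmoid_pos t

theorem act_lt_one (t : ℝ) : act t < 1 := by
  rw [act_eq_sigmoid]; exact Real.sigmoid_lt_one t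

theorem act_neg (t : ℝ) : act (-t) = 1 - act t := by
  rw [act_eq_sigmoid]; exact Real.sigmoid_neg t

theorem act_le_exp (t : ℝ) : act t ≤ Real.exp t := by
  unfold act
  rw [div_le_iff₀ (by positivity), mul_add, ← Real.exp_add]
  simp [(Real.exp_pos t).le]

theorem one_sub_act_le_exp (t : ℝ) : 1 - act t ≤ Real.exp (-t) := by
  rw [← act_neg]; exact act_le_exp _

theorem abs_act_sub_le (x y : ℝ) : |act x - act y| ≤ |x - y| := by
  have h := Convex.norm_image_sub_le_of_norm_deriv_le (f := act) (s := Set.univ) (C := 1)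
    (x := y) (y := x)
    (fun t _ => (contDiff_act (n := 1)).differentiable (by norm_num) t) ?_ convex_univ
    (Set.mem_univ _) (Set.mem_univ _)
  · simpa using h
  · intro t _
    rw [act_eq_sigmoid, Real.deriv_sigmoid]
    have h1 := Real.sigmoid_pos t
    have h2 := Real.sigmoid_lt_one t
    rw [Real.norm_eq_abs, abs_of_nonneg (by nlinarith)]
    nlinarith

/-- The derivatives of the logistic function are polynomials in the function itself, because it
satisfies `act' = act * (1 - act)`; the degree grows by one with each derivative. -/
theorem exists_iteratedDeriv_act_eq_eval (k : ℕ) :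
    ∃ P : Polynomial ℝ, P.natDegree = k + 1 ∧ ∀ x, iteratedDeriv k act x = P.eval (act x) := by
  induction k with
  | zero => exact ⟨Polynomial.X, by simp, by simp⟩
  | succ k ih =>
    obtain ⟨P, hP, h⟩ := ih
    refine ⟨Polynomial.derivative P * (Polynomial.X * (1 - Polynomial.X)), ?_, ?_⟩
    · have h1 : (Polynomial.derivative P).natDegree = k := by
        rw [Polynomial.natDegree_derivative, hP]; rfl
      have h0 : P.derivative ≠ 0 := by
        intro h0
        have := Polynomial.derivative_eq_zero.1 h0
        omega
      have h2 : (1 - Polynomial.X : Polynomial ℝ).natDegree = 1 := by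
        rw [← neg_sub, Polynomial.natDegree_neg]
        exact Polynomial.natDegree_X_sub_C (1 : ℝ)
      have h3 : (1 - Polynomial.X : Polynomial ℝ) ≠ 0 := by
        intro h; rw [h] at h2; simp at h2
      rw [Polynomial.natDegree_mul h0 (mul_ne_zero Polynomial.X_ne_zero h3),
        Polynomial.natDegree_mul Polynomial.X_ne_zero h3, h1, h2, Polynomial.natDegree_X]
    · intro x
      rw [iteratedDeriv_succ]
      have h4 : iteratedDeriv k act = fun x => P.eval (act x) := funext h
      have h5 : HasDerivAt act (act x * (1 - act x)) x := by
        rw [act_eq_sigmoid]; exact Real.hasDerivAt_sigmoid x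
      rw [h4]
      refine ((P.hasDerivAt (act x)).comp x h5).deriv.trans ?_
      simp

/-- Otherwise the infinitely many values of `act` would all be roots of one polynomial. -/
theorem exists_iteratedDeriv_act_ne_zero (k : ℕ) : ∃ t, iteratedDeriv k act t ≠ 0 := by
  obtain ⟨P, hP, h⟩ := exists_iteratedDeriv_act_eq_eval k
  by_contra! hc
  have h0 : P ≠ 0 := by rintro rfl; simp at hP
  have h1 : Set.range act ⊆ {x | P.IsRoot x} := by
    rintro _ ⟨t, rfl⟩
    rw [Set.mem_ofPred_eq, Polynomial.IsRoot, ← h, hc]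
  refine (Set.infinite_range_of_injective ?_) ((Polynomial.finite_setOfPred_isRoot h0).subset h1)
  rw [act_eq_sigmoid]; exact Real.sigmoid_injective

/-- Taylor's formula along the unit interval, with the Lagrange remainder. -/
theorem exists_taylor_unit (g : ℝ → ℝ) (n : ℕ) (hg : ContDiff ℝ (n + 1) g) :
    ∃ ξ ∈ Set.Icc (0 : ℝ) 1, g 1 = ∑ r ∈ Finset.range (n + 1), iteratedDeriv r g 0 / r.factorial
      + iteratedDeriv (n + 1) g ξ / (n + 1).factorial := by
  obtain ⟨ξ, hξ, h⟩ := taylor_mean_remainder_lagrange_iteratedDeriv (f := g) (x := 1) (x₀ := 0)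
    (n := n) (by norm_num) hg.contDiffOn
  rw [Set.uIoo_of_le zero_le_one] at hξ
  refine ⟨ξ, ⟨hξ.1.le, hξ.2.le⟩, ?_⟩
  rw [taylor_within_apply] at h
  simp only [sub_zero, one_pow, mul_one, smul_eq_mul] at h
  rw [sub_eq_iff_eq_add] at h
  rw [h, add_comm]
  congr 1
  refine Finset.sum_congr rfl fun r hr => ?_
  have hu : UniqueDiffOn ℝ (Set.uIcc (0 : ℝ) 1) := uniqueDiffOn_uIcc (by norm_num)
  rw [iteratedDerivWithin_eq_iteratedDeriv hu _ (by simp)]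
  · field_simp
  · refine (hg.of_le ?_).contDiffAt
    have : r ≤ n + 1 := by have := Finset.mem_range.1 hr; omega
    exact_mod_cast this

/-- The remainder of the Taylor polynomial of the logistic function is of the expected order,
uniformly for bounded increments. -/
theorem exists_act_taylor_bound (t : ℝ) (m : ℕ) (A : ℝ) :
    ∃ C, 0 ≤ C ∧ ∀ y, |y| ≤ A →
      |act (t + y) - ∑ r ∈ Finset.range m, iteratedDeriv r act t * y ^ r / r.factorial|
        ≤ C * |y| ^ m := by
  rcases m with _ | n
  · refine ⟨1, zero_le_one, fun y _ => ?_⟩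
    simp only [Finset.range_zero, Finset.sum_empty, sub_zero, pow_zero, mul_one]
    rw [abs_of_pos (act_pos _)]; exact (act_lt_one _).le
  have hcont : Continuous (iteratedDeriv (n + 1) act) :=
    (contDiff_act (n := ⊤)).continuous_iteratedDeriv _ (by exact_mod_cast le_top)
  obtain ⟨C, hC⟩ := (isCompact_Icc (a := t - A) (b := t + A)).exists_bound_of_continuousOn
    hcont.continuousOn
  refine ⟨|C|, abs_nonneg _, fun y hy => ?_⟩
  have hid : ∀ r x, iteratedDeriv r (fun τ => act (t + y * τ)) x
      = y ^ r * iteratedDeriv r act (t + y * x) := by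
    intro r x
    have h1 := iteratedDeriv_comp_const_mul (n := r) (f := fun z => act (t + z))
      (by exact (contDiff_act.comp (contDiff_const.add contDiff_id))) y
    have h2 := iteratedDeriv_comp_const_add r act t
    rw [h2] at h1
    exact congrFun h1 x
  obtain ⟨ξ, hξ, h⟩ := exists_taylor_unit (fun τ => act (t + y * τ)) n
    (contDiff_act.comp (contDiff_const.add (contDiff_const.mul contDiff_id)))
  simp only [hid, mul_one, mul_zero, add_zero] at h
  rw [h]
  have h3 : ∑ r ∈ Finset.range (n + 1), y ^ r * iteratedDeriv r act t / (r.factorial : ℝ)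
      = ∑ r ∈ Finset.range (n + 1), iteratedDeriv r act t * y ^ r / (r.factorial : ℝ) :=
    Finset.sum_congr rfl fun r _ => by ring
  rw [h3, add_sub_cancel_left, abs_div, abs_mul, abs_pow]
  have h4 : |iteratedDeriv (n + 1) act (t + y * ξ)| ≤ |C| := by
    refine (hC _ ?_).trans (le_abs_self C)
    have : |y * ξ| ≤ A := by
      rw [abs_mul, abs_of_nonneg hξ.1]
      nlinarith [abs_nonneg y, hξ.1, hξ.2]
    rw [abs_le] at this
    exact ⟨by linarith, by linarith⟩
  have h5 : (1 : ℝ) ≤ |((n + 1).factorial : ℝ)| := by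
    rw [Nat.abs_cast]; exact_mod_cast Nat.succ_le_of_lt (Nat.factorial_pos _)
  calc _ ≤ |y| ^ (n + 1) * |iteratedDeriv (n + 1) act (t + y * ξ)| :=
        div_le_self (by positivity) h5
    _ ≤ |C| * |y| ^ (n + 1) := by
        rw [mul_comm]; gcongr

/-- There are weights on `m` equispaced nodes that reproduce the `k`-th moment and annihilate all
other moments of order less than `m`. -/
theorem exists_moment_weights (m k : ℕ) (c : ℝ) :
    ∃ γ : Fin m → ℝ, ∀ r < m, ∑ i, γ i * (i : ℝ) ^ r = if r = k then c else 0 := by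
  let V : Matrix (Fin m) (Fin m) ℝ := Matrix.vandermonde fun i : Fin m => (i : ℝ)
  have hV : IsUnit V.det := by
    rw [isUnit_iff_ne_zero, Matrix.det_vandermonde_ne_zero_iff]
    intro a b hab
    exact Fin.ext (Nat.cast_injective (R := ℝ) hab)
  refine ⟨Matrix.vecMul (fun r : Fin m => if (r : ℕ) = k then c else 0) V⁻¹, fun r hr => ?_⟩
  have h1 : Matrix.vecMul (Matrix.vecMul (fun r : Fin m => if (r : ℕ) = k then c else 0) V⁻¹) V
      = fun r : Fin m => if (r : ℕ) = k then c else 0 := by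
    rw [Matrix.vecMul_vecMul, Matrix.nonsing_inv_mul _ hV, Matrix.vecMul_one]
  exact congrFun h1 ⟨r, hr⟩

/-- Divided differences of the logistic function at a point where its `k`-th derivative does not
vanish: a fixed linear combination of `m` rescaled
copies reproduces `y ^ k` with an error that is small of order `m - k` in the scale `ρ`. -/
theorem exists_ridge (m k : ℕ) (hk : k < m) :
    ∃ (t : ℝ) (γ : Fin m → ℝ) (C : ℝ), 0 ≤ C ∧ ∀ A ρ y : ℝ, 0 < ρ → A ≤ ρ → |y| ≤ A →
      |ρ ^ k * ∑ i, γ i * act (t + i * (y / ρ)) - y ^ k| ≤ C * A ^ m * ρ ^ k / ρ ^ m := by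
  obtain ⟨t, ht⟩ := exists_iteratedDeriv_act_ne_zero k
  obtain ⟨γ, hγ⟩ := exists_moment_weights m k (k.factorial / iteratedDeriv k act t)
  obtain ⟨C, hC0, hC⟩ := exists_act_taylor_bound t m m
  refine ⟨t, γ, (∑ i, |γ i|) * (C * (m : ℝ) ^ m), by positivity, ?_⟩
  intro A ρ y hρ hA hy
  have hyρ : |y / ρ| ≤ 1 := by
    rw [abs_div, abs_of_pos hρ, div_le_one hρ]; exact hy.trans hA
  have hA0 : 0 ≤ A := (abs_nonneg y).trans hy
  set z := y / ρ with hz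
  have hmain : ∑ i, γ i * (∑ r ∈ Finset.range m,
      iteratedDeriv r act t * ((i : ℕ) * z) ^ r / r.factorial) = z ^ k := by
    simp_rw [Finset.mul_sum]
    rw [Finset.sum_comm]
    have : ∀ r ∈ Finset.range m, ∑ i : Fin m, γ i * (iteratedDeriv r act t *
        ((i : ℕ) * z) ^ r / r.factorial) = if r = k then z ^ k else 0 := by
      intro r hr
      have h1 := hγ r (Finset.mem_range.1 hr)
      have h2 : ∑ i : Fin m, γ i * (iteratedDeriv r act t * ((i : ℕ) * z) ^ r / r.factorial)
          = (iteratedDeriv r act t * z ^ r / r.factorial) * ∑ i : Fin m, γ i * (i : ℝ) ^ r := by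
        rw [Finset.mul_sum]
        refine Finset.sum_congr rfl fun i _ => ?_
        rw [mul_pow]; ring
      rw [h2, h1]
      split_ifs with h
      · subst h
        have := r.factorial_ne_zero
        field_simp
      · simp
    rw [Finset.sum_congr rfl this]
    simp [hk]
  have hyk : y ^ k = ρ ^ k * z ^ k := by
    rw [hz, div_pow]; field_simp
  rw [hyk, ← hmain, ← mul_sub, ← Finset.sum_sub_distrib, abs_mul, abs_of_pos (pow_pos hρ k)]
  have hzA : |z| ≤ A / ρ := by
    rw [hz, abs_div, abs_of_pos hρ]; gcongr
  have hb : |∑ i : Fin m, (γ i * act (t + i * z) - γ i * ∑ r ∈ Finset.range m,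
      iteratedDeriv r act t * ((i : ℕ) * z) ^ r / r.factorial)|
      ≤ (∑ i, |γ i|) * (C * (m : ℝ) ^ m * (A / ρ) ^ m) := by
    refine (Finset.abs_sum_le_sum_abs _ _).trans ?_
    rw [Finset.sum_mul]
    refine Finset.sum_le_sum fun i _ => ?_
    rw [← mul_sub, abs_mul]
    refine mul_le_mul_of_nonneg_left ?_ (abs_nonneg _)
    have hi : ((i : ℕ) : ℝ) ≤ m := by exact_mod_cast i.2.le
    have h1 : |((i : ℕ) : ℝ) * z| ≤ m * (A / ρ) := by
      rw [abs_mul, Nat.abs_cast]; gcongr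
    have h2 : |((i : ℕ) : ℝ) * z| ≤ m := by
      rw [abs_mul, Nat.abs_cast]
      calc _ ≤ (m : ℝ) * 1 := by gcongr
        _ = m := mul_one _
    refine (hC _ h2).trans ?_
    rw [mul_assoc, ← mul_pow]
    gcongr
  calc _ ≤ ρ ^ k * ((∑ i, |γ i|) * (C * (m : ℝ) ^ m * (A / ρ) ^ m)) := by gcongr
    _ = _ := by rw [div_pow]; ring

/-! ### Polynomials from one layer of logistic neurons -/

/-- Inclusion-exclusion over the supersets of `R`, by expanding `∏ i, (1 - 1_{i ∉ R})`. -/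
theorem sum_sign_superset {n : ℕ} (R : Finset (Fin n)) :
    ∑ T : Finset (Fin n), (-1 : ℝ) ^ (Tᶜ.card) * (if R ⊆ T then 1 else 0)
      = if R = Finset.univ then 1 else 0 := by
  have h := Finset.prod_add (fun _ : Fin n => (1 : ℝ)) (fun i => -(if i ∈ R then (0 : ℝ) else 1))
    Finset.univ
  have h1 : ∏ i : Fin n, ((1 : ℝ) + -(if i ∈ R then (0 : ℝ) else 1))
      = if R = Finset.univ then 1 else 0 := by
    split_ifs with hR
    · subst hR; simp
    · obtain ⟨i, hi⟩ : ∃ i, i ∉ R := by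
        by_contra! hc; exact hR (Finset.eq_univ_iff_forall.2 hc)
      exact Finset.prod_eq_zero (Finset.mem_univ i) (by simp [hi])
  rw [← h1, h, Finset.powerset_univ]
  refine Finset.sum_congr rfl fun T _ => ?_
  rw [Finset.prod_const_one, one_mul, ← Finset.compl_eq_univ_sdiff]
  have h2 : ∏ i ∈ Tᶜ, -(if i ∈ R then (0 : ℝ) else 1)
      = (-1) ^ Tᶜ.card * ∏ i ∈ Tᶜ, (if i ∈ R then (0 : ℝ) else 1) := by
    rw [← Finset.prod_const, ← Finset.prod_mul_distrib]
    exact Finset.prod_congr rfl fun i _ => by ring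
  rw [h2]
  congr 1
  split_ifs with hR
  · symm
    refine Finset.prod_eq_one fun i hi => ?_
    rw [if_neg]
    intro hiR
    exact (Finset.mem_compl.1 hi) (hR hiR)
  · obtain ⟨i, hi, hiT⟩ := Finset.not_subset.1 hR
    exact (Finset.prod_eq_zero (Finset.mem_compl.2 hiT) (by simp [hi])).symm

/-- Polarization: a product of `n` variables is a linear combination of `n`-th powers of their
partial sums. -/
theorem exists_polarization (n : ℕ) :
    ∃ c : Finset (Fin n) → ℝ, ∀ x : Fin n → ℝ, ∏ i, x i = ∑ T, c T * (∑ i ∈ T, x i) ^ n := by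
  classical
  set N : ℝ := ∑ f : Fin n → Fin n, if Function.Surjective f then 1 else 0 with hN
  have hN0 : N ≠ 0 := by
    have h1 : (1 : ℝ) ≤ N := by
      have := Finset.single_le_sum (f := fun f : Fin n → Fin n =>
        if Function.Surjective f then (1 : ℝ) else 0) (s := Finset.univ)
        (fun f _ => by split_ifs <;> norm_num) (Finset.mem_univ id)
      rw [hN]
      refine le_trans (le_of_eq ?_) this
      rw [if_pos Function.surjective_id]
    linarith
  refine ⟨fun T => N⁻¹ * (-1) ^ Tᶜ.card, fun x => ?_⟩
  have hpow : ∀ T : Finset (Fin n), (∑ i ∈ T, x i) ^ n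
      = ∑ f : Fin n → Fin n, (if Finset.univ.image f ⊆ T then 1 else 0) * ∏ j, x (f j) := by
    intro T
    have h1 : (∑ i ∈ T, x i) ^ n = ∏ _j : Fin n, ∑ i ∈ T, x i := by simp
    rw [h1, Finset.prod_univ_sum]
    simp only [ite_mul, one_mul, zero_mul]
    rw [← Finset.sum_filter]
    refine Finset.sum_congr ?_ fun _ _ => rfl
    ext f
    simp [Fintype.mem_piFinset, Finset.image_subset_iff]
  simp_rw [hpow, Finset.mul_sum]
  rw [Finset.sum_comm]
  have h2 : ∀ f : Fin n → Fin n, ∑ T : Finset (Fin n), N⁻¹ * (-1) ^ Tᶜ.card *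
      ((if Finset.univ.image f ⊆ T then 1 else 0) * ∏ j, x (f j))
      = N⁻¹ * (∏ j, x j) * (if Function.Surjective f then 1 else 0) := by
    intro f
    have h3 := sum_sign_superset (Finset.univ.image f)
    have h4 : ∑ T : Finset (Fin n), N⁻¹ * (-1) ^ Tᶜ.card *
      ((if Finset.univ.image f ⊆ T then 1 else 0) * ∏ j, x (f j))
      = N⁻¹ * (∏ j, x (f j)) * ∑ T : Finset (Fin n), (-1 : ℝ) ^ (Tᶜ.card) *
        (if Finset.univ.image f ⊆ T then 1 else 0) := by
      rw [Finset.mul_sum]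
      exact Finset.sum_congr rfl fun T _ => by ring
    rw [h4, h3]
    by_cases hs : Function.Surjective f
    · have hb : Function.Bijective f := Finite.surjective_iff_bijective.1 hs
      rw [if_pos (Finset.image_univ_of_surjective hs), if_pos hs,
        Function.Bijective.prod_comp hb]
    · rw [if_neg hs, if_neg, mul_zero, mul_zero]
      intro h
      refine hs fun b => ?_
      have := h ▸ Finset.mem_univ b
      obtain ⟨a, _, ha⟩ := Finset.mem_image.1 this
      exact ⟨a, ha⟩
  rw [Finset.sum_congr rfl fun f _ => h2 f, ← Finset.mul_sum, ← hN]
  field_simp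

theorem exists_ridge_data (k e : ℕ) :
    ∃ D : ℝ × (Fin (k + e + 1) → ℝ) × ℝ, 0 ≤ D.2.2 ∧ ∀ A ρ y : ℝ, 0 < ρ → A ≤ ρ → |y| ≤ A →
      |ρ ^ k * ∑ i, D.2.1 i * act (D.1 + i * (y / ρ)) - y ^ k|
        ≤ D.2.2 * A ^ (k + e + 1) * ρ ^ k / ρ ^ (k + e + 1) := by
  obtain ⟨t, γ, C, h0, h⟩ := exists_ridge (k + e + 1) k (by omega)
  exact ⟨⟨t, γ, C⟩, h0, h⟩

/-- Base point of the divided difference reproducing the `k`-th power with error order `e + 1`. -/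
def ridgePoint (k e : ℕ) : ℝ := (exists_ridge_data k e).choose.1

/-- Weights of the divided difference reproducing the `k`-th power with error order `e + 1`. -/
def ridgeWeight (k e : ℕ) : Fin (k + e + 1) → ℝ := (exists_ridge_data k e).choose.2.1

/-- Constant in the error bound for `ridge`. -/
def ridgeErr (k e : ℕ) : ℝ := (exists_ridge_data k e).choose.2.2

/-- The approximation of `y ^ k` by `k + e + 1` logistic neurons at scale `ρ`. -/
def ridge (k e : ℕ) (ρ y : ℝ) : ℝ :=
  ρ ^ k * ∑ i, ridgeWeight k e i * act (ridgePoint k e + (i : ℕ) * (y / ρ))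

theorem ridgeErr_nonneg (k e : ℕ) : 0 ≤ ridgeErr k e := (exists_ridge_data k e).choose_spec.1

theorem abs_ridge_sub_le (k e : ℕ) {A ρ y : ℝ} (hρ : 0 < ρ) (hA : A ≤ ρ) (hy : |y| ≤ A) :
    |ridge k e ρ y - y ^ k| ≤ ridgeErr k e * A ^ (k + e + 1) / ρ ^ (e + 1) := by
  refine ((exists_ridge_data k e).choose_spec.2 A ρ y hρ hA hy).trans (le_of_eq ?_)
  change ridgeErr k e * A ^ (k + e + 1) * ρ ^ k / ρ ^ (k + e + 1) = _
  rw [add_assoc k e 1, pow_add ρ k]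
  field_simp

/-- Approximate product of two numbers, from `x * y = ((x + y) ^ 2 - (x - y) ^ 2) / 4`. -/
def mulNet (ρ x y : ℝ) : ℝ := (ridge 2 0 ρ (x + y) - ridge 2 0 ρ (x - y)) / 4

theorem abs_mulNet_sub_le {A ρ x y : ℝ} (hρ : 0 < ρ) (hA : 2 * A ≤ ρ) (hx : |x| ≤ A)
    (hy : |y| ≤ A) : |mulNet ρ x y - x * y| ≤ 4 * ridgeErr 2 0 * A ^ 3 / ρ := by
  have h1 := abs_ridge_sub_le 2 0 hρ hA (y := x + y) ((abs_add_le x y).trans (by linarith))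
  have h2 := abs_ridge_sub_le 2 0 hρ hA (y := x - y) ((abs_sub x y).trans (by linarith))
  have h3 : mulNet ρ x y - x * y = ((ridge 2 0 ρ (x + y) - (x + y) ^ 2)
      - (ridge 2 0 ρ (x - y) - (x - y) ^ 2)) / 4 := by unfold mulNet; ring
  rw [h3, abs_div, abs_of_pos (by norm_num : (0 : ℝ) < 4)]
  have h4 := (abs_sub (ridge 2 0 ρ (x + y) - (x + y) ^ 2)
      (ridge 2 0 ρ (x - y) - (x - y) ^ 2)).trans (add_le_add h1 h2)
  refine (div_le_div_of_nonneg_right h4 (by norm_num)).trans (le_of_eq ?_)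
  norm_num
  ring

/-- Coefficients of the polarization identity for `n` factors. -/
def polarCoef (n : ℕ) : Finset (Fin n) → ℝ := (exists_polarization n).choose

theorem prod_eq_sum_polarCoef {n : ℕ} (x : Fin n → ℝ) :
    ∏ i, x i = ∑ T, polarCoef n T * (∑ i ∈ T, x i) ^ n := (exists_polarization n).choose_spec x

/-- Approximate product of `n` numbers with error order `e + 1`. -/
def prodNet (n e : ℕ) (ρ : ℝ) (x : Fin n → ℝ) : ℝ :=
  ∑ T, polarCoef n T * ridge n e ρ (∑ i ∈ T, x i)

theorem exists_abs_prodNet_sub_le (n e : ℕ) (A : ℝ) :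
    ∃ C, 0 ≤ C ∧ ∀ ρ : ℝ, 1 ≤ ρ → n * A ≤ ρ → ∀ x : Fin n → ℝ, (∀ i, |x i| ≤ A) →
      |prodNet n e ρ x - ∏ i, x i| ≤ C / ρ ^ (e + 1) := by
  refine ⟨|∑ T, |polarCoef n T| * (ridgeErr n e * (n * A) ^ (n + e + 1))|, abs_nonneg _,
    fun ρ hρ hA x hx => ?_⟩
  rw [prod_eq_sum_polarCoef]
  unfold prodNet
  rw [← Finset.sum_sub_distrib]
  refine (Finset.abs_sum_le_sum_abs _ _).trans ?_
  refine le_trans ?_ (div_le_div_of_nonneg_right (le_abs_self _) (by positivity))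
  rw [Finset.sum_div]
  refine Finset.sum_le_sum fun T _ => ?_
  rw [← mul_sub, abs_mul, mul_div_assoc]
  refine mul_le_mul_of_nonneg_left ?_ (abs_nonneg _)
  refine abs_ridge_sub_le n e (by linarith) hA ?_
  refine (Finset.abs_sum_le_sum_abs _ _).trans ?_
  calc ∑ i ∈ T, |x i| ≤ ∑ i, |x i| :=
        Finset.sum_le_sum_of_subset_of_nonneg (Finset.subset_univ _) fun _ _ _ => abs_nonneg _
    _ ≤ ∑ _i : Fin n, A := Finset.sum_le_sum fun i _ => hx i
    _ = n * A := by simp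

/-- Approximate identity. -/
def idNet (ρ y : ℝ) : ℝ := ridge 1 0 ρ y

theorem abs_idNet_sub_le {A ρ y : ℝ} (hρ : 0 < ρ) (hA : A ≤ ρ) (hy : |y| ≤ A) :
    |idNet ρ y - y| ≤ ridgeErr 1 0 * A ^ 2 / ρ := by
  have h := abs_ridge_sub_le 1 0 hρ hA hy
  simpa [idNet] using h

/-- Iterating the approximate identity a bounded number of times moves bounded inputs by
`O(1 / ρ)`. -/
theorem exists_abs_idNet_iterate_sub_le (n : ℕ) (A : ℝ) :
    ∃ C, 0 ≤ C ∧ ∀ ρ : ℝ, C ≤ ρ → 1 ≤ ρ → ∀ k ≤ n, ∀ y : ℝ, |y| ≤ A →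
      |(idNet ρ)^[k] y - y| ≤ C / ρ := by
  set c := ridgeErr 1 0 * (|A| + 1) ^ 2 with hc
  have hc0 : 0 ≤ c := mul_nonneg (ridgeErr_nonneg _ _) (by positivity)
  refine ⟨n * c + (|A| + 1), by positivity, fun ρ hCρ hρ k hk y hy => ?_⟩
  have hρ0 : 0 < ρ := by linarith
  have key : |(idNet ρ)^[k] y - y| ≤ k * c / ρ := by
    induction k with
    | zero => simp
    | succ k ih =>
      have ih' := ih (by omega)
      have hk' : (k : ℝ) * c ≤ n * c := by gcongr; omega
      have h1 : (k : ℝ) * c / ρ ≤ 1 := by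
        rw [div_le_one hρ0]; linarith [abs_nonneg A]
      have h2 : |(idNet ρ)^[k] y| ≤ |A| + 1 := by
        have h3 : |(idNet ρ)^[k] y| ≤ |(idNet ρ)^[k] y - y| + |y| := by
          simpa using abs_add_le ((idNet ρ)^[k] y - y) y
        linarith [le_abs_self A]
      have h4 := abs_idNet_sub_le hρ0 (A := |A| + 1) (by nlinarith [hc0]) h2
      rw [Function.iterate_succ_apply']
      have h5 := abs_add_le (idNet ρ ((idNet ρ)^[k] y) - (idNet ρ)^[k] y) ((idNet ρ)^[k] y - y)
      rw [sub_add_sub_cancel] at h5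
      refine h5.trans ((add_le_add h4 ih').trans (le_of_eq ?_))
      rw [← hc]; push_cast; ring
  refine key.trans ?_
  have hk' : (k : ℝ) * c ≤ n * c := by gcongr
  gcongr
  linarith [abs_nonneg A]

/-! ### A partition of unity with two layers of neurons -/

/-- Smooth step at the integer threshold `i`. The threshold `0` is always passed, so that the cell
weights have constant total mass also for points slightly outside of the grid. -/
def step (M : ℕ) (v : ℝ) (i : ℕ) : ℝ := if i = 0 then 1 else act ((M : ℝ) ^ 2 * (v - i))

/-- Smooth conjunction of the steps `k l` in the coordinates `v l`: the argument is close to `M / 2`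
if all `d` steps are passed, and at most about `-M / 2` otherwise. -/
def orthant {d : ℕ} (M : ℕ) (v : Fin d → ℝ) (k : Fin d → Fin M) : ℝ :=
  act (M * (∑ l, step M (v l) (k l) - d + 1 / 2))

/-- Matrix of the backward difference on `Fin M`. -/
def diffCoef {M : ℕ} (i k : Fin M) : ℝ :=
  (if k = i then 1 else 0) - (if (k : ℕ) = i + 1 then 1 else 0)

/-- The weight of the cell `i` of the unit grid: the mixed difference of the orthant functions at
its corners. -/
def cellWeight {d : ℕ} (M : ℕ) (v : Fin d → ℝ) (i : Fin d → Fin M) : ℝ :=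
  ∑ k, orthant M v k * ∏ l, diffCoef (i l) (k l)

/-- `v` lies in the interval `[i, i + 1]` up to `1 / M`. The first and the last interval are
unbounded, because there is no threshold beyond them. -/
def NearCell (M : ℕ) (v : ℝ) (i : ℕ) : Prop :=
  (i = 0 ∨ (i : ℝ) - 1 / M ≤ v) ∧ (i + 1 = M ∨ v ≤ i + 1 + 1 / M)

theorem step_le_one (M : ℕ) (v : ℝ) (i : ℕ) : step M v i ≤ 1 := by
  unfold step; split_ifs
  · norm_num
  · exact (act_lt_one _).le

theorem sum_diffCoef_left {M : ℕ} (k : Fin M) :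
    ∑ i, diffCoef i k = if (k : ℕ) = 0 then 1 else 0 := by
  unfold diffCoef
  rw [Finset.sum_sub_distrib]
  simp only [Finset.sum_ite_eq, Finset.mem_univ, if_true]
  rcases Nat.eq_zero_or_pos (k : ℕ) with h | h
  · rw [if_pos h, Finset.sum_eq_zero, sub_zero]
    intro i _
    rw [if_neg (by omega)]
  · rw [if_neg (by omega), Finset.sum_eq_single (⟨k - 1, by omega⟩ : Fin M)]
    · rw [if_pos (by simp only; omega), sub_self]
    · intro b _ hb
      rw [if_neg]
      intro hk
      exact hb (Fin.ext (by simp only; omega))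
    · simp

theorem sum_abs_diffCoef_le {M : ℕ} (i : Fin M) : ∑ k, |diffCoef i k| ≤ 2 := by
  have h1 : ∀ k : Fin M, |diffCoef i k| ≤ (if k = i then 1 else 0)
      + (if (k : ℕ) = i + 1 then 1 else 0) := by
    intro k
    unfold diffCoef
    split_ifs <;> norm_num
  refine (Finset.sum_le_sum fun k _ => h1 k).trans ?_
  rw [Finset.sum_add_distrib]
  have h2 : ∑ k : Fin M, (if (k : ℕ) = i + 1 then (1 : ℝ) else 0) ≤ 1 := by
    rw [Finset.sum_boole]
    have : (Finset.univ.filter fun k : Fin M => (k : ℕ) = i + 1).card ≤ 1 := by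
      rw [Finset.card_le_one]
      intro a ha b hb
      simp only [Finset.mem_filter, Finset.mem_univ, true_and] at ha hb
      exact Fin.ext (by omega)
    exact_mod_cast this
  simp only [Finset.sum_ite_eq', Finset.mem_univ, if_true]
  linarith

theorem sum_prod_abs_diffCoef_le {d M : ℕ} (i : Fin d → Fin M) :
    ∑ k : Fin d → Fin M, |∏ l, diffCoef (i l) (k l)| ≤ 2 ^ d := by
  simp_rw [Finset.abs_prod]
  rw [← Fintype.piFinset_univ, ← Finset.prod_univ_sum (fun _ => Finset.univ)
    (fun l k => |diffCoef (i l) k|)]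
  calc _ ≤ ∏ _l : Fin d, (2 : ℝ) :=
        Finset.prod_le_prod (fun l _ => Finset.sum_nonneg fun _ _ => abs_nonneg _)
          fun l _ => sum_abs_diffCoef_le (i l)
    _ = 2 ^ d := by simp

/-- The sum over the cells telescopes to the orthant neuron with all thresholds `0`, which is
constant. -/
theorem sum_cellWeight {d M : ℕ} (hM : 0 < M) (v : Fin d → ℝ) :
    ∑ i, cellWeight M v i = act (M / 2) := by
  unfold cellWeight
  rw [Finset.sum_comm]
  have h1 : ∀ k : Fin d → Fin M, ∑ i : Fin d → Fin M, orthant M v k * ∏ l, diffCoef (i l) (k l)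
      = if k = fun _ => ⟨0, hM⟩ then orthant M v k else 0 := by
    intro k
    rw [← Finset.mul_sum, ← Fintype.piFinset_univ, ← Finset.prod_univ_sum (fun _ => Finset.univ)
      (fun l i => diffCoef i (k l))]
    simp_rw [sum_diffCoef_left]
    split_ifs with h
    · subst h; simp
    · obtain ⟨l, hl⟩ := Function.ne_iff.1 h
      rw [Finset.prod_eq_zero (Finset.mem_univ l), mul_zero]
      rw [if_neg]
      intro h0
      exact hl (Fin.ext h0)
  rw [Finset.sum_congr rfl fun k _ => h1 k]
  simp only [Finset.sum_ite_eq', Finset.mem_univ, if_true]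
  unfold orthant step
  simp
  ring_nf

theorem abs_cellWeight_le {d M : ℕ} (v : Fin d → ℝ) (i : Fin d → Fin M) :
    |cellWeight M v i| ≤ 2 ^ d := by
  refine (Finset.abs_sum_le_sum_abs _ _).trans (le_trans ?_ (sum_prod_abs_diffCoef_le i))
  refine Finset.sum_le_sum fun k _ => ?_
  rw [abs_mul]
  have : |orthant M v k| ≤ 1 := by
    unfold orthant; rw [abs_of_pos (act_pos _)]; exact (act_lt_one _).le
  calc _ ≤ 1 * |∏ l, diffCoef (i l) (k l)| := by gcongr
    _ = _ := one_mul _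

theorem diffCoef_swap {M : ℕ} (i j k : Fin M) (hj : (j : ℕ) = i + 1) :
    diffCoef i (Equiv.swap i j k) = -diffCoef i k := by
  have hji : j ≠ i := by rintro rfl; omega
  have hv : ∀ k : Fin M, ((k : ℕ) = i + 1) ↔ k = j := fun k => by rw [Fin.ext_iff, hj]
  unfold diffCoef
  simp only [hv]
  rcases eq_or_ne k i with h | h
  · subst h; simp [hji, hji.symm]
  · rcases eq_or_ne k j with h' | h'
    · subst h'; simp [hji.symm, hji]
    · rw [Equiv.swap_apply_of_ne_of_ne h h']; simp [h, h']

/-- A mixed difference annihilates functions that do not depend on one of the coordinates. -/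
theorem sum_mul_prod_diffCoef_eq_zero {d M : ℕ} (i : Fin d → Fin M) (l : Fin d)
    (hl : (i l : ℕ) + 1 < M) (G : (Fin d → Fin M) → ℝ)
    (hG : ∀ k b, G (Function.update k l b) = G k) :
    ∑ k, G k * ∏ l, diffCoef (i l) (k l) = 0 := by
  set j : Fin M := ⟨i l + 1, hl⟩
  let e : (Fin d → Fin M) ≃ (Fin d → Fin M) :=
    Equiv.piCongrRight fun l' => if l' = l then Equiv.swap (i l) j else Equiv.refl _
  have he : ∀ k, e k = Function.update k l (Equiv.swap (i l) j (k l)) := by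
    intro k
    funext l'
    rcases eq_or_ne l' l with h | h
    · subst h; simp [e]
    · simp [e, h]
  have h1 := Equiv.sum_comp e fun k => G k * ∏ l, diffCoef (i l) (k l)
  have h2 : ∀ k, G (e k) * ∏ l, diffCoef (i l) (e k l)
      = -(G k * ∏ l, diffCoef (i l) (k l)) := by
    intro k
    rw [he, hG]
    rw [← Finset.mul_prod_erase _ _ (Finset.mem_univ l), Function.update_self,
      diffCoef_swap _ _ _ rfl, ← Finset.mul_prod_erase _ (fun l => diffCoef (i l) (k l))
        (Finset.mem_univ l)]
    have h3 : ∏ x ∈ Finset.univ.erase l,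
        diffCoef (i x) (Function.update k l ((Equiv.swap (i l) j) (k l)) x)
        = ∏ x ∈ Finset.univ.erase l, diffCoef (i x) (k x) := by
      refine Finset.prod_congr rfl fun x hx => ?_
      rw [Function.update_of_ne (Finset.ne_of_mem_erase hx)]
    rw [h3]; ring
  simp_rw [h2] at h1
  rw [Finset.sum_neg_distrib] at h1
  linarith

theorem diffCoef_ne_zero {M : ℕ} {i k : Fin M} (h : diffCoef i k ≠ 0) :
    k = i ∨ (k : ℕ) = i + 1 := by
  by_contra! hc
  exact h (by simp [diffCoef, hc.1, hc.2])

theorem abs_sum_mul_prod_diffCoef_le {d M : ℕ} (i : Fin d → Fin M) (G : (Fin d → Fin M) → ℝ)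
    (η : ℝ) (hη : 0 ≤ η) (hG : ∀ k, (∀ l, k l = i l ∨ (k l : ℕ) = i l + 1) → |G k| ≤ η) :
    |∑ k, G k * ∏ l, diffCoef (i l) (k l)| ≤ 2 ^ d * η := by
  refine (Finset.abs_sum_le_sum_abs _ _).trans ?_
  calc _ ≤ ∑ k : Fin d → Fin M, |∏ l, diffCoef (i l) (k l)| * η := by
        refine Finset.sum_le_sum fun k _ => ?_
        rw [abs_mul, mul_comm]
        by_cases h : ∀ l, k l = i l ∨ (k l : ℕ) = i l + 1
        · exact mul_le_mul_of_nonneg_left (hG k h) (abs_nonneg _)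
        · obtain ⟨l, hl⟩ := not_forall.1 h
          have : diffCoef (i l) (k l) = 0 := by
            by_contra h0; exact hl (diffCoef_ne_zero h0)
          rw [Finset.prod_eq_zero (Finset.mem_univ l) this]; simp
    _ ≤ _ := by
        rw [← Finset.sum_mul]
        exact mul_le_mul_of_nonneg_right (sum_prod_abs_diffCoef_le i) hη

/-- The weight of a cell is exponentially small as soon as one coordinate stays away from it. -/
theorem abs_cellWeight_le_of_not_near {d M : ℕ} (hM : 2 ≤ M) (v : Fin d → ℝ)
    (i : Fin d → Fin M) (h : ¬ ∀ l, NearCell M (v l) (i l)) :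
    |cellWeight M v i| ≤ 2 ^ d * (M * Real.exp (-(M / 4))) := by
  have hM' : (2 : ℝ) ≤ M := by exact_mod_cast hM
  have hM0 : (0 : ℝ) < M := by linarith
  have he4 : Real.exp (-(M : ℝ)) ≤ 1 / 4 := by
    have h1 : Real.exp (-(M : ℝ)) ≤ Real.exp (-2) := Real.exp_le_exp.2 (by linarith)
    have h2 : Real.exp (-2) = (Real.exp (-1)) ^ 2 := by rw [← Real.exp_nat_mul]; norm_num
    have h3 := Real.exp_neg_one_lt_d9
    have h4 := Real.exp_pos (-1)
    nlinarith
  obtain ⟨l, hl⟩ := not_forall.1 h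
  rw [NearCell, not_and_or, not_or, not_or, not_le, not_le] at hl
  rcases hl with ⟨hi0, hlow⟩ | ⟨hiM, hhigh⟩
  · refine abs_sum_mul_prod_diffCoef_le i _ _ (by positivity) fun k hk => ?_
    -- Below the cell, the step in the coordinate `l` fails at both corners.
    have hk0 : (k l : ℕ) ≠ 0 := by
      rcases hk l with h | h
      · rw [h]; exact hi0
      · omega
    have hkge : ((i l : ℕ) : ℝ) ≤ (k l : ℕ) := by
      rcases hk l with h | h
      · rw [h]
      · rw [h]; push_cast; linarith
    have hs : step M (v l) (k l) ≤ 1 / 4 := by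
      unfold step
      rw [if_neg hk0]
      refine (act_le_exp _).trans (le_trans (Real.exp_le_exp.2 ?_) he4)
      have : v l - (k l : ℕ) ≤ -(1 / M) := by linarith
      calc (M : ℝ) ^ 2 * (v l - (k l : ℕ)) ≤ (M : ℝ) ^ 2 * (-(1 / (M : ℝ))) := by gcongr
        _ = -(M : ℝ) := by field_simp
    have hsum : ∑ l, step M (v l) (k l) ≤ d - 1 + 1 / 4 := by
      rw [← Finset.add_sum_erase _ _ (Finset.mem_univ l)]
      have : ∑ x ∈ Finset.univ.erase l, step M (v x) (k x) ≤ d - 1 := by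
        calc _ ≤ ∑ x ∈ Finset.univ.erase l, (1 : ℝ) :=
              Finset.sum_le_sum fun x _ => step_le_one _ _ _
          _ = d - 1 := by
              have hd : 1 ≤ d := by have := l.2; omega
              simp [Finset.card_erase_of_mem, Nat.cast_sub hd]
      linarith
    rw [orthant, abs_of_pos (act_pos _)]
    calc _ ≤ Real.exp (M * (∑ l, step M (v l) (k l) - d + 1 / 2)) := act_le_exp _
      _ ≤ Real.exp (-(M / 4)) := by
          refine Real.exp_le_exp.2 ?_
          have : ∑ l, step M (v l) (k l) - d + 1 / 2 ≤ -(1 / 4) := by linarith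
          nlinarith
      _ ≤ M * Real.exp (-(M / 4)) := by
          have := Real.exp_pos (-((M : ℝ) / 4)); nlinarith
  · have hlt : (i l : ℕ) + 1 < M := by have := (i l).2; omega
    -- Above the cell, the step in the coordinate `l` is passed at both corners. Replacing it by `1`
    -- changes the difference little, and makes it vanish.
    set G : (Fin d → Fin M) → ℝ := fun k =>
      act (M * (∑ x ∈ Finset.univ.erase l, step M (v x) (k x) + 1 - d + 1 / 2)) with hGdef
    have hG0 := sum_mul_prod_diffCoef_eq_zero i l hlt G (by
      intro k b
      simp only [hGdef]
      have : ∑ x ∈ Finset.univ.erase l, step M (v x) (Function.update k l b x)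
          = ∑ x ∈ Finset.univ.erase l, step M (v x) (k x) :=
        Finset.sum_congr rfl fun x hx => by
          rw [Function.update_of_ne (Finset.ne_of_mem_erase hx)]
      rw [this])
    have hsub : cellWeight M v i
        = ∑ k, (orthant M v k - G k) * ∏ l, diffCoef (i l) (k l) := by
      simp_rw [sub_mul]
      rw [Finset.sum_sub_distrib, hG0, sub_zero]; rfl
    rw [hsub]
    refine abs_sum_mul_prod_diffCoef_le i _ _ (by positivity) fun k hk => ?_
    have hkle : ((k l : ℕ) : ℝ) ≤ (i l : ℕ) + 1 := by
      rcases hk l with h | h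
      · rw [h]; linarith
      · rw [h]; push_cast; linarith
    have hs : 1 - step M (v l) (k l) ≤ Real.exp (-M) := by
      unfold step
      split_ifs with h0
      · simp [(Real.exp_pos _).le]
      · refine (one_sub_act_le_exp _).trans (Real.exp_le_exp.2 ?_)
        have : 1 / M ≤ v l - (k l : ℕ) := by linarith
        have h2 : (M : ℝ) ^ 2 * (1 / M) ≤ (M : ℝ) ^ 2 * (v l - (k l : ℕ)) := by gcongr
        have h3 : (M : ℝ) ^ 2 * (1 / M) = M := by field_simp
        linarith
    have hs1 := step_le_one M (v l) (k l)
    rw [orthant]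
    refine (abs_act_sub_le _ _).trans ?_
    rw [← Finset.add_sum_erase _ _ (Finset.mem_univ l), ← mul_sub, abs_mul, abs_of_pos hM0]
    refine mul_le_mul_of_nonneg_left ?_ hM0.le
    rw [show step M (v l) (k l) + ∑ x ∈ Finset.univ.erase l, step M (v x) (k x) - d + 1 / 2
      - (∑ x ∈ Finset.univ.erase l, step M (v x) (k x) + 1 - d + 1 / 2)
      = -(1 - step M (v l) (k l)) by ring, abs_neg, abs_of_nonneg (by linarith)]
    exact hs.trans (Real.exp_le_exp.2 (by linarith))

open Classical in
theorem card_nearCell_le (M : ℕ) (hM : 1 ≤ M) (v : ℝ) :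
    (Finset.univ.filter fun i : Fin M => NearCell M v i).card ≤ 4 := by
  have hM' : (1 : ℝ) ≤ M := by exact_mod_cast hM
  have hinv : 1 / (M : ℝ) ≤ 1 := by rw [div_le_one (by linarith)]; exact hM'
  set w : ℝ := max 0 (min v M) with hw
  have hsub : ((Finset.univ.filter fun i : Fin M => NearCell M v i).image
      fun i : Fin M => ((i : ℕ) : ℤ)) ⊆ Finset.Icc (⌈w - 2⌉) (⌊w + 1⌋) := by
    intro z hz
    obtain ⟨i, hi, rfl⟩ := Finset.mem_image.1 hz
    obtain ⟨h1, h2⟩ := (Finset.mem_filter.1 hi).2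
    have hiM : ((i : ℕ) : ℝ) + 1 ≤ M := by exact_mod_cast i.2
    have hi0 : (0 : ℝ) ≤ (i : ℕ) := Nat.cast_nonneg _
    rw [Finset.mem_Icc, Int.ceil_le, Int.le_floor]
    push_cast
    constructor
    · have : w ≤ (i : ℕ) + 2 := by
        refine max_le (by linarith) ?_
        rcases h2 with h2 | h2
        · refine (min_le_right _ _).trans ?_
          have : ((i : ℕ) : ℝ) + 1 = M := by exact_mod_cast h2
          linarith
        · refine (min_le_left _ _).trans (by linarith)
      linarith
    · rcases h1 with h1 | h1
      · rw [h1]; simp only [Nat.cast_zero]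
        linarith [le_max_left 0 (min v M)]
      · have : ((i : ℕ) : ℝ) - 1 ≤ min v M := le_min (by linarith) (by linarith)
        linarith [le_max_right 0 (min v M)]
  have hcard := Finset.card_le_card hsub
  rw [Finset.card_image_of_injective _ (fun a b h => Fin.ext (by simpa using h)),
    Int.card_Icc] at hcard
  refine hcard.trans ?_
  have h3 : ⌊w + 1⌋ ≤ w + 1 := Int.floor_le _
  have h4 : w - 2 ≤ ⌈w - 2⌉ := Int.le_ceil _
  have h5 : ((⌊w + 1⌋ + 1 - ⌈w - 2⌉ : ℤ) : ℝ) ≤ (4 : ℤ) := by push_cast; linarith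
  have h6 : ⌊w + 1⌋ + 1 - ⌈w - 2⌉ ≤ 4 := by exact_mod_cast h5
  omega

/-- Bound for the total weight of the cells away from the point. -/
def cellTail (d M : ℕ) : ℝ := (M : ℝ) ^ d * (2 ^ d * (M * Real.exp (-(M / 4))))

open Classical in
/-- Sums against the cell weights are controlled by the cells near the point. -/
theorem sum_abs_cellWeight_mul_le {d M : ℕ} (hM : 2 ≤ M) (v : Fin d → ℝ)
    (φ : (Fin d → Fin M) → ℝ) (a b : ℝ) (ha0 : 0 ≤ a) (hb0 : 0 ≤ b)
    (ha : ∀ i, (∀ l, NearCell M (v l) (i l)) → φ i ≤ a) (hb : ∀ i, φ i ≤ b) :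
    ∑ i, |cellWeight M v i| * φ i ≤ 8 ^ d * a + cellTail d M * b := by
  have h1 : ∀ i, |cellWeight M v i| * φ i ≤
      (if ∀ l, NearCell M (v l) (i l) then 2 ^ d * a else 0)
        + 2 ^ d * (M * Real.exp (-(M / 4))) * b := by
    intro i
    split_ifs with h
    · have h2 : |cellWeight M v i| * φ i ≤ 2 ^ d * a :=
        (mul_le_mul_of_nonneg_left (ha i h) (abs_nonneg _)).trans
          (mul_le_mul_of_nonneg_right (abs_cellWeight_le v i) ha0)
      have : 0 ≤ 2 ^ d * (M * Real.exp (-(M / 4))) * b := by positivity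
      linarith
    · rw [zero_add]
      exact (mul_le_mul_of_nonneg_left (hb i) (abs_nonneg _)).trans
          (mul_le_mul_of_nonneg_right (abs_cellWeight_le_of_not_near hM v i h) hb0)
  refine (Finset.sum_le_sum fun i _ => h1 i).trans ?_
  rw [Finset.sum_add_distrib]
  refine add_le_add ?_ (le_of_eq ?_)
  · rw [← Finset.sum_filter, Finset.sum_const, nsmul_eq_mul]
    have h3 : (Finset.univ.filter fun i : Fin d → Fin M => ∀ l, NearCell M (v l) (i l)).card
        ≤ 4 ^ d := by
      have h4 : (Finset.univ.filter fun i : Fin d → Fin M => ∀ l, NearCell M (v l) (i l))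
          ⊆ Fintype.piFinset fun l => Finset.univ.filter fun i : Fin M => NearCell M (v l) i := by
        intro i hi
        rw [Fintype.mem_piFinset]
        intro l
        simpa using (Finset.mem_filter.1 hi).2 l
      refine (Finset.card_le_card h4).trans ?_
      rw [Fintype.card_piFinset]
      calc _ ≤ ∏ _l : Fin d, 4 :=
            Finset.prod_le_prod' fun l _ => card_nearCell_le M (by omega) (v l)
        _ = 4 ^ d := by simp
    have h5 : ((Finset.univ.filter fun i : Fin d → Fin M =>
        ∀ l, NearCell M (v l) (i l)).card : ℝ) ≤ 4 ^ d := by exact_mod_cast h3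
    calc _ ≤ (4 : ℝ) ^ d * (2 ^ d * a) := by gcongr
      _ = 8 ^ d * a := by rw [← mul_assoc, ← mul_pow]; norm_num
  · rw [Finset.sum_const, Finset.card_univ, nsmul_eq_mul]
    simp [cellTail]; ring

/-- The tail of the cell weights decays faster than any power. -/
theorem exists_cellTail_le (d N : ℕ) : ∃ C, 0 ≤ C ∧ ∀ M : ℕ, 1 ≤ M →
    cellTail d M ≤ C / (M : ℝ) ^ N := by
  refine ⟨2 ^ d * (4 ^ (d + 1 + N) * (d + 1 + N).factorial), by positivity, fun M hM => ?_⟩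
  have hM0 : (0 : ℝ) < M := by exact_mod_cast hM
  rw [le_div_iff₀ (by positivity)]
  have h1 := Real.pow_div_factorial_le_exp ((M : ℝ) / 4) (by positivity) (d + 1 + N)
  rw [div_le_iff₀ (by positivity), div_pow, div_le_iff₀ (by positivity)] at h1
  have h2 : Real.exp ((M : ℝ) / 4) * Real.exp (-(M / 4)) = 1 := by
    rw [← Real.exp_add]; simp
  calc cellTail d M * (M : ℝ) ^ N
      = 2 ^ d * ((M : ℝ) ^ (d + 1 + N) * Real.exp (-(M / 4))) := by
        unfold cellTail; rw [pow_add, pow_add]; ring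
    _ ≤ 2 ^ d * (Real.exp ((M : ℝ) / 4) * ((d + 1 + N).factorial : ℝ) * 4 ^ (d + 1 + N)
          * Real.exp (-(M / 4))) := by gcongr
    _ = 2 ^ d * (4 ^ (d + 1 + N) * (d + 1 + N).factorial)
          * (Real.exp ((M : ℝ) / 4) * Real.exp (-(M / 4))) := by ring
    _ = _ := by rw [h2, mul_one]

/-! ### Folding the line onto one cell -/

/-- Slope change of the zigzag `fold` at the integer `i`. -/
def foldCoef (i : ℕ) : ℝ := if i = 0 then 0 else 2 * (-1) ^ i

/-- On `[0, M]`, the distance to the nearest even integer, as a sum of ramps. -/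
def fold (M : ℕ) (v : ℝ) : ℝ := v + ∑ i ∈ Finset.range M, foldCoef i * max (v - i) 0

/-- The even endpoint of the interval `[i, i + 1]`. -/
def evenEnd (i : ℕ) : ℕ := 2 * ((i + 1) / 2)

/-- The point of `[i, i + 1]` that `fold` maps to `j / M`. -/
def corner (M i j : ℕ) : ℝ := evenEnd i + (if Even i then 1 else -1) * (j / M)

theorem evenEnd_of_even {i : ℕ} (h : Even i) : evenEnd i = i := by
  obtain ⟨k, rfl⟩ := h; unfold evenEnd; omega

theorem evenEnd_of_not_even {i : ℕ} (h : ¬ Even i) : evenEnd i = i + 1 := by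
  obtain ⟨k, rfl⟩ := Nat.not_even_iff_odd.1 h; unfold evenEnd; omega

theorem abs_foldCoef_le (i : ℕ) : |foldCoef i| ≤ 2 := by
  unfold foldCoef
  split_ifs
  · simp
  · simp [abs_mul]

/-- On the interval `[n, n + 1]`, the sum of the ramps that have started is the signed distance to
the even endpoint. -/
theorem foldCoef_sum (n : ℕ) (v : ℝ) :
    v + ∑ i ∈ Finset.range (n + 1), foldCoef i * (v - i)
      = (if Even n then 1 else -1) * (v - evenEnd n) := by
  induction n with
  | zero => simp [foldCoef, evenEnd]
  | succ n ih =>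
    rw [Finset.sum_range_succ, ← add_assoc, ih]
    by_cases h : Even n
    · have h1 : ¬ Even (n + 1) := by rw [Nat.even_add_one]; exact not_not.2 h
      rw [evenEnd_of_even h, evenEnd_of_not_even h1, if_pos h, if_neg h1, foldCoef,
        if_neg (Nat.succ_ne_zero n), (Nat.not_even_iff_odd.1 h1).neg_one_pow]
      push_cast; ring
    · have h1 : Even (n + 1) := Nat.even_add_one.2 h
      rw [evenEnd_of_even h1, evenEnd_of_not_even h, if_pos h1, if_neg h, foldCoef,
        if_neg (Nat.succ_ne_zero n), h1.neg_one_pow]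
      push_cast; ring

theorem fold_eq_signed {M i : ℕ} (hi : i < M) {v : ℝ} (h0 : (i : ℝ) ≤ v) (h1 : v ≤ i + 1) :
    fold M v = (if Even i then 1 else -1) * (v - evenEnd i) := by
  rw [← foldCoef_sum, fold]
  congr 1
  rw [← Finset.sum_range_add_sum_Ico _ (Nat.succ_le_of_lt hi)]
  have h2 : ∑ k ∈ Finset.Ico (i + 1) M, foldCoef k * max (v - k) 0 = 0 := by
    refine Finset.sum_eq_zero fun k hk => ?_
    have : ((i + 1 : ℕ) : ℝ) ≤ k := by exact_mod_cast (Finset.mem_Ico.1 hk).1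
    push_cast at this
    rw [max_eq_right (by linarith), mul_zero]
  rw [Nat.succ_eq_add_one, h2, add_zero]
  refine Finset.sum_congr rfl fun k hk => ?_
  have : (k : ℝ) ≤ i := by exact_mod_cast Nat.lt_succ_iff.1 (Finset.mem_range.1 hk)
  rw [max_eq_left (by linarith)]

theorem fold_eq_abs {M i : ℕ} (hi : i < M) {v : ℝ} (h0 : (i : ℝ) ≤ v) (h1 : v ≤ i + 1) :
    fold M v = |v - evenEnd i| := by
  rw [fold_eq_signed hi h0 h1]
  split_ifs with h
  · rw [evenEnd_of_even h, abs_of_nonneg (by linarith), one_mul]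
  · rw [evenEnd_of_not_even h, abs_of_nonpos (by push_cast; linarith)]; ring

theorem exists_cell {M : ℕ} (hM : 0 < M) {v : ℝ} (h0 : 0 ≤ v) (h1 : v ≤ M) :
    ∃ i < M, (i : ℝ) ≤ v ∧ v ≤ i + 1 := by
  rcases h1.lt_or_eq with h | h
  · exact ⟨⌊v⌋₊, (Nat.floor_lt h0).2 h, Nat.floor_le h0, (Nat.lt_floor_add_one v).le⟩
  · refine ⟨M - 1, by omega, ?_⟩
    rw [Nat.cast_sub hM, h]; constructor <;> simp

theorem fold_mem {M : ℕ} (hM : 0 < M) {v : ℝ} (h0 : 0 ≤ v) (h1 : v ≤ M) :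
    0 ≤ fold M v ∧ fold M v ≤ 1 := by
  obtain ⟨i, hi, h2, h3⟩ := exists_cell hM h0 h1
  rw [fold_eq_abs hi h2 h3]
  refine ⟨abs_nonneg _, abs_le.2 ?_⟩
  by_cases h : Even i
  · rw [evenEnd_of_even h]; constructor <;> linarith
  · rw [evenEnd_of_not_even h]; push_cast; constructor <;> linarith

theorem abs_sub_evenEnd_le {i : ℕ} {v : ℝ} (h0 : (i : ℝ) ≤ v) (h1 : v ≤ i + 1) (k : ℕ) :
    |v - evenEnd i| ≤ |v - evenEnd k| := by
  have hv : |v - evenEnd i| ≤ 1 := by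
    refine abs_le.2 ?_
    by_cases h : Even i
    · rw [evenEnd_of_even h]; constructor <;> linarith
    · rw [evenEnd_of_not_even h]; push_cast; constructor <;> linarith
  rcases lt_trichotomy ((i + 1) / 2) ((k + 1) / 2) with h | h | h
  · have h2 : evenEnd i + 2 ≤ evenEnd k := by unfold evenEnd; omega
    have h3 : ((evenEnd i : ℕ) : ℝ) + 2 ≤ evenEnd k := by exact_mod_cast h2
    have h4 := neg_abs_le (v - evenEnd k)
    have h5 := le_abs_self (v - evenEnd i)
    linarith
  · rw [evenEnd, h, ← evenEnd]
  · have h2 : evenEnd k + 2 ≤ evenEnd i := by unfold evenEnd; omega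
    have h3 : ((evenEnd k : ℕ) : ℝ) + 2 ≤ evenEnd i := by exact_mod_cast h2
    have h4 := le_abs_self (v - evenEnd k)
    have h5 := neg_abs_le (v - evenEnd i)
    linarith

theorem fold_sub_le {M : ℕ} (hM : 0 < M) {v w : ℝ} (h0 : 0 ≤ v) (h1 : v ≤ M) (h2 : 0 ≤ w)
    (h3 : w ≤ M) : fold M v - fold M w ≤ |v - w| := by
  obtain ⟨i, hi, hi0, hi1⟩ := exists_cell hM h0 h1
  obtain ⟨k, hk, hk0, hk1⟩ := exists_cell hM h2 h3
  rw [fold_eq_abs hi hi0 hi1, fold_eq_abs hk hk0 hk1]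
  have h4 := abs_sub_evenEnd_le hi0 hi1 k
  have h5 := abs_sub_abs_le_abs_sub (v - evenEnd k) (w - evenEnd k)
  rw [sub_sub_sub_cancel_right] at h5
  linarith

theorem corner_mem {M i j : ℕ} (hj : j < M) :
    (i : ℝ) ≤ corner M i j ∧ corner M i j ≤ i + 1 := by
  have hM : (0 : ℝ) < M := by exact_mod_cast (Nat.zero_le j).trans_lt hj
  have h0 : (0 : ℝ) ≤ (j : ℝ) / M := by positivity
  have h1 : (j : ℝ) / M ≤ 1 := by rw [div_le_one hM]; exact_mod_cast hj.le
  unfold corner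
  by_cases h : Even i
  · rw [evenEnd_of_even h, if_pos h]; constructor <;> linarith
  · rw [evenEnd_of_not_even h, if_neg h]; push_cast; constructor <;> linarith

theorem abs_sub_corner {M i j : ℕ} (hi : i < M) {v : ℝ} (h0 : (i : ℝ) ≤ v) (h1 : v ≤ i + 1) :
    |v - corner M i j| = |fold M v - j / M| := by
  rw [fold_eq_signed hi h0 h1, corner]
  split_ifs
  · congr 1; ring
  · rw [← abs_neg]; congr 1; ring

/-- If perturbations of `v` and of its rescaled fold position are near the cells `i` and `j`, then
`v` is within `O(1 / M)` of the corner of the fine cell `(i, j)`. -/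
theorem abs_sub_corner_le {M i j : ℕ} (hi : i < M) {v v' w' c : ℝ} (hv0 : 0 ≤ v)
    (hvM : v ≤ M) (hv' : |v' - v| ≤ 1 / M) (hw' : |w' - M * fold M v| ≤ c)
    (hni : NearCell M v' i) (hnj : NearCell M w' j) :
    |v - corner M i j| ≤ (c + 6) / M := by
  have hM0 : 0 < M := (Nat.zero_le i).trans_lt hi
  have hM : (1 : ℝ) ≤ M := by exact_mod_cast hM0
  have hMp : (0 : ℝ) < M := by linarith
  have hinv : 1 / (M : ℝ) ≤ 1 := by rw [div_le_one hMp]; exact hM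
  have hinv0 : 0 < 1 / (M : ℝ) := by positivity
  obtain ⟨hv1, hv2⟩ := abs_le.1 hv'
  obtain ⟨hw1, hw2⟩ := abs_le.1 hw'
  obtain ⟨hf0, hf1⟩ := fold_mem hM0 hv0 hvM
  have hiM : (i : ℝ) + 1 ≤ M := by exact_mod_cast hi
  have hi0 : (0 : ℝ) ≤ i := Nat.cast_nonneg i
  -- The zigzag is isometric on the cell `i` only, hence the projection `ξ` of `v` to this cell.
  set ξ : ℝ := max (i : ℝ) (min v (i + 1)) with hξ
  have hξ0 : (i : ℝ) ≤ ξ := le_max_left _ _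
  have hξ1 : ξ ≤ i + 1 := max_le (by linarith) (min_le_right _ _)
  have hvξ : |v - ξ| ≤ 2 / M := by
    have h2 : 2 / (M : ℝ) = 1 / M + 1 / M := by ring
    rw [h2]
    rcases lt_or_ge v i with h | h
    · have : ξ = i := by rw [hξ, min_eq_left (by linarith), max_eq_left h.le]
      rw [this, abs_of_nonpos (by linarith)]
      rcases hni.1 with h3 | h3
      · rw [h3] at h; simp only [Nat.cast_zero] at h; linarith
      · linarith
    · rcases le_or_gt v (i + 1) with h' | h'
      · have : ξ = v := by rw [hξ, min_eq_left h', max_eq_right h]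
        rw [this]; simp
      · have : ξ = i + 1 := by rw [hξ, min_eq_right h'.le, max_eq_right (by linarith)]
        rw [this, abs_of_nonneg (by linarith)]
        rcases hni.2 with h3 | h3
        · have : (i : ℝ) + 1 = M := by exact_mod_cast h3
          linarith
        · linarith
  have hc0 : 0 ≤ c := (abs_nonneg _).trans hw'
  have hfj : |fold M v - j / M| ≤ (c + 2) / M := by
    have h4 : |M * fold M v - j| ≤ c + 2 := by
      refine abs_le.2 ⟨?_, ?_⟩
      · rcases hnj.1 with h3 | h3
        · rw [h3]; simp only [Nat.cast_zero]; nlinarith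
        · linarith
      · rcases hnj.2 with h3 | h3
        · have : (j : ℝ) + 1 = M := by exact_mod_cast h3
          nlinarith
        · linarith
    have h5 : fold M v - j / M = (M * fold M v - j) / M := by field_simp
    rw [h5, abs_div, abs_of_pos hMp]
    gcongr
  have hξv : |fold M ξ - fold M v| ≤ |v - ξ| := by
    have h6 := fold_sub_le hM0 (v := ξ) (w := v) (by linarith) (by linarith) hv0 hvM
    have h7 := fold_sub_le hM0 (v := v) (w := ξ) hv0 hvM (by linarith) (by linarith)
    rw [abs_sub_comm] at h6
    exact abs_le.2 ⟨by linarith, by linarith⟩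
  have h8 : |ξ - corner M i j| ≤ 2 / M + (c + 2) / M := by
    rw [abs_sub_corner hi hξ0 hξ1]
    have := abs_add_le (fold M ξ - fold M v) (fold M v - j / M)
    rw [sub_add_sub_cancel] at this
    linarith
  have h9 := abs_add_le (v - ξ) (ξ - corner M i j)
  rw [sub_add_sub_cancel] at h9
  have h10 : (c + 6) / (M : ℝ) = 2 / M + (2 / M + (c + 2) / M) := by ring
  linarith

/-- A ramp as a product of its argument with a steep logistic step. -/
theorem abs_mul_act_sub_max_le {κ : ℝ} (hκ : 0 < κ) (y : ℝ) :
    |y * act (κ * y) - max y 0| ≤ 1 / κ := by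
  have hexp : ∀ x : ℝ, x * Real.exp (-x) ≤ 1 := by
    intro x
    have h1 := Real.add_one_le_exp x
    rw [Real.exp_neg, ← div_eq_mul_inv, div_le_one (Real.exp_pos x)]
    linarith
  rcases le_total 0 y with h | h
  · rw [max_eq_left h, abs_sub_comm, ← mul_one_sub, abs_of_nonneg
      (mul_nonneg h (by linarith [act_lt_one (κ * y)])), le_div_iff₀ hκ]
    calc y * (1 - act (κ * y)) * κ ≤ y * Real.exp (-(κ * y)) * κ := by
          gcongr; exact one_sub_act_le_exp _
      _ = (κ * y) * Real.exp (-(κ * y)) := by ring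
      _ ≤ 1 := hexp _
  · rw [max_eq_right h, sub_zero, abs_mul, abs_of_nonpos h, abs_of_pos (act_pos _),
      le_div_iff₀ hκ]
    calc -y * act (κ * y) * κ ≤ -y * Real.exp (κ * y) * κ := by
          have := act_le_exp (κ * y)
          have : 0 ≤ -y := by linarith
          gcongr
      _ = (-(κ * y)) * Real.exp (-(-(κ * y))) := by rw [neg_neg]; ring
      _ ≤ 1 := hexp _

/-- Neuron of the first layer: the step at `i / M` in the variable `u`. -/
def coarse (M : ℕ) (u : ℝ) (i : ℕ) : ℝ := act ((M : ℝ) ^ 2 * (M * u - i))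

/-- Slope of the zigzag minus one, computed by the first layer. -/
def foldSlope (M : ℕ) (u : ℝ) : ℝ := ∑ i : Fin M, foldCoef i * coarse M u i

/-- Offset of the zigzag, computed by the first layer. -/
def foldOffset (M : ℕ) (u : ℝ) : ℝ := ∑ i : Fin M, foldCoef i * (i : ℕ) * coarse M u i

/-- Approximation of `fold M (M * u)` computed in two layers, where `u'` is an approximation
of `u`. Since the sum of the soft ramps `(M * u - i) * coarse M u i` factors through `foldSlope` and
`foldOffset`, one product per coordinate is enough. -/
def foldNet (M : ℕ) (u u' : ℝ) : ℝ :=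
  idNet ((M : ℝ) ^ 5) (M * u' - foldOffset M u)
    + M * mulNet ((M : ℝ) ^ 5) u' (foldSlope M u)

theorem coarse_abs_le (M : ℕ) (u : ℝ) (i : ℕ) : |coarse M u i| ≤ 1 := by
  rw [coarse, abs_of_pos (act_pos _)]; exact (act_lt_one _).le

theorem abs_foldSlope_le (M : ℕ) (u : ℝ) : |foldSlope M u| ≤ 2 * M := by
  refine (Finset.abs_sum_le_sum_abs _ _).trans ?_
  calc _ ≤ ∑ _i : Fin M, (2 : ℝ) * 1 := Finset.sum_le_sum fun i _ => by
        rw [abs_mul]; gcongr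
        · exact abs_foldCoef_le _
        · exact coarse_abs_le _ _ _
    _ = 2 * M := by simp; ring

theorem abs_foldOffset_le (M : ℕ) (u : ℝ) : |foldOffset M u| ≤ 2 * (M : ℝ) ^ 2 := by
  refine (Finset.abs_sum_le_sum_abs _ _).trans ?_
  calc _ ≤ ∑ _i : Fin M, (2 : ℝ) * M * 1 := Finset.sum_le_sum fun i _ => by
        rw [abs_mul, abs_mul, Nat.abs_cast]; gcongr
        · exact abs_foldCoef_le _
        · exact i.2.le
        · exact coarse_abs_le _ _ _
    _ = 2 * (M : ℝ) ^ 2 := by simp; ring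

theorem abs_soft_fold_sub_le {M : ℕ} (hM : 0 < M) (u : ℝ) :
    |M * u - foldOffset M u + M * (u * foldSlope M u) - fold M (M * u)| ≤ 2 / M := by
  have hMp : (0 : ℝ) < M := by exact_mod_cast hM
  have h1 : M * u - foldOffset M u + M * (u * foldSlope M u) - fold M (M * u)
      = ∑ i : Fin M, foldCoef i * ((M * u - (i : ℕ)) * coarse M u i - max (M * u - (i : ℕ)) 0) := by
    rw [fold, ← Fin.sum_univ_eq_sum_range (fun i => foldCoef i * max ((M : ℝ) * u - i) 0)]
    simp_rw [mul_sub]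
    rw [Finset.sum_sub_distrib]
    have h2 : ∑ i : Fin M, foldCoef i * ((M * u - (i : ℕ)) * coarse M u i)
        = M * (u * foldSlope M u) - foldOffset M u := by
      rw [foldSlope, foldOffset, Finset.mul_sum, Finset.mul_sum, ← Finset.sum_sub_distrib]
      exact Finset.sum_congr rfl fun i _ => by ring
    rw [h2]; ring
  rw [h1]
  refine (Finset.abs_sum_le_sum_abs _ _).trans ?_
  calc _ ≤ ∑ _i : Fin M, (2 : ℝ) * (1 / (M : ℝ) ^ 2) := Finset.sum_le_sum fun i _ => by
        rw [abs_mul]; gcongr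
        · exact abs_foldCoef_le _
        · exact abs_mul_act_sub_max_le (by positivity) _
    _ = 2 / (M : ℝ) := by simp; field_simp

/-- The folded coordinate is computed up to `O(1 / M)`. -/
theorem exists_abs_foldNet_sub_le : ∃ C, 0 ≤ C ∧ ∀ M : ℕ, 2 ≤ M → ∀ u u' : ℝ,
    |u| ≤ 1 → |u' - u| ≤ 1 / (M : ℝ) ^ 3 → |foldNet M u u' - fold M (M * u)| ≤ C / M := by
  refine ⟨16 * ridgeErr 1 0 + 108 * ridgeErr 2 0 + 5, by
    have := ridgeErr_nonneg 1 0; have := ridgeErr_nonneg 2 0; positivity, ?_⟩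
  intro M hM u u' hu huu
  have hM2 : (2 : ℝ) ≤ M := by exact_mod_cast hM
  have hMp : (0 : ℝ) < M := by linarith
  have hM3 : 1 / (M : ℝ) ^ 3 ≤ 1 := by
    rw [div_le_one (by positivity)]; exact one_le_pow₀ (by linarith)
  have hu' : |u'| ≤ 2 := by
    have := abs_add_le (u' - u) u
    rw [sub_add_cancel] at this
    linarith
  have hX := abs_foldSlope_le M u
  have hY := abs_foldOffset_le M u
  have hM4 : (16 : ℝ) ≤ (M : ℝ) ^ 4 := by
    calc (16 : ℝ) = 2 ^ 4 := by norm_num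
      _ ≤ (M : ℝ) ^ 4 := by gcongr
  have hM3' : (8 : ℝ) ≤ (M : ℝ) ^ 3 := by
    calc (8 : ℝ) = 2 ^ 3 := by norm_num
      _ ≤ (M : ℝ) ^ 3 := by gcongr
  have e1 := abs_idNet_sub_le (A := 4 * (M : ℝ) ^ 2) (ρ := (M : ℝ) ^ 5)
    (y := M * u' - foldOffset M u) (by positivity)
    (by rw [show (M : ℝ) ^ 5 = M ^ 3 * M ^ 2 by ring]; gcongr; linarith)
    (by
      refine (abs_sub _ _).trans ?_
      rw [abs_mul, Nat.abs_cast]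
      nlinarith)
  have e2 := abs_mulNet_sub_le (A := 3 * (M : ℝ)) (ρ := (M : ℝ) ^ 5)
    (x := u') (y := foldSlope M u) (by positivity)
    (by rw [show (M : ℝ) ^ 5 = M ^ 4 * M by ring]; nlinarith)
    (by linarith) (by linarith)
  have e3 := abs_soft_fold_sub_le (by omega : 0 < M) u
  have e4 : |(M * u' - foldOffset M u + M * (u' * foldSlope M u))
      - (M * u - foldOffset M u + M * (u * foldSlope M u))| ≤ 3 / M := by
    rw [show (M * u' - foldOffset M u + M * (u' * foldSlope M u))
      - (M * u - foldOffset M u + M * (u * foldSlope M u))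
      = M * (1 + foldSlope M u) * (u' - u) by ring, abs_mul, abs_mul, Nat.abs_cast]
    have : |1 + foldSlope M u| ≤ 3 * M := by
      refine (abs_add_le _ _).trans ?_
      rw [abs_one]; linarith
    calc (M : ℝ) * |1 + foldSlope M u| * |u' - u| ≤ M * (3 * M) * (1 / (M : ℝ) ^ 3) := by gcongr
      _ = 3 / M := by field_simp
  set p1 := idNet ((M : ℝ) ^ 5) (M * u' - foldOffset M u) with hp1
  set p2 := mulNet ((M : ℝ) ^ 5) u' (foldSlope M u) with hp2
  have e2' : |M * (p2 - u' * foldSlope M u)| ≤ 108 * ridgeErr 2 0 / M := by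
    rw [abs_mul, Nat.abs_cast]
    calc (M : ℝ) * |p2 - u' * foldSlope M u|
        ≤ M * (4 * ridgeErr 2 0 * (3 * (M : ℝ)) ^ 3 / (M : ℝ) ^ 5) := by gcongr
      _ = 108 * ridgeErr 2 0 / M := by field_simp; ring
  have e1' : |p1 - (M * u' - foldOffset M u)| ≤ 16 * ridgeErr 1 0 / M := by
    refine e1.trans (le_of_eq ?_)
    field_simp; ring
  have h : foldNet M u u' - fold M (M * u) = (p1 - (M * u' - foldOffset M u))
      + M * (p2 - u' * foldSlope M u)
      + ((M * u' - foldOffset M u + M * (u' * foldSlope M u))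
        - (M * u - foldOffset M u + M * (u * foldSlope M u)))
      + (M * u - foldOffset M u + M * (u * foldSlope M u) - fold M (M * u)) := by
    unfold foldNet; ring
  rw [h]
  refine (abs_add_le _ _).trans ((add_le_add ((abs_add_le _ _).trans (add_le_add
    ((abs_add_le _ _).trans (add_le_add e1' e2')) e4)) e3).trans (le_of_eq ?_))
  ring

/-! ### Assembling networks layer by layer -/

/-- `y` is an affine combination of the functions `z i` with all coefficients and the constant
term at most `δ` in absolute value. -/
def AffIn {X ι : Type*} [Fintype ι] (δ : ℝ) (z : ι → X → ℝ) (y : X → ℝ) : Prop :=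
  ∃ (a : ι → ℝ) (b : ℝ), (∀ i, |a i| ≤ δ) ∧ |b| ≤ δ ∧ ∀ x, y x = ∑ i, a i * z i x + b

/-- The functions `z i` are computed by distinct neurons of the `n`-th hidden layer of a network of
width `w` with parameters at most `δ`. -/
def Realizes {D : ℕ} {ι : Type*} (w n : ℕ) (δ : ℝ) (z : ι → EuclideanSpace ℝ (Fin D) → ℝ) : Prop :=
  ∃ (N : HiddenLayers D w n) (e : ι ↪ Fin w), N.BoundedBy δ ∧ ∀ i x, N.eval x (e i) = z i x

section AffIn

variable {X ι : Type*} [Fintype ι] {z : ι → X → ℝ}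

theorem AffIn.mono {δ δ' : ℝ} {y : X → ℝ} (h : AffIn δ z y) (hδ : δ ≤ δ') : AffIn δ' z y := by
  obtain ⟨a, b, ha, hb, hy⟩ := h
  exact ⟨a, b, fun i => (ha i).trans hδ, hb.trans hδ, hy⟩

theorem AffIn.nonneg {δ : ℝ} {y : X → ℝ} (h : AffIn δ z y) : 0 ≤ δ := by
  obtain ⟨_, b, _, hb, _⟩ := h
  exact (abs_nonneg b).trans hb

theorem AffIn.congr {δ : ℝ} {y y' : X → ℝ} (h : AffIn δ z y) (hy : ∀ x, y' x = y x) :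
    AffIn δ z y' := by
  rwa [show y' = y from funext hy]

theorem AffIn.const (c : ℝ) : AffIn |c| z fun _ => c :=
  ⟨fun _ => 0, c, fun _ => by simp, le_rfl, fun x => by simp⟩

theorem AffIn.add {δ₁ δ₂ : ℝ} {y₁ y₂ : X → ℝ} (h₁ : AffIn δ₁ z y₁) (h₂ : AffIn δ₂ z y₂) :
    AffIn (δ₁ + δ₂) z fun x => y₁ x + y₂ x := by
  obtain ⟨a₁, b₁, ha₁, hb₁, hy₁⟩ := h₁
  obtain ⟨a₂, b₂, ha₂, hb₂, hy₂⟩ := h₂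
  refine ⟨fun i => a₁ i + a₂ i, b₁ + b₂, fun i => ?_, ?_, fun x => ?_⟩
  · exact (abs_add_le _ _).trans (add_le_add (ha₁ i) (ha₂ i))
  · exact (abs_add_le _ _).trans (add_le_add hb₁ hb₂)
  · beta_reduce
    rw [hy₁, hy₂]
    simp only [add_mul, Finset.sum_add_distrib]
    ring

theorem AffIn.const_mul {δ : ℝ} {y : X → ℝ} (c : ℝ) (h : AffIn δ z y) :
    AffIn (|c| * δ) z fun x => c * y x := by
  obtain ⟨a, b, ha, hb, hy⟩ := h
  refine ⟨fun i => c * a i, c * b, fun i => ?_, ?_, fun x => ?_⟩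
  · rw [abs_mul]; exact mul_le_mul_of_nonneg_left (ha i) (abs_nonneg _)
  · rw [abs_mul]; exact mul_le_mul_of_nonneg_left hb (abs_nonneg _)
  · beta_reduce
    rw [hy, mul_add, Finset.mul_sum]
    simp only [mul_assoc]

theorem AffIn.sub {δ₁ δ₂ : ℝ} {y₁ y₂ : X → ℝ} (h₁ : AffIn δ₁ z y₁) (h₂ : AffIn δ₂ z y₂) :
    AffIn (δ₁ + δ₂) z fun x => y₁ x - y₂ x := by
  have h := h₁.add (h₂.const_mul (-1))
  rw [abs_neg, abs_one, one_mul] at h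
  exact h.congr fun x => by ring

theorem AffIn.sum {κ : Type*} (s : Finset κ) {δ : κ → ℝ} {y : κ → X → ℝ}
    (h : ∀ k ∈ s, AffIn (δ k) z (y k)) : AffIn (∑ k ∈ s, δ k) z fun x => ∑ k ∈ s, y k x := by
  classical
  induction s using Finset.induction_on with
  | empty => simpa using AffIn.const (z := z) 0
  | insert k s hk ih =>
    simp only [Finset.sum_insert hk]
    exact (h k (Finset.mem_insert_self _ _)).add
      (ih fun j hj => h j (Finset.mem_insert_of_mem hj))

/-- A combination of distinct members of the family. -/
theorem AffIn.sum_family {κ : Type*} [Fintype κ] (g : κ → ι) (hg : Function.Injective g)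
    (c : κ → ℝ) {δ : ℝ} (hδ : 0 ≤ δ) (hc : ∀ k, |c k| ≤ δ) :
    AffIn δ z fun x => ∑ k, c k * z (g k) x := by
  classical
  refine ⟨fun i => ∑ k, if g k = i then c k else 0, 0, fun i => ?_, by simpa using hδ,
    fun x => ?_⟩
  · beta_reduce
    by_cases h : ∃ k, g k = i
    · obtain ⟨k, rfl⟩ := h
      rw [Finset.sum_eq_single k (fun j _ hj => if_neg fun h => hj (hg h)) (by simp)]
      simpa using hc k
    · rw [Finset.sum_eq_zero fun k _ => if_neg fun h' => h ⟨k, h'⟩]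
      simpa using hδ
  · simp_rw [Finset.sum_mul]
    rw [Finset.sum_comm, add_zero]
    refine Finset.sum_congr rfl fun k _ => ?_
    simp

theorem AffIn.family (i : ι) : AffIn 1 z (z i) := by
  have h := AffIn.sum_family (z := z) (fun _ : Unit => i) (fun _ _ _ => rfl) (fun _ => 1)
    zero_le_one (by simp)
  exact h.congr fun x => by simp

end AffIn

section Realizes

variable {D : ℕ} {w n : ℕ} {ι κ : Type*}

theorem Realizes.first [Fintype κ] {δ : ℝ} (hδ : 0 ≤ δ) (hκ : Fintype.card κ ≤ w)
    {y : κ → EuclideanSpace ℝ (Fin D) → ℝ}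
    (hy : ∀ k, AffIn δ (fun (i : Fin D) (x : EuclideanSpace ℝ (Fin D)) => x i) (y k)) :
    Realizes w 1 δ fun k x => act (y k x) := by
  classical
  choose a b ha hb hyx using hy
  obtain ⟨e⟩ : Nonempty (κ ↪ Fin w) :=
    Function.Embedding.nonempty_of_card_le (by simpa using hκ)
  refine ⟨.first (fun r c => if h : ∃ k, e k = r then a h.choose c else 0)
    (fun r => if h : ∃ k, e k = r then b h.choose else 0), e, ⟨fun r c => ?_, fun r => ?_⟩,
    fun k x => ?_⟩
  · beta_reduce
    split_ifs with h
    · exact ha _ _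
    · simpa using hδ
  · beta_reduce
    split_ifs with h
    · exact hb _
    · simpa using hδ
  · have h : ∃ k', e k' = e k := ⟨k, rfl⟩
    have h1 : h.choose = k := e.injective h.choose_spec
    simp only [HiddenLayers.eval, dif_pos h, h1, hyx]

theorem Realizes.next [Fintype ι] [Fintype κ] {δ : ℝ} {z : ι → EuclideanSpace ℝ (Fin D) → ℝ}
    (hz : Realizes w n δ z) (hδ : 0 ≤ δ) (hκ : Fintype.card κ ≤ w)
    {y : κ → EuclideanSpace ℝ (Fin D) → ℝ} (hy : ∀ k, AffIn δ z (y k)) :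
    Realizes w (n + 1) δ fun k x => act (y k x) := by
  classical
  obtain ⟨N, f, hN, hf⟩ := hz
  choose a b ha hb hyx using hy
  obtain ⟨e⟩ : Nonempty (κ ↪ Fin w) :=
    Function.Embedding.nonempty_of_card_le (by simpa using hκ)
  refine ⟨.next N (fun r c => if h : ∃ k, e k = r then
      (if h' : ∃ i, f i = c then a h.choose h'.choose else 0) else 0)
    (fun r => if h : ∃ k, e k = r then b h.choose else 0), e, ⟨hN, fun r c => ?_, fun r => ?_⟩,
    fun k x => ?_⟩
  · beta_reduce
    split_ifs with h
    · exact ha _ _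
    · simpa using hδ
    · simpa using hδ
  · beta_reduce
    split_ifs with h
    · exact hb _
    · simpa using hδ
  · have h : ∃ k', e k' = e k := ⟨k, rfl⟩
    have h1 : h.choose = k := e.injective h.choose_spec
    simp only [HiddenLayers.eval, dif_pos h, h1, hyx]
    congr 2
    rw [← Finset.sum_subset (Finset.subset_univ (Finset.univ.map f))]
    · rw [Finset.sum_map]
      refine Finset.sum_congr rfl fun i _ => ?_
      have h' : ∃ i', f i' = f i := ⟨i, rfl⟩
      have h2 : h'.choose = i := f.injective h'.choose_spec
      rw [dif_pos h', h2, hf]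
    · intro c _ hc
      rw [dif_neg, zero_mul]
      rintro ⟨i, rfl⟩
      exact hc (Finset.mem_map_of_mem _ (Finset.mem_univ i))

theorem Realizes.mem_netClass [Fintype ι] {δ : ℝ} {z : ι → EuclideanSpace ℝ (Fin D) → ℝ}
    (hz : Realizes w n δ z) {y : EuclideanSpace ℝ (Fin D) → ℝ} (hy : AffIn δ z y) :
    y ∈ netClass D n w δ := by
  classical
  have hδ := hy.nonneg
  obtain ⟨N, f, hN, hf⟩ := hz
  obtain ⟨a, b, ha, hb, hyx⟩ := hy
  refine ⟨N, fun c => if h' : ∃ i, f i = c then a h'.choose else 0, b, hN, fun c => ?_, hb, ?_⟩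
  · beta_reduce
    split_ifs with h
    · exact ha _
    · simpa using hδ
  · funext x
    rw [hyx]
    congr 1
    rw [← Finset.sum_subset (Finset.subset_univ (Finset.univ.map f))]
    · rw [Finset.sum_map]
      refine Finset.sum_congr rfl fun i _ => ?_
      have h' : ∃ i', f i' = f i := ⟨i, rfl⟩
      have h2 : h'.choose = i := f.injective h'.choose_spec
      beta_reduce
      rw [dif_pos h', h2, hf]
    · intro c _ hc
      beta_reduce
      rw [dif_neg, zero_mul]
      rintro ⟨i, rfl⟩
      exact hc (Finset.mem_map_of_mem _ (Finset.mem_univ i))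

end Realizes

/-- Bound for the weights, the base point and the nodes of `ridge`. -/
def ridgeSize (k e : ℕ) : ℝ := ∑ i, |ridgeWeight k e i| + |ridgePoint k e| + (k + e + 1)

theorem ridgeSize_nonneg (k e : ℕ) : 0 ≤ ridgeSize k e := by unfold ridgeSize; positivity

/-- The argument of the `i`-th neuron of `ridge`. -/
def ridgeArg (k e : ℕ) (ρ y : ℝ) (i : Fin (k + e + 1)) : ℝ := ridgePoint k e + (i : ℕ) * (y / ρ)

section

variable {X ι : Type*} [Fintype ι] {z : ι → X → ℝ}

theorem AffIn.ridgeArg {δ ρ : ℝ} {y : X → ℝ} (k e : ℕ) (hρ : 1 ≤ ρ) (hy : AffIn δ z y)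
    (i : Fin (k + e + 1)) : AffIn (ridgeSize k e * (1 + δ)) z fun x => ridgeArg k e ρ (y x) i := by
  have h := (AffIn.const (z := z) (ridgePoint k e)).add (hy.const_mul ((i : ℕ) / ρ))
  have hδ := hy.nonneg
  refine AffIn.mono (h.congr fun x => ?_) ?_
  · unfold Mscale.ridgeArg; ring
  · have h1 : |ridgePoint k e| ≤ ridgeSize k e := by
      have : 0 ≤ ∑ i, |ridgeWeight k e i| := by positivity
      unfold ridgeSize
      have : (0 : ℝ) ≤ k + e + 1 := by positivity
      linarith
    have h2 : |((i : ℕ) : ℝ) / ρ| ≤ ridgeSize k e := by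
      rw [abs_div, Nat.abs_cast, abs_of_pos (by linarith : 0 < ρ)]
      refine (div_le_self (Nat.cast_nonneg _) hρ).trans ?_
      have h3 : ((i : ℕ) : ℝ) ≤ k + e + 1 := by exact_mod_cast i.2.le
      have : 0 ≤ ∑ i, |ridgeWeight k e i| := by positivity
      have := abs_nonneg (ridgePoint k e)
      unfold ridgeSize
      linarith
    calc _ ≤ ridgeSize k e + ridgeSize k e * δ := by gcongr
      _ = _ := by ring

theorem AffIn.ridge {ρ : ℝ} {y : X → ℝ} (k e : ℕ) (hρ : 0 ≤ ρ) (g : Fin (k + e + 1) → ι)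
    (hg : ∀ i x, z (g i) x = act (Mscale.ridgeArg k e ρ (y x) i)) :
    AffIn (ρ ^ k * ridgeSize k e) z fun x => ridge k e ρ (y x) := by
  have h := (AffIn.sum Finset.univ fun i _ =>
    (AffIn.family (z := z) (g i)).const_mul (ridgeWeight k e i)).const_mul (ρ ^ k)
  refine AffIn.mono (h.congr fun x => ?_) ?_
  · unfold Mscale.ridge
    simp only [hg, Mscale.ridgeArg]
  · rw [abs_of_nonneg (by positivity)]
    refine mul_le_mul_of_nonneg_left ?_ (by positivity)
    unfold ridgeSize
    simp only [mul_one]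
    have : (0 : ℝ) ≤ k + e + 1 := by positivity
    linarith [abs_nonneg (ridgePoint k e)]

end

/-- Appending approximate identities turns a network with `n` hidden layers into one with
`n + 1 + k` hidden layers. -/
theorem Realizes.pad {D w n : ℕ} {ι : Type*} [Fintype ι] {δ δ₀ ρ : ℝ}
    {z : ι → EuclideanSpace ℝ (Fin D) → ℝ}
    (hz : Realizes w n δ z) {y : EuclideanSpace ℝ (Fin D) → ℝ} (hy : AffIn δ₀ z y) (hw : 2 ≤ w)
    (hρ : 1 ≤ ρ) (h1 : ridgeSize 1 0 * (1 + δ₀) ≤ δ)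
    (h2 : ridgeSize 1 0 * (1 + ρ * ridgeSize 1 0) ≤ δ) (h3 : ρ * ridgeSize 1 0 ≤ δ) (k : ℕ) :
    (fun x => (idNet ρ)^[k + 1] (y x)) ∈ netClass D (n + 1 + k) w δ := by
  have hδ : 0 ≤ δ := le_trans (mul_nonneg (ridgeSize_nonneg _ _) (by linarith [hy.nonneg])) h1
  have key : Realizes w (n + 1 + k) δ
      fun (i : Fin (1 + 0 + 1)) x => act (ridgeArg 1 0 ρ ((idNet ρ)^[k] (y x)) i) := by
    induction k with
    | zero =>
      exact hz.next hδ (by simpa using hw) fun i => (hy.ridgeArg 1 0 hρ i).mono h1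
    | succ k ih =>
      have h4 := AffIn.ridge (ρ := ρ) (y := fun x => (idNet ρ)^[k] (y x)) 1 0 (by linarith)
        (z := fun (i : Fin (1 + 0 + 1)) x => act (ridgeArg 1 0 ρ ((idNet ρ)^[k] (y x)) i))
        id (fun i x => rfl)
      refine ih.next hδ (by simpa using hw) fun i => ?_
      rw [pow_one] at h4
      refine ((h4.ridgeArg 1 0 hρ i).mono h2).congr fun x => ?_
      rw [Function.iterate_succ_apply']
      rfl
  have h6 := AffIn.ridge (ρ := ρ) (y := fun x => (idNet ρ)^[k] (y x)) 1 0 (by linarith)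
        (z := fun (i : Fin (1 + 0 + 1)) x => act (ridgeArg 1 0 ρ ((idNet ρ)^[k] (y x)) i))
        id (fun i x => rfl)
  refine key.mem_netClass ((h6.mono (by rw [pow_one]; exact h3)).congr fun x => ?_)
  rw [Function.iterate_succ_apply']
  rfl

/-! ### Taylor expansion in terms of mixed partial derivatives -/

section Taylor

variable {d : ℕ} {f : EuclideanSpace ℝ (Fin d) → ℝ}

/-- Iterated partial derivative along a list of coordinates; unlike with multi-indices, the chain
rule along a line needs no binomial coefficients. -/
def iterPartial (L : List (Fin d)) (f : EuclideanSpace ℝ (Fin d) → ℝ) :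
    EuclideanSpace ℝ (Fin d) → ℝ :=
  L.foldr partialDeriv f

theorem partialDeriv_eq_fderiv (hf : ContDiff ℝ 1 f) (i : Fin d) :
    partialDeriv i f = fun x => fderiv ℝ f x (EuclideanSpace.single i 1) := by
  funext x
  exact ((hf.differentiable (by norm_num)) x).lineDeriv_eq_fderiv

theorem ContDiff.partialDeriv {n : ℕ} (hf : ContDiff ℝ (n + 1 : ℕ) f) (i : Fin d) :
    ContDiff ℝ n (partialDeriv i f) := by
  rw [partialDeriv_eq_fderiv (hf.of_le (by norm_cast; omega)) i]
  exact (hf.fderiv_right (by norm_cast)).clm_apply contDiff_const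

theorem ContDiff.iterPartial {n : ℕ} (L : List (Fin d))
    (hf : ContDiff ℝ (n + L.length : ℕ) f) : ContDiff ℝ n (iterPartial L f) := by
  induction L generalizing n with
  | nil => simpa [Mscale.iterPartial] using hf
  | cons i L ih =>
    have h := ih (n := n + 1) (by
      rw [List.length_cons] at hf
      rwa [show n + 1 + L.length = n + (L.length + 1) by ring])
    exact ContDiff.partialDeriv h i

theorem partialDeriv_comm (hf : ContDiff ℝ 2 f) (i j : Fin d) :
    partialDeriv i (partialDeriv j f) = partialDeriv j (partialDeriv i f) := by
  have h1 : ContDiff ℝ 1 f := hf.of_le (by norm_num)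
  have hd : Differentiable ℝ (fderiv ℝ f) :=
    (hf.fderiv_right (m := 1) (by norm_num)).differentiable (by norm_num)
  have key : ∀ a b : Fin d, ∀ x, partialDeriv a (partialDeriv b f) x
      = fderiv ℝ (fderiv ℝ f) x (EuclideanSpace.single a 1) (EuclideanSpace.single b 1) := by
    intro a b x
    have h2 : ContDiff ℝ 1 (partialDeriv b f) :=
      ContDiff.partialDeriv (n := 1) (by exact_mod_cast hf) b
    rw [partialDeriv_eq_fderiv h2, partialDeriv_eq_fderiv h1]
    beta_reduce
    rw [fderiv_clm_apply (hd x) (differentiableAt_const _)]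
    simp
  funext x
  rw [key, key]
  exact (hf.contDiffAt.isSymmSndFDerivAt (by simp)) _ _

theorem iterPartial_perm {L L' : List (Fin d)} (h : L.Perm L') (hf : ContDiff ℝ L.length f) :
    iterPartial L f = iterPartial L' f := by
  induction h with
  | nil => rfl
  | cons i h ih =>
    change partialDeriv i (iterPartial _ f) = partialDeriv i (iterPartial _ f)
    rw [ih (hf.of_le (by simp))]
  | swap i j L =>
    refine partialDeriv_comm ?_ j i
    have := ContDiff.iterPartial (n := 2) L (f := f) (hf.of_le (by
      rw [List.length_cons, List.length_cons]; norm_cast; omega))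
    exact_mod_cast this
  | trans h₁ h₂ ih₁ ih₂ =>
    rw [ih₁ hf, ih₂ (by rwa [← h₁.length_eq])]

theorem foldr_iterate_eq (j : Fin d → ℕ) (l : List (Fin d)) :
    l.foldr (fun i g => (partialDeriv i)^[j i] g) f
      = iterPartial (l.flatMap fun i => List.replicate (j i) i) f := by
  have hrep : ∀ (n : ℕ) (i : Fin d) (g : EuclideanSpace ℝ (Fin d) → ℝ),
      (partialDeriv i)^[n] g = (List.replicate n i).foldr partialDeriv g := by
    intro n i g
    induction n with
    | zero => rfl
    | succ n ih => rw [Function.iterate_succ_apply', ih, List.replicate_succ, List.foldr_cons]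
  induction l with
  | nil => rfl
  | cons i l ih =>
    rw [List.foldr_cons, ih, hrep, List.flatMap_cons]
    unfold iterPartial
    rw [List.foldr_append]

/-- By the symmetry of second derivatives, only the multiplicities of the coordinates matter. -/
theorem iterPartial_eq_mixedPartial (L : List (Fin d)) (hf : ContDiff ℝ L.length f) :
    iterPartial L f = mixedPartial (fun i => L.count i) f := by
  rw [mixedPartial, foldr_iterate_eq]
  refine iterPartial_perm ?_ hf
  rw [List.perm_iff_count]
  intro a
  rw [List.count_flatMap]
  have h1 : (List.map (List.count a ∘ fun i => List.replicate (L.count i) i) (List.finRange d)).sum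
      = ∑ i : Fin d, if i = a then L.count i else 0 := by
    rw [← List.ofFn_eq_map, List.sum_ofFn]
    refine Finset.sum_congr rfl fun i _ => ?_
    simp [List.count_replicate]
  rw [h1]
  simp

theorem sum_count_eq_length (L : List (Fin d)) : ∑ i, L.count i = L.length := by
  have := Multiset.sum_count_eq_card (s := Finset.univ) (m := (L : Multiset (Fin d)))
    (fun a _ => Finset.mem_univ a)
  simpa using this

theorem hasDerivAt_comp_line (hf : ContDiff ℝ 1 f) (c v : EuclideanSpace ℝ (Fin d)) (t : ℝ) :
    HasDerivAt (fun t : ℝ => f (c + t • v)) (∑ i, v i * partialDeriv i f (c + t • v)) t := by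
  have h1 : HasDerivAt (fun t : ℝ => c + t • v) v t := by
    simpa using ((hasDerivAt_id t).smul_const v).const_add c
  have h2 := ((hf.differentiable (by norm_num)) (c + t • v)).hasFDerivAt.comp_hasDerivAt t h1
  have hv : v = ∑ i, v i • EuclideanSpace.single i (1 : ℝ) := by
    ext k
    simp [Finset.sum_apply, Pi.single_apply]
  have h3 : fderiv ℝ f (c + t • v) v = ∑ i, v i * partialDeriv i f (c + t • v) := by
    conv_lhs => enter [2]; rw [hv]
    rw [map_sum]
    refine Finset.sum_congr rfl fun i _ => ?_
    rw [map_smul, smul_eq_mul, partialDeriv_eq_fderiv hf]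
  rw [← h3]
  exact h2

theorem iteratedDeriv_comp_line (c v : EuclideanSpace ℝ (Fin d)) (n : ℕ) (hf : ContDiff ℝ n f)
    (t : ℝ) : iteratedDeriv n (fun t : ℝ => f (c + t • v)) t
      = ∑ β : Fin n → Fin d, (∏ i, v (β i)) * iterPartial (List.ofFn β) f (c + t • v) := by
  induction n generalizing t with
  | zero => simp [iterPartial]
  | succ n ih =>
    rw [iteratedDeriv_succ]
    have h1 : iteratedDeriv n (fun t : ℝ => f (c + t • v)) = fun t =>
        ∑ β : Fin n → Fin d, (∏ i, v (β i)) * iterPartial (List.ofFn β) f (c + t • v) :=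
      funext fun t => ih (hf.of_le (by norm_cast; omega)) t
    rw [h1]
    have h2 : HasDerivAt (fun t : ℝ => ∑ β : Fin n → Fin d,
        (∏ i, v (β i)) * iterPartial (List.ofFn β) f (c + t • v))
        (∑ β : Fin n → Fin d, (∏ i, v (β i)) *
          ∑ k, v k * partialDeriv k (iterPartial (List.ofFn β) f) (c + t • v)) t := by
      refine HasDerivAt.fun_sum fun β _ => HasDerivAt.const_mul _ ?_
      refine hasDerivAt_comp_line ?_ c v t
      exact_mod_cast ContDiff.iterPartial (n := 1) (List.ofFn β) (f := f)
        (by rw [List.length_ofFn, add_comm]; exact hf)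
    rw [h2.deriv, ← (Fin.consEquiv fun _ => Fin d).sum_comp, Fintype.sum_prod_type,
      Finset.sum_comm]
    refine Finset.sum_congr rfl fun β _ => ?_
    rw [Finset.mul_sum]
    refine Finset.sum_congr rfl fun k _ => ?_
    simp only [Fin.consEquiv_apply, Fin.prod_univ_succ, Fin.cons_zero, Fin.cons_succ,
      List.ofFn_succ]
    change _ = _ * partialDeriv k (iterPartial (List.ofFn β) f) (c + t • v)
    ring

/-- Taylor polynomial of degree `q` at `c`, evaluated at `c + v`. -/
def taylorPoly (q : ℕ) (f : EuclideanSpace ℝ (Fin d) → ℝ) (c v : EuclideanSpace ℝ (Fin d)) : ℝ :=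
  ∑ n ∈ Finset.range (q + 1), ∑ β : Fin n → Fin d,
    iterPartial (List.ofFn β) f c / n.factorial * ∏ i, v (β i)

theorem abs_coord_le_norm (v : EuclideanSpace ℝ (Fin d)) (i : Fin d) : |v i| ≤ ‖v‖ := by
  rw [← Real.norm_eq_abs]; exact PiLp.norm_apply_le v i

theorem abs_prod_coord_le {n : ℕ} (v : EuclideanSpace ℝ (Fin d)) (β : Fin n → Fin d) :
    |∏ i, v (β i)| ≤ ‖v‖ ^ n := by
  rw [Finset.abs_prod]
  calc _ ≤ ∏ _i : Fin n, ‖v‖ :=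
        Finset.prod_le_prod (fun _ _ => abs_nonneg _) fun i _ => abs_coord_le_norm v (β i)
    _ = ‖v‖ ^ n := by simp

theorem abs_sub_taylorPoly_le {q : ℕ} (hq : 1 ≤ q) {s C₀ : ℝ} (hs : 0 < s) (hC₀ : 0 ≤ C₀)
    (hf : IsSmoothClass q s C₀ f) (c v : EuclideanSpace ℝ (Fin d)) :
    |f (c + v) - taylorPoly q f c v| ≤ (d : ℝ) ^ q * C₀ * (‖v‖ ^ q * ‖v‖ ^ s) := by
  obtain ⟨hcd, hH⟩ := hf
  obtain ⟨m, rfl⟩ : ∃ m, q = m + 1 := ⟨q - 1, by omega⟩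
  have hgc : ContDiff ℝ ((m + 1 : ℕ)) (fun t : ℝ => f (c + t • v)) :=
    hcd.comp (contDiff_const.add (contDiff_id.smul contDiff_const))
  obtain ⟨ξ, hξ, h⟩ := exists_taylor_unit (fun t : ℝ => f (c + t • v)) m
    (by exact_mod_cast hgc)
  rw [one_smul, iteratedDeriv_comp_line c v (m + 1) hcd] at h
  have h1 : ∑ r ∈ Finset.range (m + 1), iteratedDeriv r (fun t : ℝ => f (c + t • v)) 0
        / (r.factorial : ℝ)
      = ∑ n ∈ Finset.range (m + 1), ∑ β : Fin n → Fin d,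
        iterPartial (List.ofFn β) f c / n.factorial * ∏ i, v (β i) := by
    refine Finset.sum_congr rfl fun r hr => ?_
    rw [iteratedDeriv_comp_line c v r
      (hcd.of_le (by have := Finset.mem_range.1 hr; norm_cast; omega)), zero_smul, add_zero,
      Finset.sum_div]
    exact Finset.sum_congr rfl fun β _ => by ring
  rw [h1] at h
  rw [taylorPoly, Finset.sum_range_succ, h, add_sub_add_left_eq_sub, Finset.sum_div,
    ← Finset.sum_sub_distrib]
  refine (Finset.abs_sum_le_sum_abs _ _).trans ?_
  have hterm : ∀ β : Fin (m + 1) → Fin d,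
      |(∏ i, v (β i)) * iterPartial (List.ofFn β) f (c + ξ • v) / ((m + 1).factorial : ℝ)
        - iterPartial (List.ofFn β) f c / ((m + 1).factorial : ℝ) * ∏ i, v (β i)|
      ≤ C₀ * (‖v‖ ^ (m + 1) * ‖v‖ ^ s) := by
    intro β
    have hfac : (1 : ℝ) ≤ ((m + 1).factorial : ℝ) := by
      exact_mod_cast Nat.succ_le_of_lt (Nat.factorial_pos _)
    have h2 : |iterPartial (List.ofFn β) f (c + ξ • v) - iterPartial (List.ofFn β) f c|
        ≤ C₀ * ‖v‖ ^ s := by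
      rw [iterPartial_eq_mixedPartial _ (by rw [List.length_ofFn]; exact hcd)]
      refine (hH _ (by rw [sum_count_eq_length, List.length_ofFn]) _ _).trans ?_
      rw [add_sub_cancel_left, norm_smul, Real.norm_eq_abs, abs_of_nonneg hξ.1]
      have : ξ * ‖v‖ ≤ ‖v‖ := mul_le_of_le_one_left (norm_nonneg _) hξ.2
      gcongr
      exact mul_nonneg hξ.1 (norm_nonneg _)
    rw [show (∏ i, v (β i)) * iterPartial (List.ofFn β) f (c + ξ • v) / ((m + 1).factorial : ℝ)
        - iterPartial (List.ofFn β) f c / ((m + 1).factorial : ℝ) * ∏ i, v (β i)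
      = ((∏ i, v (β i)) * (iterPartial (List.ofFn β) f (c + ξ • v)
          - iterPartial (List.ofFn β) f c)) / ((m + 1).factorial : ℝ) by ring, abs_div, abs_mul,
      Nat.abs_cast]
    refine (div_le_self (by positivity) hfac).trans ?_
    calc _ ≤ ‖v‖ ^ (m + 1) * (C₀ * ‖v‖ ^ s) :=
          mul_le_mul (abs_prod_coord_le v β) h2 (abs_nonneg _) (by positivity)
      _ = _ := by ring
  refine (Finset.sum_le_sum fun β _ => hterm β).trans (le_of_eq ?_)
  simp [Finset.card_univ]
  ring

end Taylor

/-! ### Homogenised polynomials -/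

/-- The point `(1, u)`. -/
def homog {d : ℕ} (u : Fin d → ℝ) : Fin (d + 1) → ℝ := Fin.cons 1 u

theorem exists_ofFn_eq {α : Type*} {q : ℕ} (s : Sym α q) :
    ∃ φ : Fin q → α, Multiset.ofList (List.ofFn φ) = (s : Multiset α) := by
  obtain ⟨m, hm⟩ := s
  induction m using Quotient.inductionOn with
  | h l =>
    have hl : l.length = q := by simpa using hm
    subst hl
    refine ⟨fun i => l.get i, ?_⟩
    rw [List.ofFn_get]; rfl

/-- An enumeration of the `q` factors of a monomial. -/
def symEnum {α : Type*} {q : ℕ} (s : Sym α q) : Fin q → α := (exists_ofFn_eq s).choose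

/-- The monomial `∏ i ∈ s, (1, u) i`; as `s` varies these are all monomials in `u` of degree at
most `q`. -/
def symMonomial {d q : ℕ} (s : Sym (Fin (d + 1)) q) (u : Fin d → ℝ) : ℝ :=
  ∏ i, homog u (symEnum s i)

theorem card_sym_eq (d q : ℕ) : Fintype.card (Sym (Fin (d + 1)) q) = (d + q).choose d := by
  rw [Sym.card_sym_eq_choose, Fintype.card_fin]
  rw [show d + 1 + q - 1 = d + q by omega, ← Nat.choose_symm_add]

/-- Polynomials in `u` of degree at most `q` with coefficients bounded by `b`. -/
def IsBoundedPoly {d : ℕ} (q : ℕ) (b : ℝ) (g : (Fin d → ℝ) → ℝ) : Prop :=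
  ∃ e : Sym (Fin (d + 1)) q → ℝ, (∀ s, |e s| ≤ b) ∧ ∀ u, g u = ∑ s, e s * symMonomial s u

theorem IsBoundedPoly.const_mul {d q : ℕ} {b : ℝ} {g : (Fin d → ℝ) → ℝ}
    (h : IsBoundedPoly q b g) (c : ℝ) : IsBoundedPoly q (|c| * b) fun u => c * g u := by
  obtain ⟨e, he, hg⟩ := h
  refine ⟨fun s => c * e s, fun s => ?_, fun u => ?_⟩
  · rw [abs_mul]; exact mul_le_mul_of_nonneg_left (he s) (abs_nonneg _)
  · beta_reduce
    rw [hg, Finset.mul_sum]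
    exact Finset.sum_congr rfl fun _ _ => by ring

theorem IsBoundedPoly.sum {d q : ℕ} {κ : Type*} (t : Finset κ) {b : κ → ℝ}
    {g : κ → (Fin d → ℝ) → ℝ} (h : ∀ k ∈ t, IsBoundedPoly q (b k) (g k)) :
    IsBoundedPoly q (∑ k ∈ t, b k) fun u => ∑ k ∈ t, g k u := by
  classical
  induction t using Finset.induction_on with
  | empty => exact ⟨fun _ => 0, by simp, by simp⟩
  | insert k t hk ih =>
    obtain ⟨e₁, he₁, hg₁⟩ := h k (Finset.mem_insert_self _ _)
    obtain ⟨e₂, he₂, hg₂⟩ := ih fun j hj => h j (Finset.mem_insert_of_mem hj)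
    simp only [Finset.sum_insert hk]
    refine ⟨fun s => e₁ s + e₂ s, fun s => ?_, fun u => ?_⟩
    · exact (abs_add_le _ _).trans (add_le_add (he₁ s) (he₂ s))
    · beta_reduce at hg₂ ⊢
      rw [hg₁, hg₂, ← Finset.sum_add_distrib]
      exact Finset.sum_congr rfl fun _ _ => by ring

/-- The unordered tuple of the values of `β`. -/
def symOfFn {α : Type*} {q : ℕ} (β : Fin q → α) : Sym α q :=
  ⟨Multiset.ofList (List.ofFn β), by simp⟩

theorem prod_homog_eq_symMonomial {d q : ℕ} (β : Fin q → Fin (d + 1)) (u : Fin d → ℝ) :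
    ∏ i, homog u (β i) = symMonomial (symOfFn β) u := by
  have h := (exists_ofFn_eq (symOfFn β)).choose_spec
  have h2 := congrArg (fun m => (m.map (homog u)).prod) h
  simp only [Multiset.map_coe, Multiset.prod_coe, List.map_ofFn, List.prod_ofFn,
    symOfFn, Sym.coe_mk, Function.comp] at h2
  exact h2.symm

/-- A product of `q` linear forms in `(1, u)` with coefficients at most `1`. -/
theorem isBoundedPoly_prod {d q : ℕ} (a : Fin q → Fin (d + 1) → ℝ) (ha : ∀ i k, |a i k| ≤ 1) :
    IsBoundedPoly q ((d + 1 : ℝ) ^ q) fun u : Fin d → ℝ => ∏ i, ∑ k, a i k * homog u k := by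
  classical
  refine ⟨fun s => ∑ β : Fin q → Fin (d + 1), if symOfFn β = s then ∏ i, a i (β i) else 0,
    fun s => ?_, fun u => ?_⟩
  · refine (Finset.abs_sum_le_sum_abs _ _).trans ?_
    calc _ ≤ ∑ _β : Fin q → Fin (d + 1), (1 : ℝ) := by
          refine Finset.sum_le_sum fun β _ => ?_
          split_ifs
          · rw [Finset.abs_prod]
            exact Finset.prod_le_one (fun _ _ => abs_nonneg _) fun i _ => ha _ _
          · simp
      _ = (d + 1 : ℝ) ^ q := by simp
  · beta_reduce
    rw [Finset.prod_univ_sum, Fintype.piFinset_univ]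
    simp_rw [Finset.sum_mul, Finset.prod_mul_distrib]
    rw [Finset.sum_comm]
    refine Finset.sum_congr rfl fun β _ => ?_
    rw [prod_homog_eq_symMonomial]
    simp only [ite_mul, zero_mul, Finset.sum_ite_eq, Finset.mem_univ, if_true]

/-! ### Error analysis of the approximating network -/

section Pipeline

variable {d : ℕ} (q M : ℕ)

/-- The input coordinates after `n` approximate identity layers. The scale makes the error
`O(M ^ (-(2 q + 2)))`, which is at most the target `M ^ (-2 p)`. -/
def carry (n : ℕ) (u : Fin d → ℝ) (l : Fin d) : ℝ := (idNet ((M : ℝ) ^ (2 * q + 2)))^[n] (u l)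

/-- Computed position on the coarse grid, in units of the coarse mesh. -/
def coarsePos (u : Fin d → ℝ) (l : Fin d) : ℝ := M * carry q M 2 u l

/-- Computed position inside the coarse cell, in units of the fine mesh. -/
def finePos (u : Fin d → ℝ) (l : Fin d) : ℝ := M * foldNet M (u l) (carry q M 1 u l)

/-- Entry of the table `e` for the fine index `j`, selected by the coarse position. -/
def selected (e : (Fin d → Fin M) → (Fin d → Fin M) → Sym (Fin (d + 1)) q → ℝ) (u : Fin d → ℝ)
    (j : Fin d → Fin M) (s : Sym (Fin (d + 1)) q) : ℝ :=
  ∑ i, cellWeight M (coarsePos q M u) i * e i j s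

/-- Computed polynomial coefficients at `u`. The exponent `d` in the scale of the products pays for
the sum of `M ^ d` errors. -/
def coefNet (e : (Fin d → Fin M) → (Fin d → Fin M) → Sym (Fin (d + 1)) q → ℝ) (u : Fin d → ℝ)
    (s : Sym (Fin (d + 1)) q) : ℝ :=
  ∑ j, mulNet ((M : ℝ) ^ (2 * q + 2 + d)) (cellWeight M (finePos q M u) j) (selected q M e u j s)

/-- The computed value of the local polynomial at `u`. The products have error order `2 q + 2` at
the small scale `M`, which keeps the factor `M ^ (q + 1)` in front of the neurons small. -/
def polyNet (e : (Fin d → Fin M) → (Fin d → Fin M) → Sym (Fin (d + 1)) q → ℝ) (u : Fin d → ℝ) :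
    ℝ :=
  ∑ s, prodNet (q + 1) (2 * q + 1) M
    (Fin.cons (coefNet q M e u s) fun i => homog (carry q M 5 u) (symEnum s i))

end Pipeline

theorem exists_carry_bound (q : ℕ) : ∃ C, 0 ≤ C ∧ ∃ M₀ : ℕ, 2 ≤ M₀ ∧ ∀ M ≥ M₀, ∀ d : ℕ,
    ∀ u : Fin d → ℝ, (∀ l, |u l| ≤ 1) → ∀ n ≤ 5, ∀ l,
      |carry q M n u l - u l| ≤ C / (M : ℝ) ^ (2 * q + 2) := by
  obtain ⟨C, hC0, hC⟩ := exists_abs_idNet_iterate_sub_le 5 1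
  refine ⟨C, hC0, max 2 ⌈C⌉₊, le_max_left _ _, fun M hM d u hu n hn l => ?_⟩
  have hM2 : 2 ≤ M := (le_max_left _ _).trans hM
  have hM1 : (1 : ℝ) ≤ M := by exact_mod_cast (by omega : 1 ≤ M)
  have hMC : C ≤ M := (Nat.le_ceil C).trans (by exact_mod_cast (le_max_right _ _).trans hM)
  exact hC _ (hMC.trans (le_self_pow₀ hM1 (by omega))) (one_le_pow₀ hM1) n hn _ (hu l)

theorem exists_position_bound (q : ℕ) (hq : 1 ≤ q) : ∃ c, 0 ≤ c ∧ ∃ M₀ : ℕ, 2 ≤ M₀ ∧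
    ∀ M ≥ M₀, ∀ d : ℕ, ∀ u : Fin d → ℝ, (∀ l, |u l| ≤ 1) → ∀ l,
      |coarsePos q M u l - M * u l| ≤ 1 / M ∧ |finePos q M u l - M * fold M (M * u l)| ≤ c := by
  obtain ⟨C, hC0, M₁, hM₁, hC⟩ := exists_carry_bound q
  obtain ⟨c, hc0, hc⟩ := exists_abs_foldNet_sub_le
  refine ⟨c, hc0, max M₁ ⌈C⌉₊, le_max_of_le_left hM₁, fun M hM d u hu l => ?_⟩
  have hMM₁ : M₁ ≤ M := (le_max_left _ _).trans hM
  have hM2 : 2 ≤ M := hM₁.trans hMM₁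
  have hM1 : (1 : ℝ) ≤ M := by exact_mod_cast (by omega : 1 ≤ M)
  have hMp : (0 : ℝ) < M := by linarith
  have hMC : C ≤ M := (Nat.le_ceil C).trans (by exact_mod_cast (le_max_right _ _).trans hM)
  have hcarry : ∀ n ≤ 5, |carry q M n u l - u l| ≤ 1 / (M : ℝ) ^ 3 := by
    intro n hn
    refine (hC M hMM₁ d u hu n hn l).trans ?_
    rw [div_le_div_iff₀ (by positivity) (by positivity), one_mul]
    calc C * (M : ℝ) ^ 3 ≤ M * (M : ℝ) ^ 3 := by gcongr
      _ = (M : ℝ) ^ 4 := by ring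
      _ ≤ (M : ℝ) ^ (2 * q + 2) := pow_le_pow_right₀ hM1 (by omega)
  constructor
  · rw [coarsePos, ← mul_sub, abs_mul, Nat.abs_cast]
    calc (M : ℝ) * |carry q M 2 u l - u l| ≤ M * (1 / (M : ℝ) ^ 3) := by
          gcongr; exact hcarry 2 (by norm_num)
      _ = 1 / (M : ℝ) ^ 2 := by field_simp
      _ ≤ 1 / M := by
          apply one_div_le_one_div_of_le hMp
          exact le_self_pow₀ hM1 (by norm_num)
  · rw [finePos, ← mul_sub, abs_mul, Nat.abs_cast]
    calc (M : ℝ) * |foldNet M (u l) (carry q M 1 u l) - fold M (M * u l)| ≤ M * (c / M) := by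
          gcongr; exact hc M hM2 _ _ (hu l) (hcarry 1 (by norm_num))
      _ = c := by field_simp

theorem abs_prod_sub_prod_le {n : ℕ} {x y : Fin n → ℝ} {ε : ℝ} (hε : 0 ≤ ε)
    (hx : ∀ i, |x i| ≤ 2) (hy : ∀ i, |y i| ≤ 2) (hxy : ∀ i, |x i - y i| ≤ ε) :
    |∏ i, x i - ∏ i, y i| ≤ n * 2 ^ n * ε := by
  induction n with
  | zero => simp
  | succ n ih =>
    rw [Fin.prod_univ_succ, Fin.prod_univ_succ]
    have h1 := ih (fun i => hx i.succ) (fun i => hy i.succ) (fun i => hxy i.succ)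
    have h2 : |∏ i : Fin n, y i.succ| ≤ 2 ^ n := by
      rw [Finset.abs_prod]
      calc _ ≤ ∏ _i : Fin n, (2 : ℝ) :=
            Finset.prod_le_prod (fun _ _ => abs_nonneg _) fun i _ => hy i.succ
        _ = 2 ^ n := by simp
    rw [show x 0 * ∏ i : Fin n, x i.succ - y 0 * ∏ i : Fin n, y i.succ
      = x 0 * (∏ i : Fin n, x i.succ - ∏ i : Fin n, y i.succ)
        + (x 0 - y 0) * ∏ i : Fin n, y i.succ by ring]
    refine (abs_add_le _ _).trans ?_
    rw [abs_mul, abs_mul]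
    calc _ ≤ 2 * (n * 2 ^ n * ε) + ε * 2 ^ n := by
          gcongr
          · exact hx 0
          · exact hxy 0
      _ ≤ ((n + 1 : ℕ) : ℝ) * 2 ^ (n + 1) * ε := by
          push_cast; rw [pow_succ]
          have : (0 : ℝ) ≤ 2 ^ n * ε := by positivity
          nlinarith

theorem abs_homog_le {d : ℕ} {u : Fin d → ℝ} {A : ℝ} (hA : 1 ≤ A) (hu : ∀ l, |u l| ≤ A)
    (k : Fin (d + 1)) : |homog u k| ≤ A := by
  refine Fin.cases ?_ (fun l => ?_) k
  · simpa [homog] using hA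
  · simpa [homog] using hu l

theorem abs_symMonomial_le_one {d q : ℕ} (s : Sym (Fin (d + 1)) q) {u : Fin d → ℝ}
    (hu : ∀ l, |u l| ≤ 1) : |symMonomial s u| ≤ 1 := by
  rw [symMonomial, Finset.abs_prod]
  exact Finset.prod_le_one (fun _ _ => abs_nonneg _) fun i _ => abs_homog_le le_rfl hu _

/-- The local polynomials of the table `e` have normalized coefficients, and approximate `F` to the
order `p` in the distance from the corner of their fine cell. The distance `r / M` is arbitrary,
since the tails of the cell weights also involve polynomials of remote cells. -/
def IsLocalApprox {d : ℕ} (q M : ℕ) (p : ℝ) (F : (Fin d → ℝ) → ℝ)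
    (e : (Fin d → Fin M) → (Fin d → Fin M) → Sym (Fin (d + 1)) q → ℝ) : Prop :=
  (∀ i j s, |e i j s| ≤ 1) ∧ ∀ u : Fin d → ℝ, (∀ l, 0 ≤ u l ∧ u l ≤ 1) → ∀ i j, ∀ r : ℝ,
    (∀ l, |M * u l - corner M (i l) (j l)| ≤ r) →
      |F u - ∑ s, e i j s * symMonomial s u| ≤ (r / M) ^ p

theorem IsLocalApprox.abs_sub_le_one {d q M : ℕ} {p : ℝ} {F : (Fin d → ℝ) → ℝ}
    {e : (Fin d → Fin M) → (Fin d → Fin M) → Sym (Fin (d + 1)) q → ℝ}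
    (h : IsLocalApprox q M p F e) (hM0 : 0 < M) {u : Fin d → ℝ} (hu : ∀ l, 0 ≤ u l ∧ u l ≤ 1)
    (i j : Fin d → Fin M) : |F u - ∑ s, e i j s * symMonomial s u| ≤ 1 := by
  have hMp : (0 : ℝ) < M := by exact_mod_cast hM0
  refine (h.2 u hu i j M fun l => ?_).trans (le_of_eq ?_)
  · have h1 := corner_mem (M := M) (i := i l) (j l).2
    have h2 : ((i l : ℕ) : ℝ) + 1 ≤ M := by exact_mod_cast (i l).2
    have h3 : (0 : ℝ) ≤ (i l : ℕ) := Nat.cast_nonneg _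
    have h4 : (M : ℝ) * u l ≤ M := mul_le_of_le_one_right hMp.le (hu l).2
    have h5 : 0 ≤ (M : ℝ) * u l := mul_nonneg hMp.le (hu l).1
    exact abs_le.2 ⟨by linarith, by linarith⟩
  · rw [div_self hMp.ne', Real.one_rpow]

theorem IsLocalApprox.abs_le {d q M : ℕ} {p : ℝ} {F : (Fin d → ℝ) → ℝ}
    {e : (Fin d → Fin M) → (Fin d → Fin M) → Sym (Fin (d + 1)) q → ℝ}
    (h : IsLocalApprox q M p F e) (hM0 : 0 < M) {u : Fin d → ℝ} (hu : ∀ l, 0 ≤ u l ∧ u l ≤ 1) :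
    |F u| ≤ 1 + (Fintype.card (Sym (Fin (d + 1)) q) : ℕ) := by
  have habs : ∀ l, |u l| ≤ 1 := fun l => by rw [abs_of_nonneg (hu l).1]; exact (hu l).2
  let i₀ : Fin d → Fin M := fun _ => ⟨0, hM0⟩
  have h1 := h.abs_sub_le_one hM0 hu i₀ i₀
  have h2 : |∑ s, e i₀ i₀ s * symMonomial s u| ≤ (Fintype.card (Sym (Fin (d + 1)) q) : ℕ) := by
    refine (Finset.abs_sum_le_sum_abs _ _).trans ?_
    calc _ ≤ ∑ _s : Sym (Fin (d + 1)) q, (1 : ℝ) := by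
          refine Finset.sum_le_sum fun s _ => ?_
          rw [abs_mul]
          exact mul_le_one₀ (h.1 _ _ _) (abs_nonneg _) (abs_symMonomial_le_one s habs)
      _ = (Fintype.card (Sym (Fin (d + 1)) q) : ℕ) := by simp
  have h3 := abs_add_le (F u - ∑ s, e i₀ i₀ s * symMonomial s u)
    (∑ s, e i₀ i₀ s * symMonomial s u)
  rw [sub_add_cancel] at h3
  linarith

/-- The ideal average of the local polynomials approximates `F` to the order of the fine mesh. -/
theorem exists_average_bound (d q : ℕ) (hq : 1 ≤ q) (p : ℝ) (hp : 0 < p)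
    (hpq : p ≤ q + 1) :
    ∃ C, 0 ≤ C ∧ ∃ M₀ : ℕ, 2 ≤ M₀ ∧ ∀ M ≥ M₀, ∀ (F : (Fin d → ℝ) → ℝ) e,
      IsLocalApprox q M p F e → ∀ u : Fin d → ℝ, (∀ l, 0 ≤ u l ∧ u l ≤ 1) →
      |∑ s, (∑ j, cellWeight M (finePos q M u) j * selected q M e u j s) * symMonomial s u - F u|
        ≤ C / (M : ℝ) ^ (2 * p) := by
  obtain ⟨c, hc0, M₀, hM₀, hpos⟩ := exists_position_bound q hq
  obtain ⟨Ct, hCt0, hCt⟩ := exists_cellTail_le d (2 * q + 2)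
  obtain ⟨Ce, hCe0, hCe⟩ := exists_cellTail_le 0 (2 * q + 2)
  set Nq : ℝ := ((Fintype.card (Sym (Fin (d + 1)) q) : ℕ) : ℝ) with hNq
  refine ⟨8 ^ d * (8 ^ d * (c + 6) ^ p + Ct) + Ct * (8 ^ d + Ct) + (1 + Nq) * (2 * Ce),
    by positivity, M₀, hM₀, ?_⟩
  intro M hM F e hFe u hu
  have hM2 : 2 ≤ M := hM₀.trans hM
  have hM0 : 0 < M := by omega
  have hM1 : (1 : ℝ) ≤ M := by exact_mod_cast hM0
  have hMp : (0 : ℝ) < M := by linarith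
  have habs : ∀ l, |u l| ≤ 1 := fun l => by rw [abs_of_nonneg (hu l).1]; exact (hu l).2
  set A := cellWeight M (coarsePos q M u) with hA
  set B := cellWeight M (finePos q M u) with hB
  set T : (Fin d → Fin M) → (Fin d → Fin M) → ℝ := fun i j => ∑ s, e i j s * symMonomial s u
    with hT
  set η : ℝ := 1 / (M : ℝ) ^ (2 * p) with hη
  have hη0 : 0 ≤ η := by positivity
  have hη1 : η ≤ 1 := by
    rw [hη, div_le_one (by positivity)]
    exact Real.one_le_rpow hM1 (by linarith)
  have hpow : 1 / (M : ℝ) ^ (2 * q + 2) ≤ η := by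
    apply one_div_le_one_div_of_le (by positivity)
    rw [← Real.rpow_natCast]
    exact Real.rpow_le_rpow_of_exponent_le hM1 (by push_cast; linarith)
  have htail : cellTail d M ≤ Ct * η := by
    refine (hCt M hM0).trans ?_
    rw [div_eq_mul_one_div]; gcongr
  have htail1 : cellTail d M ≤ Ct := htail.trans (by nlinarith)
  have hexp : 1 - act (M / 2) ≤ Ce * η := by
    refine (one_sub_act_le_exp _).trans ?_
    refine le_trans ?_ ((hCe M hM0).trans (by rw [div_eq_mul_one_div]; gcongr))
    unfold cellTail
    simp only [pow_zero, one_mul]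
    calc Real.exp (-((M : ℝ) / 2)) ≤ Real.exp (-((M : ℝ) / 4)) :=
          Real.exp_le_exp.2 (by linarith)
      _ ≤ M * Real.exp (-((M : ℝ) / 4)) :=
          le_mul_of_one_le_left (Real.exp_pos _).le hM1
  have hφ1 : ∀ i j, |F u - T i j| ≤ 1 := fun i j => hFe.abs_sub_le_one hM0 hu i j
  have hφ2 : ∀ i j, (∀ l, NearCell M (coarsePos q M u l) (i l)) →
      (∀ l, NearCell M (finePos q M u l) (j l)) → |F u - T i j| ≤ (c + 6) ^ p * η := by
    intro i j hi hj
    refine (hFe.2 u hu i j ((c + 6) / M) fun l => ?_).trans (le_of_eq ?_)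
    · obtain ⟨h1, h2⟩ := hpos M hM d u habs l
      exact abs_sub_corner_le (i l).2 (mul_nonneg hMp.le (hu l).1)
        (mul_le_of_le_one_right hMp.le (hu l).2) h1 h2 (hi l) (hj l)
    · rw [div_div, ← pow_two, Real.div_rpow (by linarith) (by positivity), hη,
        ← Real.rpow_natCast, ← Real.rpow_mul hMp.le, div_eq_mul_one_div]
      norm_num
  have hinner1 : ∀ i, ∑ j, |B j| * |F u - T i j| ≤ 8 ^ d + Ct := by
    intro i
    refine (sum_abs_cellWeight_mul_le hM2 _ _ 1 1 zero_le_one zero_le_one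
      (fun j _ => hφ1 i j) (hφ1 i)).trans ?_
    linarith
  have hinner2 : ∀ i, (∀ l, NearCell M (coarsePos q M u l) (i l)) →
      ∑ j, |B j| * |F u - T i j| ≤ 8 ^ d * ((c + 6) ^ p * η) + Ct * η := by
    intro i hi
    refine (sum_abs_cellWeight_mul_le hM2 _ _ ((c + 6) ^ p * η) 1 (by positivity) zero_le_one
      (fun j hj => hφ2 i j hi hj) (hφ1 i)).trans ?_
    linarith
  have houter := sum_abs_cellWeight_mul_le hM2 (coarsePos q M u)
    (fun i => ∑ j, |B j| * |F u - T i j|) (8 ^ d * ((c + 6) ^ p * η) + Ct * η) (8 ^ d + Ct)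
    (by positivity) (by positivity) hinner2 hinner1
  have hsum : ∑ s, (∑ j, B j * selected q M e u j s) * symMonomial s u
      = ∑ i, ∑ j, A i * B j * T i j := by
    simp only [selected, hT, Finset.sum_mul, Finset.mul_sum]
    rw [Finset.sum_comm]
    simp_rw [Finset.sum_comm (s := (Finset.univ : Finset (Sym (Fin (d + 1)) q)))]
    rw [Finset.sum_comm]
    refine Finset.sum_congr rfl fun i _ => Finset.sum_congr rfl fun j _ =>
      Finset.sum_congr rfl fun s _ => by ring
  have hAB : ∑ i, ∑ j, A i * B j * F u = act (M / 2) * act (M / 2) * F u := by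
    conv_rhs =>
      enter [1]
      congr
      · rw [← sum_cellWeight hM0 (coarsePos q M u)]
      · rw [← sum_cellWeight hM0 (finePos q M u)]
    rw [Finset.sum_mul_sum, Finset.sum_mul]
    exact Finset.sum_congr rfl fun i _ => by rw [Finset.sum_mul]
  have hF : |F u| ≤ 1 + Nq := hFe.abs_le hM0 hu
  -- The weights `A i * B j` sum to `act (M / 2) ^ 2` instead of `1`, hence the second term.
  have hdecomp : ∑ s, (∑ j, B j * selected q M e u j s) * symMonomial s u - F u
      = -(∑ i, ∑ j, A i * B j * (F u - T i j))
        + (act (M / 2) * act (M / 2) - 1) * F u := by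
    rw [hsum]
    simp_rw [mul_sub, Finset.sum_sub_distrib]
    rw [hAB]; ring
  rw [hdecomp]
  refine (abs_add_le _ _).trans ?_
  rw [abs_neg, abs_mul]
  have hb1 : |∑ i, ∑ j, A i * B j * (F u - T i j)|
      ≤ ∑ i, |A i| * ∑ j, |B j| * |F u - T i j| := by
    refine (Finset.abs_sum_le_sum_abs _ _).trans (Finset.sum_le_sum fun i _ => ?_)
    refine (Finset.abs_sum_le_sum_abs _ _).trans (le_of_eq ?_)
    rw [Finset.mul_sum]
    exact Finset.sum_congr rfl fun j _ => by rw [abs_mul, abs_mul, mul_assoc]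
  have hb2 : |act ((M : ℝ) / 2) * act (M / 2) - 1| ≤ 2 * (Ce * η) := by
    have h1 := act_pos ((M : ℝ) / 2)
    have h2 := act_lt_one ((M : ℝ) / 2)
    rw [abs_of_nonpos (by nlinarith)]
    nlinarith
  have hb3 : cellTail d M * (8 ^ d + Ct) ≤ Ct * η * (8 ^ d + Ct) := by gcongr
  calc _ ≤ (8 ^ d * (8 ^ d * ((c + 6) ^ p * η) + Ct * η) + Ct * η * (8 ^ d + Ct))
        + 2 * (Ce * η) * (1 + Nq) := by
        refine add_le_add (hb1.trans (houter.trans (by linarith))) ?_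
        exact mul_le_mul hb2 hF (abs_nonneg _) (by positivity)
    _ = _ := by rw [hη]; ring

/-- The network approximates `F` to the order of the fine mesh. -/
theorem exists_polyNet_bound (d q : ℕ) (hq : 1 ≤ q) (p : ℝ) (hp : 0 < p)
    (hpq : p ≤ q + 1) :
    ∃ C, 0 ≤ C ∧ ∃ M₀ : ℕ, 2 ≤ M₀ ∧ ∀ M ≥ M₀, ∀ (F : (Fin d → ℝ) → ℝ) e,
      IsLocalApprox q M p F e → ∀ u : Fin d → ℝ, (∀ l, 0 ≤ u l ∧ u l ≤ 1) →
      |polyNet q M e u - F u| ≤ C / (M : ℝ) ^ (2 * p) := by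
  obtain ⟨C₁, hC₁0, M₁, hM₁, hav⟩ := exists_average_bound d q hq p hp hpq
  obtain ⟨Ct, hCt0, hCt⟩ := exists_cellTail_le d 0
  obtain ⟨Cc, hCc0, M₂, hM₂, hcarry⟩ := exists_carry_bound q
  set A : ℝ := 8 ^ d + Ct with hAdef
  have hA1 : 1 ≤ A := by
    have : (1 : ℝ) ≤ 8 ^ d := one_le_pow₀ (by norm_num)
    linarith
  set C₂ : ℝ := 4 * ridgeErr 2 0 * A ^ 3 with hC₂
  have hC₂0 : 0 ≤ C₂ := mul_nonneg (mul_nonneg (by norm_num) (ridgeErr_nonneg _ _)) (by positivity)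
  set A' : ℝ := A * A + C₂ + 2 with hA'
  obtain ⟨C₃, hC₃0, hprod⟩ := exists_abs_prodNet_sub_le (q + 1) (2 * q + 1) A'
  set Nq : ℝ := ((Fintype.card (Sym (Fin (d + 1)) q) : ℕ) : ℝ) with hNq
  set m₃ : ℕ := ⌈2 * A + (q + 1 : ℕ) * A' + Cc⌉₊ with hm₃
  refine ⟨Nq * (C₃ + (C₂ * 2 ^ q + A * A * (q * 2 ^ q * Cc))) + C₁, by positivity,
    max (max M₁ M₂) m₃, le_max_of_le_left (le_max_of_le_left hM₁), ?_⟩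
  intro M hM F e hFe u hu
  have hMM₁ : M₁ ≤ M := (le_max_left _ _).trans ((le_max_left _ _).trans hM)
  have hMM₂ : M₂ ≤ M := (le_max_right _ _).trans ((le_max_left _ _).trans hM)
  have hM2 : 2 ≤ M := hM₁.trans hMM₁
  have hM0 : 0 < M := by omega
  have hM1 : (1 : ℝ) ≤ M := by exact_mod_cast hM0
  have hMp : (0 : ℝ) < M := by linarith
  have hMbig : 2 * A + (q + 1 : ℕ) * A' + Cc ≤ M :=
    (Nat.le_ceil _).trans (by exact_mod_cast (le_max_right _ _).trans hM)
  have hA'2 : 2 ≤ A' := by rw [hA']; nlinarith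
  have hMA : 2 * A ≤ M := by
    have : 0 ≤ ((q + 1 : ℕ) : ℝ) * A' := by positivity
    linarith
  have hMA' : ((q + 1 : ℕ) : ℝ) * A' ≤ M := by linarith
  have hMC : Cc ≤ M := by
    have : 0 ≤ ((q + 1 : ℕ) : ℝ) * A' := by positivity
    linarith
  have habs : ∀ l, |u l| ≤ 1 := fun l => by rw [abs_of_nonneg (hu l).1]; exact (hu l).2
  have hcv : ∀ l, |carry q M 5 u l - u l| ≤ Cc / (M : ℝ) ^ (2 * q + 2) := fun l =>
    hcarry M hMM₂ d u habs 5 le_rfl l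
  have hcv2 : ∀ l, |carry q M 5 u l| ≤ 2 := by
    intro l
    have h1 : Cc / (M : ℝ) ^ (2 * q + 2) ≤ 1 := by
      rw [div_le_one (by positivity)]
      exact hMC.trans (le_self_pow₀ hM1 (by omega))
    have h2 := abs_add_le (carry q M 5 u l - u l) (u l)
    rw [sub_add_cancel] at h2
    linarith [hcv l, habs l]
  set η : ℝ := 1 / (M : ℝ) ^ (2 * q + 2) with hη
  have hη0 : 0 ≤ η := by positivity
  have hη1 : η ≤ 1 := by
    rw [hη, div_le_one (by positivity)]; exact one_le_pow₀ hM1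
  have htail : cellTail d M ≤ Ct := by simpa using hCt M hM0
  have htot : ∀ v : Fin d → ℝ, ∑ i, |cellWeight M v i| ≤ A := by
    intro v
    have h := sum_abs_cellWeight_mul_le hM2 v (fun _ => 1) 1 1 zero_le_one zero_le_one
      (fun _ _ => le_rfl) (fun _ => le_rfl)
    simp only [mul_one] at h
    linarith
  have hsel : ∀ j s, |selected q M e u j s| ≤ A := by
    intro j s
    refine (Finset.abs_sum_le_sum_abs _ _).trans (le_trans ?_ (htot (coarsePos q M u)))
    refine Finset.sum_le_sum fun i _ => ?_
    rw [abs_mul]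
    exact mul_le_of_le_one_right (abs_nonneg _) (hFe.1 _ _ _)
  have hB : ∀ j, |cellWeight M (finePos q M u) j| ≤ A := fun j =>
    (Finset.single_le_sum (f := fun j => |cellWeight M (finePos q M u) j|)
      (fun _ _ => abs_nonneg _) (Finset.mem_univ j)).trans (htot _)
  set E : Sym (Fin (d + 1)) q → ℝ := fun s =>
    ∑ j, cellWeight M (finePos q M u) j * selected q M e u j s with hE
  have hEA : ∀ s, |E s| ≤ A * A := by
    intro s
    refine (Finset.abs_sum_le_sum_abs _ _).trans ?_
    calc _ ≤ ∑ j, |cellWeight M (finePos q M u) j| * A := by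
          refine Finset.sum_le_sum fun j _ => ?_
          rw [abs_mul]
          exact mul_le_mul_of_nonneg_left (hsel j s) (abs_nonneg _)
      _ ≤ A * A := by
          rw [← Finset.sum_mul]
          exact mul_le_mul_of_nonneg_right (htot _) (by linarith)
  have hcoef : ∀ s, |coefNet q M e u s - E s| ≤ C₂ * η := by
    intro s
    rw [coefNet, hE]
    beta_reduce
    rw [← Finset.sum_sub_distrib]
    refine (Finset.abs_sum_le_sum_abs _ _).trans ?_
    calc _ ≤ ∑ _j : Fin d → Fin M, C₂ / (M : ℝ) ^ (2 * q + 2 + d) := by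
          refine Finset.sum_le_sum fun j _ => ?_
          refine abs_mulNet_sub_le (A := A) (by positivity) ?_ (hB j) (hsel j s)
          exact hMA.trans (le_self_pow₀ hM1 (by omega))
      _ = C₂ * η := by
          rw [Finset.sum_const, Finset.card_univ, hη]
          simp only [Fintype.card_pi, Fintype.card_fin, Finset.prod_const, Finset.card_univ,
            nsmul_eq_mul]
          push_cast
          rw [pow_add]; field_simp
  have hcoefA : ∀ s, |coefNet q M e u s| ≤ A' := by
    intro s
    have h2 := abs_add_le (coefNet q M e u s - E s) (E s)
    rw [sub_add_cancel] at h2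
    have h3 : C₂ * η ≤ C₂ := mul_le_of_le_one_right hC₂0 hη1
    rw [hA']
    linarith [hcoef s, hEA s]
  have hmon : ∀ s : Sym (Fin (d + 1)) q,
      |∏ i, homog (carry q M 5 u) (symEnum s i) - symMonomial s u| ≤ q * 2 ^ q * Cc * η := by
    intro s
    have h := abs_prod_sub_prod_le (x := fun i => homog (carry q M 5 u) (symEnum s i))
      (y := fun i => homog u (symEnum s i)) (ε := Cc * η) (by positivity)
      (fun i => abs_homog_le (by norm_num) hcv2 _)
      (fun i => abs_homog_le (by norm_num) (fun l => (habs l).trans (by norm_num)) _)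
      (fun i => by
        refine Fin.cases ?_ (fun l => ?_) (symEnum s i)
        · simp only [homog, Fin.cons_zero, sub_self, abs_zero]; positivity
        · simp only [homog, Fin.cons_succ]
          refine (hcv l).trans (le_of_eq ?_)
          rw [hη]; ring)
    refine h.trans (le_of_eq (by ring))
  have hmon2 : ∀ s : Sym (Fin (d + 1)) q,
      |∏ i, homog (carry q M 5 u) (symEnum s i)| ≤ 2 ^ q := by
    intro s
    rw [Finset.abs_prod]
    calc _ ≤ ∏ _i : Fin q, (2 : ℝ) := Finset.prod_le_prod (fun _ _ => abs_nonneg _)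
          fun i _ => abs_homog_le (by norm_num) hcv2 _
      _ = 2 ^ q := by simp
  have hterm : ∀ s, |prodNet (q + 1) (2 * q + 1) M
      (Fin.cons (coefNet q M e u s) fun i => homog (carry q M 5 u) (symEnum s i))
        - E s * symMonomial s u| ≤ (C₃ + (C₂ * 2 ^ q + A * A * (q * 2 ^ q * Cc))) * η := by
    intro s
    have h1 := hprod M hM1 hMA'
      (Fin.cons (coefNet q M e u s) fun i => homog (carry q M 5 u) (symEnum s i)) (by
        intro i
        refine Fin.cases ?_ (fun i => ?_) i
        · simpa using hcoefA s
        · simp only [Fin.cons_succ]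
          exact (abs_homog_le (by norm_num) hcv2 _).trans hA'2)
    rw [Fin.prod_univ_succ, Fin.cons_zero] at h1
    simp only [Fin.cons_succ] at h1
    set P := ∏ i, homog (carry q M 5 u) (symEnum s i) with hP
    set y := prodNet (q + 1) (2 * q + 1) M
      (Fin.cons (coefNet q M e u s) fun i => homog (carry q M 5 u) (symEnum s i)) with hy
    rw [show y - E s * symMonomial s u = (y - coefNet q M e u s * P)
      + ((coefNet q M e u s - E s) * P + E s * (P - symMonomial s u)) by ring]
    refine (abs_add_le _ _).trans ((add_le_add h1 ((abs_add_le _ _).trans ?_)).trans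
      (le_of_eq (?_ : C₃ / (M : ℝ) ^ (2 * q + 1 + 1) + (C₂ * η * 2 ^ q
        + A * A * (q * 2 ^ q * Cc * η)) = _)))
    · rw [abs_mul, abs_mul]
      exact add_le_add (mul_le_mul (hcoef s) (hmon2 s) (abs_nonneg _) (by positivity))
        (mul_le_mul (hEA s) (hmon s) (abs_nonneg _) (by positivity))
    · rw [hη]; ring
  have hav' := hav M hMM₁ F e hFe u hu
  have hpow : η ≤ 1 / (M : ℝ) ^ (2 * p) := by
    apply one_div_le_one_div_of_le (by positivity)
    rw [← Real.rpow_natCast]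
    exact Real.rpow_le_rpow_of_exponent_le hM1 (by push_cast; linarith)
  have hpoly : |polyNet q M e u - ∑ s, E s * symMonomial s u|
      ≤ Nq * (C₃ + (C₂ * 2 ^ q + A * A * (q * 2 ^ q * Cc))) * η := by
    rw [polyNet, ← Finset.sum_sub_distrib]
    refine (Finset.abs_sum_le_sum_abs _ _).trans
      ((Finset.sum_le_sum fun s _ => hterm s).trans (le_of_eq ?_))
    rw [Finset.sum_const, Finset.card_univ, nsmul_eq_mul, hNq]; ring
  have hfin := abs_add_le (polyNet q M e u - ∑ s, E s * symMonomial s u)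
    (∑ s, E s * symMonomial s u - F u)
  rw [sub_add_sub_cancel] at hfin
  refine hfin.trans ?_
  rw [add_div]
  refine add_le_add (hpoly.trans ?_) hav'
  rw [div_eq_mul_one_div]
  gcongr

/-! ### Realising the approximation by a network -/

theorem AffIn.mulNet {X ι : Type*} [Fintype ι] {z : ι → X → ℝ} {ρ : ℝ} (hρ : 0 ≤ ρ)
    {x y : X → ℝ} (g₁ g₂ : Fin (2 + 0 + 1) → ι)
    (h₁ : ∀ i a, z (g₁ i) a = act (Mscale.ridgeArg 2 0 ρ (x a + y a) i))
    (h₂ : ∀ i a, z (g₂ i) a = act (Mscale.ridgeArg 2 0 ρ (x a - y a) i)) :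
    AffIn (ρ ^ 2 * ridgeSize 2 0) z fun a => mulNet ρ (x a) (y a) := by
  have h := ((AffIn.ridge (y := fun a => x a + y a) 2 0 hρ g₁ h₁).sub
    (AffIn.ridge (y := fun a => x a - y a) 2 0 hρ g₂ h₂)).const_mul (1 / 4)
  refine AffIn.mono (h.congr fun a => ?_) ?_
  · unfold Mscale.mulNet; ring
  · rw [abs_of_pos (by norm_num)]
    have := mul_nonneg (pow_nonneg hρ 2) (ridgeSize_nonneg 2 0)
    linarith

section Layers

variable {d : ℕ} (q M : ℕ) (r : ℝ)

/-- The affine map from `[-r, r]^d` to `[0, 1]^d`. -/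
def unitPos (x : EuclideanSpace ℝ (Fin d)) (l : Fin d) : ℝ := x l / (2 * r) + 1 / 2

/-- Arguments of the neurons of the `n + 1`-st hidden layer that carry the input coordinates. -/
def argCarry (n : ℕ) (a : Fin d × Fin (1 + 0 + 1)) (x : EuclideanSpace ℝ (Fin d)) : ℝ :=
  ridgeArg 1 0 ((M : ℝ) ^ (2 * q + 2)) (carry q M n (unitPos r x) a.1) a.2

/-- Arguments of the first hidden layer: coarse steps. -/
def arg₁ : (Fin d × Fin M) ⊕ (Fin d × Fin (1 + 0 + 1)) → EuclideanSpace ℝ (Fin d) → ℝ :=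
  Sum.elim (fun a x => (M : ℝ) ^ 2 * (M * unitPos r x a.1 - (a.2 : ℕ))) (argCarry q M r 0)

/-- Arguments of the second hidden layer: the zigzag. -/
def arg₂ : ((Fin d × Fin (1 + 0 + 1)) ⊕ ((Fin d × Fin (2 + 0 + 1)) ⊕ (Fin d × Fin (2 + 0 + 1)))) ⊕
    (Fin d × Fin (1 + 0 + 1)) → EuclideanSpace ℝ (Fin d) → ℝ :=
  Sum.elim (Sum.elim
    (fun a x => ridgeArg 1 0 ((M : ℝ) ^ 5)
      (M * carry q M 1 (unitPos r x) a.1 - foldOffset M (unitPos r x a.1)) a.2)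
    (Sum.elim
      (fun a x => ridgeArg 2 0 ((M : ℝ) ^ 5)
        (carry q M 1 (unitPos r x) a.1 + foldSlope M (unitPos r x a.1)) a.2)
      (fun a x => ridgeArg 2 0 ((M : ℝ) ^ 5)
        (carry q M 1 (unitPos r x) a.1 - foldSlope M (unitPos r x a.1)) a.2)))
    (argCarry q M r 1)

/-- Arguments of the third hidden layer: coarse and fine steps. -/
def arg₃ : ((Fin d × Fin M) ⊕ (Fin d × Fin M)) ⊕ (Fin d × Fin (1 + 0 + 1)) →
    EuclideanSpace ℝ (Fin d) → ℝ :=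
  Sum.elim (Sum.elim
    (fun a x => (M : ℝ) ^ 2 * (coarsePos q M (unitPos r x) a.1 - (a.2 : ℕ)))
    (fun a x => (M : ℝ) ^ 2 * (finePos q M (unitPos r x) a.1 - (a.2 : ℕ))))
    (argCarry q M r 2)

/-- Arguments of the fourth hidden layer: orthants of the coarse and of the fine grid. -/
def arg₄ : ((Fin d → Fin M) ⊕ (Fin d → Fin M)) ⊕ (Fin d × Fin (1 + 0 + 1)) →
    EuclideanSpace ℝ (Fin d) → ℝ :=
  Sum.elim (Sum.elim
    (fun k x => M * (∑ l, step M (coarsePos q M (unitPos r x) l) (k l) - d + 1 / 2))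
    (fun k x => M * (∑ l, step M (finePos q M (unitPos r x) l) (k l) - d + 1 / 2)))
    (argCarry q M r 3)

/-- Arguments of the fifth hidden layer: products of fine cell weights with selected table
entries. -/
def arg₅ (e : (Fin d → Fin M) → (Fin d → Fin M) → Sym (Fin (d + 1)) q → ℝ) :
    ((((Fin d → Fin M) × Sym (Fin (d + 1)) q) × Fin (2 + 0 + 1)) ⊕
      (((Fin d → Fin M) × Sym (Fin (d + 1)) q) × Fin (2 + 0 + 1))) ⊕
    (Fin d × Fin (1 + 0 + 1)) → EuclideanSpace ℝ (Fin d) → ℝ :=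
  Sum.elim (Sum.elim
    (fun a x => ridgeArg 2 0 ((M : ℝ) ^ (2 * q + 2 + d))
      (cellWeight M (finePos q M (unitPos r x)) a.1.1
        + selected q M e (unitPos r x) a.1.1 a.1.2) a.2)
    (fun a x => ridgeArg 2 0 ((M : ℝ) ^ (2 * q + 2 + d))
      (cellWeight M (finePos q M (unitPos r x)) a.1.1
        - selected q M e (unitPos r x) a.1.1 a.1.2) a.2))
    (argCarry q M r 4)

/-- Factors of the monomial `s` with its computed coefficient. -/
def polyFactor (e : (Fin d → Fin M) → (Fin d → Fin M) → Sym (Fin (d + 1)) q → ℝ)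
    (s : Sym (Fin (d + 1)) q) (x : EuclideanSpace ℝ (Fin d)) : Fin (q + 1) → ℝ :=
  Fin.cons (coefNet q M e (unitPos r x) s)
    fun i => homog (carry q M 5 (unitPos r x)) (symEnum s i)

/-- Arguments of the sixth hidden layer: evaluation of the local polynomial. -/
def arg₆ (e : (Fin d → Fin M) → (Fin d → Fin M) → Sym (Fin (d + 1)) q → ℝ) :
    (Sym (Fin (d + 1)) q × Finset (Fin (q + 1))) × Fin (q + 1 + (2 * q + 1) + 1) →
    EuclideanSpace ℝ (Fin d) → ℝ :=
  fun a x => ridgeArg (q + 1) (2 * q + 1) M (∑ i ∈ a.1.2, polyFactor q M r e a.1.1 x i) a.2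

variable {q M r}

theorem AffIn.carry {ι : Type*} [Fintype ι] {z : ι → EuclideanSpace ℝ (Fin d) → ℝ} {n : ℕ}
    (g : Fin d × Fin (1 + 0 + 1) → ι) (hg : ∀ a x, z (g a) x = act (argCarry q M r n a x))
    (l : Fin d) : AffIn ((M : ℝ) ^ (2 * q + 2) * ridgeSize 1 0) z
      fun x => carry q M (n + 1) (unitPos r x) l := by
  have h := AffIn.ridge (z := z) (ρ := (M : ℝ) ^ (2 * q + 2))
    (y := fun x => Mscale.carry q M n (unitPos r x) l) 1 0 (by positivity) (fun i => g (l, i))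
    (fun i x => hg (l, i) x)
  rw [pow_one] at h
  refine h.congr fun x => ?_
  unfold Mscale.carry
  rw [Function.iterate_succ_apply']
  rfl

theorem AffIn.argCarry {ι : Type*} [Fintype ι] {z : ι → EuclideanSpace ℝ (Fin d) → ℝ} {n : ℕ}
    (hM : 1 ≤ M) (g : Fin d × Fin (1 + 0 + 1) → ι)
    (hg : ∀ a x, z (g a) x = act (argCarry q M r n a x)) (a : Fin d × Fin (1 + 0 + 1)) :
    AffIn (ridgeSize 1 0 * (1 + (M : ℝ) ^ (2 * q + 2) * ridgeSize 1 0)) z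
      (argCarry q M r (n + 1) a) := by
  have hM1 : (1 : ℝ) ≤ M := by exact_mod_cast hM
  exact (AffIn.carry g hg a.1).ridgeArg 1 0 (one_le_pow₀ hM1) a.2

theorem argCarry_bound {δ : ℝ} (hM : 1 ≤ M)
    (hδ : ridgeSize 1 0 * (1 + ridgeSize 1 0) * (M : ℝ) ^ (10 * q + 2 * d + 10) ≤ δ) :
    ridgeSize 1 0 * (1 + (M : ℝ) ^ (2 * q + 2) * ridgeSize 1 0) ≤ δ := by
  have hM1 : (1 : ℝ) ≤ M := by exact_mod_cast hM
  have h0 := ridgeSize_nonneg 1 0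
  refine le_trans ?_ hδ
  have h1 : (1 : ℝ) ≤ (M : ℝ) ^ (10 * q + 2 * d + 10) := one_le_pow₀ hM1
  have h2 : (M : ℝ) ^ (2 * q + 2) ≤ (M : ℝ) ^ (10 * q + 2 * d + 10) :=
    pow_le_pow_right₀ hM1 (by omega)
  calc _ ≤ ridgeSize 1 0 * ((M : ℝ) ^ (10 * q + 2 * d + 10)
        + (M : ℝ) ^ (10 * q + 2 * d + 10) * ridgeSize 1 0) := by gcongr
    _ = _ := by ring

theorem affIn_unitPos {P : ℝ} (hr : 0 < r) (hrP : 1 / r ≤ P) (hP : 1 ≤ P) (l : Fin d) :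
    AffIn P (fun (i : Fin d) (x : EuclideanSpace ℝ (Fin d)) => x i)
      (fun x => unitPos r x l) := by
  have h := ((AffIn.family (z := fun (i : Fin d) (x : EuclideanSpace ℝ (Fin d)) => x i)
    l).const_mul (1 / (2 * r))).add (AffIn.const (1 / 2))
  refine AffIn.mono (h.congr fun x => ?_) ?_
  · unfold unitPos; ring
  · rw [abs_of_pos (by positivity), abs_of_pos (by norm_num), mul_one]
    have : 1 / (2 * r) = 1 / r / 2 := by field_simp
    rw [this]; linarith

theorem realizes_arg₁ (d q : ℕ) : ∃ K, 0 ≤ K ∧ ∀ (M w : ℕ) (r δ : ℝ), 1 ≤ M → 0 < r →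
    1 / r ≤ (M : ℝ) ^ (2 * q + 2) → d * M + 2 * d ≤ w →
    K * (M : ℝ) ^ (10 * q + 2 * d + 10) ≤ δ →
    Realizes w 1 δ fun a x => act (arg₁ (d := d) q M r a x) := by
  refine ⟨2 + ridgeSize 1 0 * 2, by have := ridgeSize_nonneg 1 0; positivity, ?_⟩
  intro M w r δ hM hr hrM hw hδ
  have hM1 : (1 : ℝ) ≤ M := by exact_mod_cast hM
  have hR := ridgeSize_nonneg 1 0
  set P : ℝ := (M : ℝ) ^ (10 * q + 2 * d + 10) with hP
  have hP1 : 1 ≤ P := one_le_pow₀ hM1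
  have hδ0 : 0 ≤ δ := le_trans (by positivity) hδ
  have hpow : ∀ n ≤ 10 * q + 2 * d + 10, (M : ℝ) ^ n ≤ P := fun n hn =>
    pow_le_pow_right₀ hM1 hn
  refine Realizes.first hδ0 (by simp; linarith) ?_
  have hU := fun l : Fin d => affIn_unitPos hr hrM (one_le_pow₀ hM1) l
  rintro (⟨l, i⟩ | ⟨l, i⟩)
  · have h := (((hU l).const_mul (M : ℝ)).sub (AffIn.const ((i : ℕ) : ℝ))).const_mul ((M : ℝ) ^ 2)
    refine AffIn.mono h ?_
    rw [abs_of_nonneg (by positivity), Nat.abs_cast, Nat.abs_cast]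
    have hi : ((i : ℕ) : ℝ) ≤ M := by exact_mod_cast i.2.le
    calc (M : ℝ) ^ 2 * (M * (M : ℝ) ^ (2 * q + 2) + (i : ℕ))
        ≤ (M : ℝ) ^ 2 * (M * (M : ℝ) ^ (2 * q + 2) + M) := by gcongr
      _ = (M : ℝ) ^ (2 * q + 5) + (M : ℝ) ^ 3 := by ring
      _ ≤ P + P := add_le_add (hpow _ (by omega)) (hpow _ (by omega))
      _ ≤ (2 + ridgeSize 1 0 * 2) * P := by nlinarith
      _ ≤ δ := hδ
  · refine ((hU l).ridgeArg 1 0 (one_le_pow₀ hM1 (n := 2 * q + 2)) i).mono ?_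
    have := hpow (2 * q + 2) (by omega)
    calc ridgeSize 1 0 * (1 + (M : ℝ) ^ (2 * q + 2)) ≤ ridgeSize 1 0 * (P + P) := by gcongr
      _ ≤ (2 + ridgeSize 1 0 * 2) * P := by nlinarith
      _ ≤ δ := hδ

theorem realizes_arg₂ (d q : ℕ) : ∃ K, 0 ≤ K ∧ ∀ (M w : ℕ) (r δ : ℝ), 1 ≤ M →
    10 * d ≤ w → K * (M : ℝ) ^ (10 * q + 2 * d + 10) ≤ δ →
    Realizes w 1 δ (fun a x => act (arg₁ (d := d) q M r a x)) →
    Realizes w 2 δ fun a x => act (arg₂ (d := d) q M r a x) := by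
  have hR := ridgeSize_nonneg 1 0
  have hR2 := ridgeSize_nonneg 2 0
  refine ⟨ridgeSize 1 0 * (3 + ridgeSize 1 0) + ridgeSize 2 0 * (3 + ridgeSize 1 0)
    + ridgeSize 1 0 * (1 + ridgeSize 1 0), by positivity, ?_⟩
  intro M w r δ hM hw hδ hz
  have hM1 : (1 : ℝ) ≤ M := by exact_mod_cast hM
  set P : ℝ := (M : ℝ) ^ (10 * q + 2 * d + 10) with hP
  have hP1 : 1 ≤ P := one_le_pow₀ hM1
  have hpow : ∀ n ≤ 10 * q + 2 * d + 10, (M : ℝ) ^ n ≤ P := fun n hn =>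
    pow_le_pow_right₀ hM1 hn
  rw [add_mul, add_mul] at hδ
  have b1 : 0 ≤ ridgeSize 1 0 * (3 + ridgeSize 1 0) * P := by positivity
  have b2 : 0 ≤ ridgeSize 2 0 * (3 + ridgeSize 1 0) * P := by positivity
  have b3 : 0 ≤ ridgeSize 1 0 * (1 + ridgeSize 1 0) * P := by positivity
  have hcarry := fun l : Fin d => AffIn.carry (q := q) (M := M) (r := r) (n := 0)
    (z := fun a x => act (arg₁ (d := d) q M r a x)) Sum.inr (fun _ _ => rfl) l
  have hslope : ∀ l : Fin d, AffIn 2 (fun a x => act (arg₁ (d := d) q M r a x))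
      fun x => foldSlope M (unitPos r x l) := fun l =>
    AffIn.sum_family (fun i : Fin M => Sum.inl (l, i)) (fun i j h => by simpa using h)
      (fun i => foldCoef i) (by norm_num) fun i => abs_foldCoef_le _
  have hoff : ∀ l : Fin d, AffIn (2 * (M : ℝ)) (fun a x => act (arg₁ (d := d) q M r a x))
      fun x => foldOffset M (unitPos r x l) := fun l =>
    AffIn.sum_family (fun i : Fin M => Sum.inl (l, i)) (fun i j h => by simpa using h)
      (fun i => foldCoef i * (i : ℕ)) (by positivity) fun i => by
        rw [abs_mul, Nat.abs_cast]
        have hi : ((i : ℕ) : ℝ) ≤ M := by exact_mod_cast i.2.le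
        have := abs_foldCoef_le i
        gcongr
  have hM5 : (1 : ℝ) ≤ (M : ℝ) ^ 5 := one_le_pow₀ hM1
  have p1 := hpow (2 * q + 3) (by omega)
  have p2 : (M : ℝ) ≤ P := by simpa using hpow 1 (by omega)
  have p3 := hpow (2 * q + 2) (by omega)
  have c2 : ridgeSize 2 0 * (1 + ((M : ℝ) ^ (2 * q + 2) * ridgeSize 1 0 + 2)) ≤ δ := by
    calc _ ≤ ridgeSize 2 0 * (P + (P * ridgeSize 1 0 + 2 * P)) := by gcongr; linarith
      _ = ridgeSize 2 0 * (3 + ridgeSize 1 0) * P := by ring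
      _ ≤ δ := by linarith
  refine hz.next (le_trans (by linarith) hδ) (by simp; linarith) ?_
  rintro ((⟨l, i⟩ | (⟨l, i⟩ | ⟨l, i⟩)) | a)
  · refine ((((hcarry l).const_mul (M : ℝ)).sub (hoff l)).ridgeArg 1 0 hM5 i).mono ?_
    rw [Nat.abs_cast]
    calc ridgeSize 1 0 * (1 + (M * ((M : ℝ) ^ (2 * q + 2) * ridgeSize 1 0) + 2 * M))
        = ridgeSize 1 0 * (1 + ((M : ℝ) ^ (2 * q + 3) * ridgeSize 1 0 + 2 * M)) := by ring
      _ ≤ ridgeSize 1 0 * (P + (P * ridgeSize 1 0 + 2 * P)) := by gcongr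
      _ = ridgeSize 1 0 * (3 + ridgeSize 1 0) * P := by ring
      _ ≤ δ := by linarith
  · exact (((hcarry l).add (hslope l)).ridgeArg 2 0 hM5 i).mono c2
  · exact (((hcarry l).sub (hslope l)).ridgeArg 2 0 hM5 i).mono c2
  · exact (AffIn.argCarry hM Sum.inr (fun _ _ => rfl) a).mono (argCarry_bound hM (by linarith))

theorem realizes_arg₃ (d q : ℕ) (hq : 1 ≤ q) : ∃ K, 0 ≤ K ∧ ∀ (M w : ℕ) (r δ : ℝ), 1 ≤ M →
    2 * (d * M) + 2 * d ≤ w → K * (M : ℝ) ^ (10 * q + 2 * d + 10) ≤ δ →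
    Realizes w 2 δ (fun a x => act (arg₂ (d := d) q M r a x)) →
    Realizes w 3 δ fun a x => act (arg₃ (d := d) q M r a x) := by
  have hR := ridgeSize_nonneg 1 0
  have hR2 := ridgeSize_nonneg 2 0
  refine ⟨(ridgeSize 1 0 + 1) + (ridgeSize 1 0 + ridgeSize 2 0 + 1)
    + ridgeSize 1 0 * (1 + ridgeSize 1 0), by positivity, ?_⟩
  intro M w r δ hM hw hδ hz
  have hM1 : (1 : ℝ) ≤ M := by exact_mod_cast hM
  set P : ℝ := (M : ℝ) ^ (10 * q + 2 * d + 10) with hP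
  have hP1 : 1 ≤ P := one_le_pow₀ hM1
  have hpow : ∀ n ≤ 10 * q + 2 * d + 10, (M : ℝ) ^ n ≤ P := fun n hn =>
    pow_le_pow_right₀ hM1 hn
  rw [add_mul, add_mul] at hδ
  have b1 : 0 ≤ (ridgeSize 1 0 + 1) * P := by positivity
  have b2 : 0 ≤ (ridgeSize 1 0 + ridgeSize 2 0 + 1) * P := by positivity
  have b3 : 0 ≤ ridgeSize 1 0 * (1 + ridgeSize 1 0) * P := by positivity
  have hcarry := fun l : Fin d => AffIn.carry (q := q) (M := M) (r := r) (n := 1)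
    (z := fun a x => act (arg₂ (d := d) q M r a x)) Sum.inr (fun _ _ => rfl) l
  have hfold : ∀ l : Fin d, AffIn
      (((M : ℝ) ^ 5) ^ 1 * ridgeSize 1 0 + |(M : ℝ)| * (((M : ℝ) ^ 5) ^ 2 * ridgeSize 2 0))
      (fun a x => act (arg₂ (d := d) q M r a x))
      fun x => foldNet M (unitPos r x l) (carry q M 1 (unitPos r x) l) := fun l =>
    (AffIn.ridge (y := fun x =>
        M * carry q M 1 (unitPos r x) l - foldOffset M (unitPos r x l)) 1 0 (by positivity)
        (fun i => Sum.inl (Sum.inl (l, i))) fun _ _ => rfl).add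
      ((AffIn.mulNet (x := fun x => carry q M 1 (unitPos r x) l)
        (y := fun x => foldSlope M (unitPos r x l)) (by positivity)
        (fun i => Sum.inl (Sum.inr (Sum.inl (l, i))))
        (fun i => Sum.inl (Sum.inr (Sum.inr (l, i)))) (fun _ _ => rfl) fun _ _ => rfl).const_mul
        (M : ℝ))
  have p3 := hpow 3 (by omega)
  refine hz.next (le_trans (by linarith) hδ) (by simp; linarith) ?_
  rintro ((⟨l, i⟩ | ⟨l, i⟩) | a)
  · refine ((((hcarry l).const_mul (M : ℝ)).sub (AffIn.const ((i : ℕ) : ℝ))).const_mul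
      ((M : ℝ) ^ 2)).mono ?_
    rw [abs_of_nonneg (by positivity), Nat.abs_cast, Nat.abs_cast]
    have hi : ((i : ℕ) : ℝ) ≤ M := by exact_mod_cast i.2.le
    have p := hpow (2 * q + 5) (by omega)
    calc (M : ℝ) ^ 2 * (M * ((M : ℝ) ^ (2 * q + 2) * ridgeSize 1 0) + (i : ℕ))
        ≤ (M : ℝ) ^ 2 * (M * ((M : ℝ) ^ (2 * q + 2) * ridgeSize 1 0) + M) := by gcongr
      _ = (M : ℝ) ^ (2 * q + 5) * ridgeSize 1 0 + (M : ℝ) ^ 3 := by ring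
      _ ≤ P * ridgeSize 1 0 + P := by gcongr
      _ = (ridgeSize 1 0 + 1) * P := by ring
      _ ≤ δ := by linarith
  · refine ((((hfold l).const_mul (M : ℝ)).sub (AffIn.const ((i : ℕ) : ℝ))).const_mul
      ((M : ℝ) ^ 2)).mono ?_
    rw [abs_of_nonneg (by positivity), Nat.abs_cast, Nat.abs_cast]
    have hi : ((i : ℕ) : ℝ) ≤ M := by exact_mod_cast i.2.le
    have p := hpow 8 (by omega)
    have p' := hpow 14 (by omega)
    calc (M : ℝ) ^ 2 * (M * (((M : ℝ) ^ 5) ^ 1 * ridgeSize 1 0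
          + M * (((M : ℝ) ^ 5) ^ 2 * ridgeSize 2 0)) + (i : ℕ))
        ≤ (M : ℝ) ^ 2 * (M * (((M : ℝ) ^ 5) ^ 1 * ridgeSize 1 0
          + M * (((M : ℝ) ^ 5) ^ 2 * ridgeSize 2 0)) + M) := by gcongr
      _ = (M : ℝ) ^ 8 * ridgeSize 1 0 + (M : ℝ) ^ 14 * ridgeSize 2 0 + (M : ℝ) ^ 3 := by ring
      _ ≤ P * ridgeSize 1 0 + P * ridgeSize 2 0 + P := by gcongr
      _ = (ridgeSize 1 0 + ridgeSize 2 0 + 1) * P := by ring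
      _ ≤ δ := by linarith
  · exact (AffIn.argCarry hM Sum.inr (fun _ _ => rfl) a).mono (argCarry_bound hM (by linarith))

theorem affIn_orthant_arg {X ι : Type*} [Fintype ι] {z : ι → X → ℝ} {d M : ℕ}
    (v : X → Fin d → ℝ) (g : Fin d × Fin M → ι)
    (hg : ∀ a x, z (g a) x = act ((M : ℝ) ^ 2 * (v x a.1 - (a.2 : ℕ)))) (k : Fin d → Fin M) :
    AffIn (M * (2 * d + 1)) z
      fun x => M * (∑ l, step M (v x l) (k l) - d + 1 / 2) := by
  have hstep : ∀ l, AffIn 1 z fun x => step M (v x l) (k l) := by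
    intro l
    by_cases h : (k l : ℕ) = 0
    · have := AffIn.const (z := z) 1
      rw [abs_one] at this
      exact this.congr fun x => by simp [step, h]
    · exact (AffIn.family (z := z) (g (l, k l))).congr fun x => by rw [hg]; simp [step, h]
  have h := ((AffIn.sum Finset.univ fun l _ => hstep l).add
    (AffIn.const (-(d : ℝ) + 1 / 2))).const_mul (M : ℝ)
  refine AffIn.mono (h.congr fun x => by ring) ?_
  rw [Nat.abs_cast]
  have h1 : |-(d : ℝ) + 1 / 2| ≤ d + 1 := by
    have : (0 : ℝ) ≤ d := Nat.cast_nonneg d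
    exact abs_le.2 ⟨by linarith, by linarith⟩
  refine mul_le_mul_of_nonneg_left ?_ (Nat.cast_nonneg _)
  simp only [Finset.sum_const, Finset.card_univ, Fintype.card_fin, nsmul_eq_mul, mul_one]
  linarith

theorem realizes_arg₄ (d q : ℕ) : ∃ K, 0 ≤ K ∧ ∀ (M w : ℕ) (r δ : ℝ), 1 ≤ M →
    2 * M ^ d + 2 * d ≤ w → K * (M : ℝ) ^ (10 * q + 2 * d + 10) ≤ δ →
    Realizes w 3 δ (fun a x => act (arg₃ (d := d) q M r a x)) →
    Realizes w 4 δ fun a x => act (arg₄ (d := d) q M r a x) := by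
  have hR := ridgeSize_nonneg 1 0
  refine ⟨(2 * d + 1) + ridgeSize 1 0 * (1 + ridgeSize 1 0), by positivity, ?_⟩
  intro M w r δ hM hw hδ hz
  have hM1 : (1 : ℝ) ≤ M := by exact_mod_cast hM
  set P : ℝ := (M : ℝ) ^ (10 * q + 2 * d + 10) with hP
  have hP1 : 1 ≤ P := one_le_pow₀ hM1
  have p2 : (M : ℝ) ≤ P := le_self_pow₀ hM1 (by omega)
  rw [add_mul] at hδ
  have b1 : 0 ≤ (2 * d + 1) * P := by positivity
  have b3 : 0 ≤ ridgeSize 1 0 * (1 + ridgeSize 1 0) * P := by positivity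
  have c : (M : ℝ) * (2 * d + 1) ≤ δ := by
    calc (M : ℝ) * (2 * d + 1) ≤ P * (2 * d + 1) := by gcongr
      _ ≤ δ := by linarith
  refine hz.next (le_trans (by linarith) hδ) (by simp; linarith) ?_
  rintro ((k | k) | a)
  · exact (affIn_orthant_arg (fun x => coarsePos q M (unitPos r x))
      (fun a => Sum.inl (Sum.inl a)) (fun _ _ => rfl) k).mono c
  · exact (affIn_orthant_arg (fun x => finePos q M (unitPos r x))
      (fun a => Sum.inl (Sum.inr a)) (fun _ _ => rfl) k).mono c
  · exact (AffIn.argCarry hM Sum.inr (fun _ _ => rfl) a).mono (argCarry_bound hM (by linarith))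

theorem affIn_cellWeight {X ι : Type*} [Fintype ι] {z : ι → X → ℝ} {d M : ℕ}
    (v : X → Fin d → ℝ) (g : (Fin d → Fin M) → ι)
    (hg : ∀ k x, z (g k) x = orthant M (v x) k) (i : Fin d → Fin M) :
    AffIn (2 ^ d) z fun x => cellWeight M (v x) i := by
  have h := AffIn.sum Finset.univ fun k _ =>
    (AffIn.family (z := z) (g k)).const_mul (∏ l, diffCoef (i l) (k l))
  refine AffIn.mono (h.congr fun x => ?_) ?_
  · unfold cellWeight
    exact Finset.sum_congr rfl fun k _ => by rw [hg, mul_comm]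
  · simp only [mul_one]
    exact sum_prod_abs_diffCoef_le i

theorem realizes_arg₅ (d q : ℕ) : ∃ K, 0 ≤ K ∧ ∀ (M w : ℕ) (r δ : ℝ)
    (e : (Fin d → Fin M) → (Fin d → Fin M) → Sym (Fin (d + 1)) q → ℝ), 1 ≤ M →
    (∀ i j s, |e i j s| ≤ 1) →
    6 * ((d + q).choose d * M ^ d) + 2 * d ≤ w → K * (M : ℝ) ^ (10 * q + 2 * d + 10) ≤ δ →
    Realizes w 4 δ (fun a x => act (arg₄ (d := d) q M r a x)) →
    Realizes w 5 δ fun a x => act (arg₅ (d := d) q M r e a x) := by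
  have hR := ridgeSize_nonneg 1 0
  have hR2 := ridgeSize_nonneg 2 0
  refine ⟨ridgeSize 2 0 * (1 + (2 ^ d + 2 ^ d)) + ridgeSize 1 0 * (1 + ridgeSize 1 0),
    by positivity, ?_⟩
  intro M w r δ e hM he hw hδ hz
  have hM1 : (1 : ℝ) ≤ M := by exact_mod_cast hM
  set P : ℝ := (M : ℝ) ^ (10 * q + 2 * d + 10) with hP
  have hP1 : 1 ≤ P := one_le_pow₀ hM1
  have p2 : (M : ℝ) ^ d ≤ P := pow_le_pow_right₀ hM1 (by omega)
  rw [add_mul] at hδ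
  have b1 : 0 ≤ ridgeSize 2 0 * (1 + (2 ^ d + 2 ^ d)) * P := by positivity
  have b3 : 0 ≤ ridgeSize 1 0 * (1 + ridgeSize 1 0) * P := by positivity
  have hB := fun j => affIn_cellWeight (z := fun a x => act (arg₄ (d := d) q M r a x))
    (fun x => finePos q M (unitPos r x)) (fun k => Sum.inl (Sum.inr k)) (fun _ _ => rfl) j
  have hA := fun i => affIn_cellWeight (z := fun a x => act (arg₄ (d := d) q M r a x))
    (fun x => coarsePos q M (unitPos r x)) (fun k => Sum.inl (Sum.inl k)) (fun _ _ => rfl) i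
  have hV : ∀ j s, AffIn ((M : ℝ) ^ d * 2 ^ d) (fun a x => act (arg₄ (d := d) q M r a x))
      fun x => selected q M e (unitPos r x) j s := by
    intro j s
    have h := AffIn.sum Finset.univ fun i _ => (hA i).const_mul (e i j s)
    refine AffIn.mono (h.congr fun x => ?_) ?_
    · unfold selected
      exact Finset.sum_congr rfl fun i _ => mul_comm _ _
    · calc _ ≤ ∑ _i : Fin d → Fin M, (1 : ℝ) * 2 ^ d :=
            Finset.sum_le_sum fun i _ => by gcongr; exact he i j s
        _ = (M : ℝ) ^ d * 2 ^ d := by simp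
  have c : ridgeSize 2 0 * (1 + (2 ^ d + (M : ℝ) ^ d * 2 ^ d)) ≤ δ := by
    calc ridgeSize 2 0 * (1 + (2 ^ d + (M : ℝ) ^ d * 2 ^ d))
        ≤ ridgeSize 2 0 * (P + (2 ^ d * P + P * 2 ^ d)) := by
          gcongr
          exact le_mul_of_one_le_right (by positivity) hP1
      _ = ridgeSize 2 0 * (1 + (2 ^ d + 2 ^ d)) * P := by ring
      _ ≤ δ := by linarith
  have hscale : (1 : ℝ) ≤ (M : ℝ) ^ (2 * q + 2 + d) := one_le_pow₀ hM1
  refine hz.next (le_trans (by linarith) hδ) ?_ ?_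
  · simp only [Fintype.card_sum, Fintype.card_prod, Fintype.card_fin, Fintype.card_pi,
      Finset.prod_const, Finset.card_univ, card_sym_eq]
    linarith
  rintro ((⟨⟨j, s⟩, i⟩ | ⟨⟨j, s⟩, i⟩) | a)
  · exact (((hB j).add (hV j s)).ridgeArg 2 0 hscale i).mono c
  · exact (((hB j).sub (hV j s)).ridgeArg 2 0 hscale i).mono c
  · exact (AffIn.argCarry hM Sum.inr (fun _ _ => rfl) a).mono (argCarry_bound hM (by linarith))

theorem realizes_arg₆ (d q : ℕ) : ∃ K, 0 ≤ K ∧ ∀ (M w : ℕ) (r δ : ℝ)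
    (e : (Fin d → Fin M) → (Fin d → Fin M) → Sym (Fin (d + 1)) q → ℝ), 1 ≤ M →
    (d + q).choose d * 2 ^ (q + 1) * (3 * q + 3) ≤ w →
    K * (M : ℝ) ^ (10 * q + 2 * d + 10) ≤ δ →
    Realizes w 5 δ (fun a x => act (arg₅ (d := d) q M r e a x)) →
    Realizes w 6 δ fun a x => act (arg₆ (d := d) q M r e a x) := by
  have hR := ridgeSize_nonneg 1 0
  have hR2 := ridgeSize_nonneg 2 0
  have hR3 := ridgeSize_nonneg (q + 1) (2 * q + 1)
  refine ⟨ridgeSize (q + 1) (2 * q + 1) * (1 + (q + 1) * (ridgeSize 2 0 + ridgeSize 1 0 + 1)),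
    by positivity, ?_⟩
  intro M w r δ e hM hw hδ hz
  have hM1 : (1 : ℝ) ≤ M := by exact_mod_cast hM
  set P : ℝ := (M : ℝ) ^ (10 * q + 2 * d + 10) with hP
  have hP1 : 1 ≤ P := one_le_pow₀ hM1
  have hpow : ∀ n ≤ 10 * q + 2 * d + 10, (M : ℝ) ^ n ≤ P := fun n hn =>
    pow_le_pow_right₀ hM1 hn
  have hcarry := fun l : Fin d => AffIn.carry (q := q) (M := M) (r := r) (n := 4)
    (z := fun a x => act (arg₅ (d := d) q M r e a x)) Sum.inr (fun _ _ => rfl) l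
  have hcoef : ∀ s, AffIn (P * ridgeSize 2 0) (fun a x => act (arg₅ (d := d) q M r e a x))
      fun x => coefNet q M e (unitPos r x) s := by
    intro s
    set ρ : ℝ := (M : ℝ) ^ (2 * q + 2 + d) with hρ
    have hρP : ρ ^ 2 ≤ P := by rw [hρ, ← pow_mul]; exact hpow _ (by omega)
    have hw : ∀ a : (Fin d → Fin M) × Fin (2 + 0 + 1),
        |ρ ^ 2 / 4 * ridgeWeight 2 0 a.2| ≤ P / 4 * ridgeSize 2 0 := by
      intro a
      rw [abs_mul, abs_of_nonneg (by positivity : 0 ≤ ρ ^ 2 / 4)]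
      have h1 : |ridgeWeight 2 0 a.2| ≤ ridgeSize 2 0 := by
        have := Finset.single_le_sum (f := fun i => |ridgeWeight 2 0 i|)
          (fun _ _ => abs_nonneg _) (Finset.mem_univ a.2)
        unfold ridgeSize
        have h3 := abs_nonneg (ridgePoint 2 0)
        push_cast
        linarith
      gcongr
    have h1 := AffIn.sum_family (z := fun a x => act (arg₅ (d := d) q M r e a x))
      (fun a : (Fin d → Fin M) × Fin (2 + 0 + 1) => Sum.inl (Sum.inl ((a.1, s), a.2)))
      (fun a b h => by simpa [Prod.ext_iff] using h) _ (by positivity) hw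
    have h2 := AffIn.sum_family (z := fun a x => act (arg₅ (d := d) q M r e a x))
      (fun a : (Fin d → Fin M) × Fin (2 + 0 + 1) => Sum.inl (Sum.inr ((a.1, s), a.2)))
      (fun a b h => by simpa [Prod.ext_iff] using h) _ (by positivity) hw
    refine AffIn.mono ((h1.sub h2).congr fun x => ?_) ?_
    · rw [Fintype.sum_prod_type, Fintype.sum_prod_type, ← Finset.sum_sub_distrib]
      unfold coefNet mulNet ridge
      refine Finset.sum_congr rfl fun j _ => ?_
      rw [← mul_sub, mul_div_right_comm, mul_sub, Finset.mul_sum, Finset.mul_sum]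
      simp only [mul_assoc]
      rfl
    · nlinarith [mul_nonneg hR2 (by linarith : 0 ≤ P)]
  have hfac : ∀ s i, AffIn ((ridgeSize 2 0 + ridgeSize 1 0 + 1) * P)
      (fun a x => act (arg₅ (d := d) q M r e a x)) fun x => polyFactor q M r e s x i := by
    intro s i
    refine Fin.cases ?_ (fun i => ?_) i
    · refine (hcoef s).mono ?_
      nlinarith [mul_nonneg hR (by linarith : 0 ≤ P)]
    · simp only [polyFactor, Fin.cons_succ]
      refine Fin.cases ?_ (fun l => ?_) (symEnum s i)
      · simp only [homog, Fin.cons_zero]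
        refine (AffIn.const 1).mono ?_
        rw [abs_one]
        nlinarith [mul_nonneg hR (by linarith : 0 ≤ P), mul_nonneg hR2 (by linarith : 0 ≤ P)]
      · simp only [homog, Fin.cons_succ]
        refine (hcarry l).mono ?_
        have := mul_le_mul_of_nonneg_right (hpow (2 * q + 2) (by omega)) hR
        nlinarith [mul_nonneg hR2 (by linarith : 0 ≤ P)]
  refine hz.next (le_trans (by positivity) hδ) ?_ ?_
  · simp only [Fintype.card_prod, Fintype.card_fin, Fintype.card_finset, card_sym_eq]
    refine le_trans (le_of_eq ?_) hw
    ring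
  rintro ⟨⟨s, T⟩, i⟩
  refine ((AffIn.sum T fun j _ => hfac s j).ridgeArg (q + 1) (2 * q + 1) hM1 i).mono
    (le_trans ?_ hδ)
  have hT : (T.card : ℝ) ≤ q + 1 := by
    have : T.card ≤ q + 1 := (Finset.card_le_univ T).trans (by simp)
    exact_mod_cast this
  rw [Finset.sum_const, nsmul_eq_mul]
  calc _ ≤ ridgeSize (q + 1) (2 * q + 1) * (P + (q + 1) *
        ((ridgeSize 2 0 + ridgeSize 1 0 + 1) * P)) := by gcongr
    _ = _ := by ring

theorem affIn_polyNet (d q : ℕ) : ∃ K, 0 ≤ K ∧ ∀ (M : ℕ) (r : ℝ)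
    (e : (Fin d → Fin M) → (Fin d → Fin M) → Sym (Fin (d + 1)) q → ℝ), 1 ≤ M →
    AffIn (K * (M : ℝ) ^ (10 * q + 2 * d + 10)) (fun a x => act (arg₆ (d := d) q M r e a x))
      fun x => polyNet q M e (unitPos r x) := by
  refine ⟨∑ _s : Sym (Fin (d + 1)) q, ∑ T, |polarCoef (q + 1) T| *
    ridgeSize (q + 1) (2 * q + 1), Finset.sum_nonneg fun _ _ => Finset.sum_nonneg fun _ _ =>
      mul_nonneg (abs_nonneg _) (ridgeSize_nonneg _ _), ?_⟩
  intro M r e hM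
  have hM1 : (1 : ℝ) ≤ M := by exact_mod_cast hM
  have h := AffIn.sum Finset.univ fun (s : Sym (Fin (d + 1)) q) _ =>
    AffIn.sum Finset.univ fun (T : Finset (Fin (q + 1))) _ =>
      (AffIn.ridge (z := fun a x => act (arg₆ (d := d) q M r e a x)) (ρ := M)
        (y := fun x => ∑ i ∈ T, polyFactor q M r e s x i) (q + 1) (2 * q + 1) (by positivity)
        (fun i => ((s, T), i)) (fun _ _ => rfl)).const_mul (polarCoef (q + 1) T)
  refine AffIn.mono (h.congr fun x => rfl) ?_
  rw [Finset.sum_mul]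
  refine Finset.sum_le_sum fun s _ => ?_
  rw [Finset.sum_mul]
  refine Finset.sum_le_sum fun T _ => ?_
  rw [mul_assoc, mul_comm ((M : ℝ) ^ (q + 1))]
  have := pow_le_pow_right₀ hM1 (by omega : q + 1 ≤ 10 * q + 2 * d + 10)
  have := ridgeSize_nonneg (q + 1) (2 * q + 1)
  gcongr

end Layers

/-! ### The full network and the local Taylor expansions -/

theorem HiddenLayers.BoundedBy.mono {D w n : ℕ} {N : HiddenLayers D w n} {δ δ' : ℝ}
    (h : N.BoundedBy δ) (hδ : δ ≤ δ') : N.BoundedBy δ' := by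
  induction N with
  | first A b => exact ⟨fun r c => (h.1 r c).trans hδ, fun r => (h.2 r).trans hδ⟩
  | next prev A b ih =>
    exact ⟨ih h.1, fun r c => (h.2.1 r c).trans hδ, fun r => (h.2.2 r).trans hδ⟩

theorem netClass_mono {D L w : ℕ} {δ δ' : ℝ} (hδ : δ ≤ δ') :
    netClass D L w δ ⊆ netClass D L w δ' := by
  rintro f ⟨N, a, b, hN, ha, hb, hf⟩
  exact ⟨N, a, b, hN.mono hδ, fun r => (ha r).trans hδ, hb.trans hδ, hf⟩

/-- Room for all layers, from the factor `2 ^ d * (2 + 2 * d) ≥ 8` in front of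
`(d + q).choose d * M ^ d`. -/
theorem le_width (d q M : ℕ) (hd : 1 ≤ d) : 8 * ((d + q).choose d * M ^ d) ≤ width d q M := by
  have h2 : 2 ≤ 2 ^ d := by
    calc 2 = 2 ^ 1 := rfl
      _ ≤ 2 ^ d := Nat.pow_le_pow_right (by norm_num) hd
  have h4 : 4 ≤ 2 + 2 * d := by omega
  calc 8 * ((d + q).choose d * M ^ d) = 2 * ((d + q).choose d * M ^ d * 4) := by ring
    _ ≤ 2 ^ d * (((d + q).choose d + d) * M ^ d * (2 + 2 * d)) := by
        gcongr
        exact Nat.le_add_right _ _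
    _ ≤ width d q M := by
        unfold width
        refine Nat.mul_le_mul_left _ ?_
        refine le_trans ?_ (Nat.le_add_right _ _)
        refine le_trans ?_ (Nat.le_add_right _ _)
        refine le_trans ?_ (le_max_left _ _)
        exact Nat.le_add_right _ _

/-- Number of approximate identity layers that fill up the prescribed depth. -/
def padding (d q : ℕ) : ℕ := 2 + Nat.clog 2 (max d (q + 1))

/-- The network function, in the coordinates of the cube `[-r, r]^d`. -/
def fullNet {d : ℕ} (q M : ℕ) (r : ℝ)
    (e : (Fin d → Fin M) → (Fin d → Fin M) → Sym (Fin (d + 1)) q → ℝ)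
    (x : EuclideanSpace ℝ (Fin d)) : ℝ :=
  (idNet ((M : ℝ) ^ (2 * q + 2)))^[padding d q] (polyNet q M e (unitPos r x))

theorem exists_fullNet_mem_netClass (d q : ℕ) (hd : 1 ≤ d) (hq : 1 ≤ q) :
    ∃ K, 0 ≤ K ∧ ∃ M₀ : ℕ, 2 ≤ M₀ ∧ ∀ M ≥ M₀, ∀ (r : ℝ)
      (e : (Fin d → Fin M) → (Fin d → Fin M) → Sym (Fin (d + 1)) q → ℝ),
      0 < r → 1 / r ≤ (M : ℝ) ^ (2 * q + 2) → (∀ i j s, |e i j s| ≤ 1) →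
      fullNet q M r e ∈ netClass d (depth d q) (width d q M)
        (K * (M : ℝ) ^ (10 * q + 2 * d + 10)) := by
  obtain ⟨K₁, hK₁, h₁⟩ := realizes_arg₁ d q
  obtain ⟨K₂, hK₂, h₂⟩ := realizes_arg₂ d q
  obtain ⟨K₃, hK₃, h₃⟩ := realizes_arg₃ d q hq
  obtain ⟨K₄, hK₄, h₄⟩ := realizes_arg₄ d q
  obtain ⟨K₅, hK₅, h₅⟩ := realizes_arg₅ d q
  obtain ⟨K₆, hK₆, h₆⟩ := realizes_arg₆ d q
  obtain ⟨K₇, hK₇, h₇⟩ := affIn_polyNet d q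
  have hR := ridgeSize_nonneg 1 0
  set K₈ : ℝ := ridgeSize 1 0 * (1 + K₇) with hK₈
  set K₉ : ℝ := ridgeSize 1 0 * (1 + ridgeSize 1 0) with hK₉
  have hK₈0 : 0 ≤ K₈ := by positivity
  have hK₉0 : 0 ≤ K₉ := by positivity
  set Nq : ℕ := (d + q).choose d with hNq
  have hNqd : d + 1 ≤ Nq := by
    rw [hNq]
    calc d + 1 = (d + 1).choose d := by rw [Nat.choose_succ_self_right]
      _ ≤ (d + q).choose d := Nat.choose_le_choose d (by omega)
  refine ⟨K₁ + K₂ + K₃ + K₄ + K₅ + K₆ + K₈ + K₉ + ridgeSize 1 0, by positivity,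
    2 + 10 * d + Nq * 2 ^ (q + 1) * (3 * q + 3), by omega, ?_⟩
  intro M hM r e hr hrM he
  have hM1 : 1 ≤ M := by omega
  have hM1' : (1 : ℝ) ≤ M := by exact_mod_cast hM1
  set P : ℝ := (M : ℝ) ^ (10 * q + 2 * d + 10) with hP
  have hP1 : 1 ≤ P := one_le_pow₀ hM1'
  have hP0 : 0 ≤ P := by linarith
  have hw := le_width d q M hd
  rw [← hNq] at hw
  set X : ℕ := M ^ d with hX
  have hMX : M ≤ X := Nat.le_self_pow (by omega) M
  have e1 : d * M ≤ Nq * X := Nat.mul_le_mul (by omega) hMX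
  have e2 : X ≤ Nq * X := Nat.le_mul_of_pos_left _ (by omega)
  set δ : ℝ := (K₁ + K₂ + K₃ + K₄ + K₅ + K₆ + K₈ + K₉ + ridgeSize 1 0) * P with hδ
  have hle : ∀ K' : ℝ, K' ≤ K₁ + K₂ + K₃ + K₄ + K₅ + K₆ + K₈ + K₉ + ridgeSize 1 0 →
      K' * P ≤ δ := fun K' h => mul_le_mul_of_nonneg_right h hP0
  have z₁ := h₁ M (width d q M) r δ hM1 hr hrM (by omega) (hle _ (by linarith))
  have z₂ := h₂ M (width d q M) r δ hM1 (by omega) (hle _ (by linarith)) z₁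
  have z₃ := h₃ M (width d q M) r δ hM1 (by omega) (hle _ (by linarith)) z₂
  have z₄ := h₄ M (width d q M) r δ hM1 (by omega) (hle _ (by linarith)) z₃
  have z₅ := h₅ M (width d q M) r δ e hM1 he (by rw [← hX]; omega) (hle _ (by linarith)) z₄
  have z₆ := h₆ M (width d q M) r δ e hM1 (by omega) (hle _ (by linarith)) z₅
  have hpow : (M : ℝ) ^ (2 * q + 2) ≤ P := pow_le_pow_right₀ hM1' (by omega)
  have h := z₆.pad (h₇ M r e hM1) (ρ := (M : ℝ) ^ (2 * q + 2)) (by omega) (one_le_pow₀ hM1')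
    (by
      calc ridgeSize 1 0 * (1 + K₇ * P) ≤ ridgeSize 1 0 * (P + K₇ * P) := by gcongr
        _ = K₈ * P := by rw [hK₈]; ring
        _ ≤ δ := hle _ (by linarith))
    (argCarry_bound hM1 (hle _ (by linarith)))
    (by
      calc (M : ℝ) ^ (2 * q + 2) * ridgeSize 1 0 ≤ P * ridgeSize 1 0 := by gcongr
        _ = ridgeSize 1 0 * P := mul_comm _ _
        _ ≤ δ := hle _ (by linarith)) (1 + Nat.clog 2 (max d (q + 1)))
  have hdep : depth d q = 6 + 1 + (1 + Nat.clog 2 (max d (q + 1))) := by unfold depth; omega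
  rw [hdep]
  convert h using 4 with x
  unfold fullNet padding
  rw [show 2 + Nat.clog 2 (max d (q + 1)) = 1 + Nat.clog 2 (max d (q + 1)) + 1 by omega]

/-- Uniform approximation on the unit cube, for tables of local polynomials. -/
theorem exists_fullNet_bound (d q : ℕ) (hq : 1 ≤ q) (p : ℝ) (hp : 0 < p) (hpq : p ≤ q + 1) :
    ∃ C, 0 ≤ C ∧ ∃ M₀ : ℕ, 2 ≤ M₀ ∧ ∀ M ≥ M₀, ∀ (F : (Fin d → ℝ) → ℝ) e,
      IsLocalApprox q M p F e → ∀ (r : ℝ) (x : EuclideanSpace ℝ (Fin d)),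
      (∀ l, 0 ≤ unitPos r x l ∧ unitPos r x l ≤ 1) →
      |fullNet q M r e x - F (unitPos r x)| ≤ C / (M : ℝ) ^ (2 * p) := by
  obtain ⟨C, hC0, M₀, hM₀, hC⟩ := exists_polyNet_bound d q hq p hp hpq
  set A : ℝ := C + (1 + (Fintype.card (Sym (Fin (d + 1)) q) : ℕ)) with hA
  obtain ⟨C', hC'0, hC'⟩ := exists_abs_idNet_iterate_sub_le (padding d q) A
  refine ⟨C + C', by positivity, max M₀ ⌈C'⌉₊, le_max_of_le_left hM₀, ?_⟩
  intro M hM F e hFe r x hx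
  have hMM₀ : M₀ ≤ M := (le_max_left _ _).trans hM
  have hM0 : 0 < M := by omega
  have hM1 : (1 : ℝ) ≤ M := by exact_mod_cast hM0
  have hMC : C' ≤ M := (Nat.le_ceil C').trans (by exact_mod_cast (le_max_right _ _).trans hM)
  have h1 := hC M hMM₀ F e hFe _ hx
  have hM2p : 1 ≤ (M : ℝ) ^ (2 * p) := Real.one_le_rpow hM1 (by linarith)
  have hy : |polyNet q M e (unitPos r x)| ≤ A := by
    have h2 := hFe.abs_le hM0 hx
    have h3 := abs_add_le (polyNet q M e (unitPos r x) - F (unitPos r x)) (F (unitPos r x))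
    rw [sub_add_cancel] at h3
    have h4 : C / (M : ℝ) ^ (2 * p) ≤ C := div_le_self hC0 hM2p
    linarith
  have h5 := hC' ((M : ℝ) ^ (2 * q + 2)) (hMC.trans (le_self_pow₀ hM1 (by omega)))
    (one_le_pow₀ hM1) (padding d q) le_rfl _ hy
  have h6 : C' / (M : ℝ) ^ (2 * q + 2) ≤ C' / (M : ℝ) ^ (2 * p) := by
    gcongr
    rw [← Real.rpow_natCast]
    exact Real.rpow_le_rpow_of_exponent_le hM1 (by push_cast; linarith)
  have h7 := abs_add_le (fullNet q M r e x - polyNet q M e (unitPos r x))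
    (polyNet q M e (unitPos r x) - F (unitPos r x))
  rw [sub_add_sub_cancel] at h7
  rw [add_div]
  unfold fullNet at h7 ⊢
  linarith

/-! ### Local polynomials of a smooth function -/

/-- The affine map from `[0, 1]^d` to `[-h, h]^d`. -/
def cubePoint {d : ℕ} (h : ℝ) (u : Fin d → ℝ) : EuclideanSpace ℝ (Fin d) :=
  WithLp.toLp 2 fun l => h * (2 * u l - 1)

theorem cubePoint_mem {d : ℕ} {h : ℝ} (hh : 0 ≤ h) {u : Fin d → ℝ}
    (hu : ∀ l, 0 ≤ u l ∧ u l ≤ 1) : cubePoint h u ∈ cube d (2 * h) := by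
  intro l
  obtain ⟨h0, h1⟩ := hu l
  simp only [cubePoint]
  constructor <;> nlinarith

theorem abs_iterPartial_le {d q : ℕ} {f : EuclideanSpace ℝ (Fin d) → ℝ} {C C' D h k : ℝ}
    (hf : ContDiff ℝ q f) (hCD : C ≤ D) (hC'D : C' ≤ D) (hk : 0 ≤ k)
    (hder : ∀ j : Fin d → ℕ, 1 ≤ ∑ i, j i → ∑ i, j i ≤ q →
      ∀ x ∈ cube d (2 * h), |mixedPartial j f x| ≤ C' * k ^ (∑ i, j i))
    (hval : ∀ x ∈ cube d (2 * h), |f x| ≤ C) {n : ℕ} (hn : n ≤ q) (β : Fin n → Fin d)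
    {x : EuclideanSpace ℝ (Fin d)} (hx : x ∈ cube d (2 * h)) :
    |iterPartial (List.ofFn β) f x| ≤ D * k ^ n := by
  rcases Nat.eq_zero_or_pos n with h0 | h0
  · subst h0
    simp only [List.ofFn_zero, pow_zero, mul_one]
    exact (hval x hx).trans hCD
  · rw [iterPartial_eq_mixedPartial _ (by
      rw [List.length_ofFn]; exact hf.of_le (by exact_mod_cast hn))]
    have hsum : ∑ i, (List.ofFn β).count i = n := by
      rw [sum_count_eq_length, List.length_ofFn]
    refine (hder _ (by rw [hsum]; exact h0) (by rw [hsum]; exact hn) x hx).trans ?_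
    rw [hsum]
    gcongr

/-- In the coordinates of the unit cube, Taylor polynomials have bounded coefficients. -/
theorem isBoundedPoly_taylorPoly {d q : ℕ} {f : EuclideanSpace ℝ (Fin d) → ℝ} {D h B : ℝ}
    (hh : 0 ≤ h) (hD : 0 ≤ D) (hB : 1 ≤ B) {c : Fin d → ℝ} (hc : ∀ l, 0 ≤ c l ∧ c l ≤ 1)
    (hder : ∀ n ≤ q, ∀ β : Fin n → Fin d,
      h ^ n * |iterPartial (List.ofFn β) f (cubePoint h c)| ≤ D * B ^ n) :
    IsBoundedPoly q ((∑ n ∈ Finset.range (q + 1), (d : ℝ) ^ n)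
        * (2 ^ q * D * (d + 1 : ℝ) ^ q) * B ^ q)
      fun u => taylorPoly q f (cubePoint h c) (cubePoint h u - cubePoint h c) := by
  have hterm : ∀ n ∈ Finset.range (q + 1), ∀ β : Fin n → Fin d,
      IsBoundedPoly q (2 ^ q * D * B ^ q * (d + 1 : ℝ) ^ q) fun u : Fin d → ℝ =>
        iterPartial (List.ofFn β) f (cubePoint h c) / n.factorial
          * ∏ i : Fin n, (cubePoint h u - cubePoint h c : EuclideanSpace ℝ (Fin d)) (β i) := by
    intro n hn β
    have hnq : n ≤ q := Nat.lt_succ_iff.1 (Finset.mem_range.1 hn)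
    -- The factor `u l - c l` is a linear form in `(1, u)`; factors `1` fill up the degree to `q`.
    let a : Fin q → Fin (d + 1) → ℝ := fun i => if hi : (i : ℕ) < n then
      Fin.cons (-c (β ⟨i, hi⟩)) (Pi.single (β ⟨i, hi⟩) 1) else Fin.cons 1 0
    have ha : ∀ i k, |a i k| ≤ 1 := by
      intro i k
      simp only [a]
      split_ifs with hi
      · refine Fin.cases ?_ (fun l => ?_) k
        · rw [Fin.cons_zero, abs_neg, abs_of_nonneg (hc _).1]; exact (hc _).2
        · rw [Fin.cons_succ, Pi.single_apply]; split_ifs <;> simp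
      · refine Fin.cases ?_ (fun l => ?_) k <;> simp
    have hval : ∀ (u : Fin d → ℝ) (i : Fin q), ∑ k, a i k * homog u k
        = if hi : (i : ℕ) < n then u (β ⟨i, hi⟩) - c (β ⟨i, hi⟩) else 1 := by
      intro u i
      simp only [a]
      split_ifs with hi
      · rw [Fin.sum_univ_succ]
        simp [homog, Pi.single_apply]
        ring
      · rw [Fin.sum_univ_succ]
        simp [homog]
    have hprod : ∀ u : Fin d → ℝ, ∏ i, ∑ k, a i k * homog u k
        = ∏ i : Fin n, (u (β i) - c (β i)) := by
      intro u
      simp_rw [hval]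
      obtain ⟨m, rfl⟩ := Nat.exists_eq_add_of_le hnq
      rw [Fin.prod_univ_add]
      simp
    have h1 := (isBoundedPoly_prod a ha).const_mul
      (iterPartial (List.ofFn β) f (cubePoint h c) / n.factorial * (2 * h) ^ n)
    obtain ⟨e, he, hg⟩ := h1
    refine ⟨e, fun s => (he s).trans ?_, fun u => ?_⟩
    · refine mul_le_mul_of_nonneg_right ?_ (by positivity)
      rw [abs_mul, abs_div, Nat.abs_cast, abs_of_nonneg (by positivity : 0 ≤ (2 * h) ^ n)]
      have hfac : (1 : ℝ) ≤ (n.factorial : ℝ) := by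
        exact_mod_cast Nat.succ_le_of_lt (Nat.factorial_pos _)
      calc |iterPartial (List.ofFn β) f (cubePoint h c)| / (n.factorial : ℝ) * (2 * h) ^ n
          ≤ |iterPartial (List.ofFn β) f (cubePoint h c)| * (2 * h) ^ n := by
            gcongr
            exact div_le_self (abs_nonneg _) hfac
        _ = 2 ^ n * (h ^ n * |iterPartial (List.ofFn β) f (cubePoint h c)|) := by
            rw [mul_pow]; ring
        _ ≤ 2 ^ q * (D * B ^ q) := by
            refine mul_le_mul (pow_le_pow_right₀ (by norm_num) hnq) ?_ (by positivity)
              (by positivity)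
            exact (hder n hnq β).trans (by gcongr)
        _ = _ := by ring
    · rw [← hg]
      beta_reduce
      rw [hprod]
      have : ∀ i : Fin n, (cubePoint h u - cubePoint h c) (β i)
          = 2 * h * (u (β i) - c (β i)) := by
        intro i
        simp only [cubePoint, PiLp.sub_apply]
        ring
      simp_rw [this]
      rw [Finset.prod_mul_distrib]
      simp only [Finset.prod_const, Finset.card_univ, Fintype.card_fin]
      ring
  have h2 := IsBoundedPoly.sum (Finset.range (q + 1)) fun n hn =>
    IsBoundedPoly.sum Finset.univ fun β _ => hterm n hn β
  obtain ⟨e, he, hg⟩ := h2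
  refine ⟨e, fun s => (he s).trans (le_of_eq ?_), hg⟩
  rw [Finset.sum_mul, Finset.sum_mul]
  refine Finset.sum_congr rfl fun n _ => ?_
  simp [Finset.card_univ]
  ring

theorem norm_le_of_abs_coord_le {d : ℕ} {v : EuclideanSpace ℝ (Fin d)} {a : ℝ}
    (h : ∀ l, |v l| ≤ a) : ‖v‖ ≤ d * a := by
  have hv : v = ∑ i, v i • EuclideanSpace.single i (1 : ℝ) := by
    ext k
    simp [Finset.sum_apply, Pi.single_apply]
  rw [hv]
  refine (norm_sum_le _ _).trans ?_
  calc _ ≤ ∑ _i : Fin d, a := by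
        refine Finset.sum_le_sum fun i _ => ?_
        rw [norm_smul, Real.norm_eq_abs]
        simpa using h i
    _ = d * a := by simp

/-- After normalisation, a smooth function is locally approximated by its Taylor polynomials at
the corners of the fine cells. -/
theorem exists_isLocalApprox (d q : ℕ) (hd : 1 ≤ d) (hq : 1 ≤ q) (s p : ℝ) (hs : 0 < s)
    (hs1 : s ≤ 1) (hp : p = q + s) (C₀ : ℝ) (hC₀ : 1 ≤ C₀) (D c₀ : ℝ) (hD : 0 ≤ D)
    (hc₀ : 1 ≤ c₀) : ∃ Λ : ℝ, 0 < Λ ∧ ∀ (h k B : ℝ), 1 ≤ h → 0 < k → 1 ≤ B → k * h ≤ B →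
      h ≤ c₀ * B → ∀ f : EuclideanSpace ℝ (Fin d) → ℝ, IsSmoothClass q s C₀ f →
      (∀ n ≤ q, ∀ β : Fin n → Fin d, ∀ x ∈ cube d (2 * h),
        |iterPartial (List.ofFn β) f x| ≤ D * k ^ n) →
      ∀ M : ℕ, 1 ≤ M → ∃ e, IsLocalApprox q M p
        (fun u => f (cubePoint h u) / (Λ * B ^ (q + 1))) e := by
  set b₀ : ℝ := (∑ n ∈ Finset.range (q + 1), (d : ℝ) ^ n) * (2 ^ q * D * (d + 1 : ℝ) ^ q) with hb₀
  have hb₀0 : 0 ≤ b₀ := by positivity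
  set b₁ : ℝ := (d : ℝ) ^ q * C₀ * (2 * d * c₀) ^ p with hb₁
  have hd' : (1 : ℝ) ≤ d := by exact_mod_cast hd
  have hb₁0 : 0 < b₁ := by positivity
  refine ⟨b₀ + b₁, by positivity, ?_⟩
  intro h k B hh hk hB hkB hhB f hf hder M hM
  have hM0 : (0 : ℝ) < M := by exact_mod_cast hM
  have hBpos : 0 < B := by linarith
  set Λ : ℝ := (b₀ + b₁) * B ^ (q + 1) with hΛ
  have hΛ0 : 0 < Λ := by positivity
  let c : (Fin d → Fin M) → (Fin d → Fin M) → Fin d → ℝ := fun i j l =>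
    corner M (i l) (j l) / M
  have hc : ∀ i j l, 0 ≤ c i j l ∧ c i j l ≤ 1 := by
    intro i j l
    have h1 := corner_mem (M := M) (i := i l) (j l).2
    have h2 : ((i l : ℕ) : ℝ) + 1 ≤ M := by exact_mod_cast (i l).2
    have h3 : (0 : ℝ) ≤ (i l : ℕ) := Nat.cast_nonneg _
    exact ⟨div_nonneg (by linarith) hM0.le, (div_le_one hM0).2 (by linarith)⟩
  have hpoly : ∀ i j, IsBoundedPoly q (b₀ * B ^ q) fun u =>
      taylorPoly q f (cubePoint h (c i j)) (cubePoint h u - cubePoint h (c i j)) := by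
    intro i j
    refine isBoundedPoly_taylorPoly (by linarith) hD hB (hc i j) fun n hn β => ?_
    calc h ^ n * |iterPartial (List.ofFn β) f (cubePoint h (c i j))| ≤ h ^ n * (D * k ^ n) := by
          gcongr
          exact hder n hn β _ (cubePoint_mem (by linarith) (hc i j))
      _ = D * (k * h) ^ n := by rw [mul_pow]; ring
      _ ≤ D * B ^ n := by gcongr
  choose e he hg using hpoly
  refine ⟨fun i j s => e i j s / Λ, fun i j s => ?_, fun u hu i j r hr => ?_⟩
  · rw [abs_div, abs_of_pos hΛ0, div_le_one hΛ0]
    refine (he i j s).trans ?_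
    rw [hΛ]
    have h1 : B ^ q ≤ B ^ (q + 1) := pow_le_pow_right₀ hB (by omega)
    calc b₀ * B ^ q ≤ (b₀ + b₁) * B ^ q := by gcongr; linarith
      _ ≤ _ := by gcongr
  · have hr0 : 0 ≤ r := (abs_nonneg _).trans (hr ⟨0, hd⟩)
    have hp0 : 0 < p := by rw [hp]; positivity
    have h1 : ∑ s, e i j s / Λ * symMonomial s u
        = taylorPoly q f (cubePoint h (c i j)) (cubePoint h u - cubePoint h (c i j)) / Λ := by
      have hgu := hg i j u
      beta_reduce at hgu
      rw [hgu, Finset.sum_div]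
      exact Finset.sum_congr rfl fun s _ => by ring
    beta_reduce
    rw [h1, ← sub_div, abs_div, abs_of_pos hΛ0, div_le_iff₀ hΛ0]
    have h2 := abs_sub_taylorPoly_le hq hs (by linarith) hf (cubePoint h (c i j))
      (cubePoint h u - cubePoint h (c i j))
    rw [add_sub_cancel] at h2
    refine h2.trans ?_
    set v := cubePoint h u - cubePoint h (c i j) with hv
    have h3 : ‖v‖ ≤ d * (2 * h * (r / M)) := by
      refine norm_le_of_abs_coord_le fun l => ?_
      have h4 : v l = 2 * h * ((M * u l - corner M (i l) (j l)) / M) := by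
        simp only [hv, cubePoint, PiLp.sub_apply, c]
        field_simp
        ring
      rw [h4, abs_mul, abs_div, abs_of_pos hM0, abs_of_pos (by linarith : 0 < 2 * h)]
      gcongr
      exact hr l
    have h5 : ‖v‖ ^ q * ‖v‖ ^ s ≤ (d * (2 * h * (r / M))) ^ p := by
      rw [hp, Real.rpow_add_of_nonneg (by positivity) (by positivity) hs.le, Real.rpow_natCast]
      gcongr
    have h6 : (d * (2 * h * (r / M))) ^ p ≤ (2 * d * c₀) ^ p * B ^ (q + 1) * (r / M) ^ p := by
      calc (d * (2 * h * (r / M))) ^ p ≤ (2 * d * c₀ * B * (r / M)) ^ p := by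
            refine Real.rpow_le_rpow (by positivity) ?_ hp0.le
            calc (d : ℝ) * (2 * h * (r / M)) ≤ d * (2 * (c₀ * B) * (r / M)) := by gcongr
              _ = _ := by ring
        _ = (2 * d * c₀) ^ p * B ^ p * (r / M) ^ p := by
            rw [Real.mul_rpow (by positivity) (by positivity),
              Real.mul_rpow (by positivity) (by positivity)]
        _ ≤ _ := by
            gcongr
            rw [← Real.rpow_natCast]
            refine Real.rpow_le_rpow_of_exponent_le hB ?_
            rw [hp]; push_cast; linarith
    calc (d : ℝ) ^ q * C₀ * (‖v‖ ^ q * ‖v‖ ^ s)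
        ≤ (d : ℝ) ^ q * C₀ * ((2 * d * c₀) ^ p * B ^ (q + 1) * (r / M) ^ p) := by
          exact mul_le_mul_of_nonneg_left (h5.trans h6) (by positivity)
      _ = (r / M) ^ p * (b₁ * B ^ (q + 1)) := by rw [hb₁]; ring
      _ ≤ (r / M) ^ p * Λ := by
          rw [hΛ]
          gcongr
          linarith

/-- A function with small gradient is almost constant on the cube. -/
theorem abs_sub_zero_le {d q : ℕ} (hq : 1 ≤ q) {f : EuclideanSpace ℝ (Fin d) → ℝ} {D h k : ℝ}
    (hf : ContDiff ℝ q f) (hh : 0 ≤ h) (hder : ∀ β : Fin 1 → Fin d, ∀ x ∈ cube d (2 * h),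
      |iterPartial (List.ofFn β) f x| ≤ D * k) {x : EuclideanSpace ℝ (Fin d)}
    (hx : x ∈ cube d h) : |f x - f 0| ≤ d * (h * (D * k)) := by
  have hf1 : ContDiff ℝ (1 : ℕ) f := hf.of_le (by exact_mod_cast hq)
  obtain ⟨ξ, hξ, h1⟩ := exists_taylor_unit (fun t : ℝ => f (0 + t • x)) 0
    (by
      have : ContDiff ℝ (1 : ℕ) (fun t : ℝ => f (0 + t • x)) :=
        hf1.comp (contDiff_const.add (contDiff_id.smul contDiff_const))
      exact_mod_cast this)
  rw [zero_add 1, iteratedDeriv_comp_line 0 x 1 hf1] at h1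
  simp only [one_smul, zero_add, Finset.range_one, Finset.sum_singleton, iteratedDeriv_zero,
    zero_smul, Nat.factorial_zero, Nat.factorial_one, Nat.cast_one, div_one] at h1
  rw [h1, add_sub_cancel_left]
  refine (Finset.abs_sum_le_sum_abs _ _).trans ?_
  calc _ ≤ ∑ _β : Fin 1 → Fin d, h * (D * k) := by
        refine Finset.sum_le_sum fun β _ => ?_
        rw [abs_mul]
        refine mul_le_mul ?_ (hder β _ fun l => ?_) (abs_nonneg _) hh
        · simp only [Finset.univ_unique, Finset.prod_singleton]
          exact abs_le.2 (hx _)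
        · obtain ⟨h2, h3⟩ := hx l
          simp only [PiLp.smul_apply, smul_eq_mul]
          constructor <;> nlinarith [hξ.1, hξ.2]
    _ = d * (h * (D * k)) := by simp

end Mscale

open Mscale

theorem theorem2 (d q : ℕ) (hd : 1 ≤ d) (hq : 1 ≤ q) (s p : ℝ) (hs : 0 < s) (hs1 : s ≤ 1)
    (hp : p = q + s) (C₀ : ℝ) (hC₀ : 1 ≤ C₀) (C C' : ℝ) (κ H : ℝ) (hκ : 0 < κ) :
    ∃ C₁ C₂ c₂ c₃ c₆ : ℝ, 0 < C₁ ∧ 0 < C₂ ∧ 0 < c₂ ∧ 0 < c₃ ∧ 0 < c₆ ∧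
      ∀ h k : ℝ, 1 ≤ h → 0 < k → (κ ≤ k ∨ h ≤ H) →
      ∀ f : EuclideanSpace ℝ (Fin d) → ℝ,
        Mscale.IsSmoothClass q s C₀ f →
        (∀ j : Fin d → ℕ, 1 ≤ ∑ i, j i → ∑ i, j i ≤ q →
          ∀ x ∈ Mscale.cube d (2 * h), |Mscale.mixedPartial j f x| ≤ C' * k ^ (∑ i, j i)) →
        (∀ x ∈ Mscale.cube d (2 * h), |f x| ≤ C) →
      ∀ M : ℕ,
        max (max (2 * c₂ * (max (k * h) C₁) ^ (5 * q + 3)) c₃) (max (2 ^ d) (12 * d))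
          ≤ (M : ℝ) ^ (2 * p) →
        ∃ fnet ∈ Mscale.featureNetClass (fun (_ : Fin 1) (x : EuclideanSpace ℝ (Fin d)) => k • x)
            (Mscale.depth d q) (Mscale.width d q M)
            (Mscale.paramBound c₆ p d M h (max (k * h) C₁)),
          ∀ x ∈ Mscale.cube d h,
            |fnet x - f x| ≤ C₂ * (max (k * h) C₁) ^ (5 * q + 3) / (M : ℝ) ^ (2 * p) := by
  obtain ⟨K, hK0, M₁, hM₁, hnet⟩ := exists_fullNet_mem_netClass d q hd hq
  have hp0 : 0 < p := by rw [hp]; positivity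
  have hpq : p ≤ q + 1 := by rw [hp]; linarith
  obtain ⟨Cb, hCb0, M₂, hM₂, hbound⟩ := exists_fullNet_bound d q hq p hp0 hpq
  set D : ℝ := max 0 (max C C') with hDdef
  have hD0 : 0 ≤ D := le_max_left _ _
  have hCD : C ≤ D := (le_max_left _ _).trans (le_max_right _ _)
  have hC'D : C' ≤ D := (le_max_right _ _).trans (le_max_right _ _)
  set c₀ : ℝ := max 1 (max (1 / κ) H) with hc₀def
  have hc₀ : 1 ≤ c₀ := le_max_left _ _
  obtain ⟨Λ, hΛ0, hloc⟩ := exists_isLocalApprox d q hd hq s p hs hs1 hp C₀ hC₀ D c₀ hD0 hc₀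
  set M₀ : ℕ := max M₁ M₂ with hM₀def
  have hM₀2 : 2 ≤ M₀ := le_max_of_le_left hM₁
  have hM₀r : (0 : ℝ) < M₀ := by exact_mod_cast (by omega : 0 < M₀)
  -- `c₃` makes `M` so large that both the construction and its error bound apply.
  refine ⟨1, Λ * Cb + d * D + 1, 1, (M₀ : ℝ) ^ (2 * p), K + 1, one_pos, by positivity, one_pos,
    by positivity, by positivity, ?_⟩
  intro h k hh hk hcase f hf hder hval M hM
  set B : ℝ := max (k * h) 1 with hBdef
  have hB1 : 1 ≤ B := le_max_right _ _
  have hkB : k * h ≤ B := le_max_left _ _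
  have hMM₀ : M₀ ≤ M := by
    have h1 : (M₀ : ℝ) ^ (2 * p) ≤ (M : ℝ) ^ (2 * p) :=
      ((le_max_right _ _).trans (le_max_left _ _)).trans hM
    have h2 := (Real.rpow_le_rpow_iff hM₀r.le (Nat.cast_nonneg M) (by linarith)).1 h1
    exact_mod_cast h2
  have hM1 : (1 : ℝ) ≤ M := by exact_mod_cast (by omega : 1 ≤ M)
  have hh0 : 0 < h := by linarith
  have hr0 : 0 < k * h := by positivity
  have hparam : K * (M : ℝ) ^ (10 * q + 2 * d + 10) ≤ paramBound (K + 1) p d M h B := by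
    have h1 : (M : ℝ) ^ (10 * q + 2 * d + 10) ≤ (M : ℝ) ^ (10 * p + 2 * d + 10) := by
      rw [← Real.rpow_natCast]
      refine Real.rpow_le_rpow_of_exponent_le hM1 ?_
      rw [hp]; push_cast; linarith
    have h2 : (1 : ℝ) ≤ Real.exp (6 * 2 ^ (2 * (d + 1) + 1) * d * h) :=
      Real.one_le_exp (by positivity)
    have h3 : (1 : ℝ) ≤ B ^ 12 := one_le_pow₀ hB1
    unfold paramBound
    calc K * (M : ℝ) ^ (10 * q + 2 * d + 10)
        ≤ (K + 1) * 1 * (M : ℝ) ^ (10 * p + 2 * d + 10) * 1 := by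
          rw [mul_one, mul_one]; gcongr; linarith
      _ ≤ _ := by gcongr
  have hderD : ∀ n ≤ q, ∀ β : Fin n → Fin d, ∀ x ∈ cube d (2 * h),
      |iterPartial (List.ofFn β) f x| ≤ D * k ^ n := fun n hn β x hx =>
    abs_iterPartial_le hf.1 hCD hC'D hk.le hder hval hn β hx
  have hM2p : (0 : ℝ) < (M : ℝ) ^ (2 * p) := by positivity
  -- `x` is recovered from `k • x` by a division by `k * h`, so `1 / (k * h)` enters the parameters.
  by_cases hsmall : 1 / (k * h) ≤ (M : ℝ) ^ (2 * q + 2)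
  · -- The Hölder remainder is of order `h ^ p`, and has to be absorbed by a power of `B`.
    have hhB : h ≤ c₀ * B := by
      rcases hcase with hc | hc
      · have h1 : 1 / κ ≤ c₀ := (le_max_left _ _).trans (le_max_right _ _)
        calc h = 1 / κ * (κ * h) := by field_simp
          _ ≤ c₀ * B := mul_le_mul h1 (le_trans (by gcongr) hkB) (by positivity) (by linarith)
      · have h1 : H ≤ c₀ := (le_max_right _ _).trans (le_max_right _ _)
        calc h ≤ c₀ * 1 := by linarith
          _ ≤ c₀ * B := by gcongr
    obtain ⟨e, he⟩ := hloc h k B hh hk hB1 hkB hhB f hf hderD M (by omega)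
    refine ⟨fun x => Λ * B ^ (q + 1) * fullNet q M (k * h) e (k • x),
      ⟨fun _ => fullNet q M (k * h) e, fun _ => Λ * B ^ (q + 1), 0, fun _ => ?_, ?_⟩, ?_⟩
    · exact netClass_mono hparam
        (hnet M ((le_max_left _ _).trans hMM₀) (k * h) e hr0 hsmall he.1)
    · funext x; simp
    · intro x hx
      have hu : ∀ l, unitPos (k * h) (k • x) l = x l / (2 * h) + 1 / 2 := by
        intro l
        simp only [unitPos, PiLp.smul_apply, smul_eq_mul]
        field_simp
      have hu01 : ∀ l, 0 ≤ unitPos (k * h) (k • x) l ∧ unitPos (k * h) (k • x) l ≤ 1 := by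
        intro l
        rw [hu]
        obtain ⟨h1, h2⟩ := hx l
        have h3 : -(1 / 2) ≤ x l / (2 * h) := by
          rw [le_div_iff₀ (by positivity)]; linarith
        have h4 : x l / (2 * h) ≤ 1 / 2 := by
          rw [div_le_iff₀ (by positivity)]; linarith
        constructor <;> linarith
      have hpt : cubePoint h (unitPos (k * h) (k • x)) = x := by
        ext l
        simp only [cubePoint, hu]
        field_simp
        ring
      have h1 := hbound M ((le_max_right _ _).trans hMM₀) _ e he (k * h) (k • x) hu01
      beta_reduce at h1
      rw [hpt] at h1
      have hS : 0 < Λ * B ^ (q + 1) := by positivity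
      have h2 : Λ * B ^ (q + 1) * fullNet q M (k * h) e (k • x) - f x
          = Λ * B ^ (q + 1) * (fullNet q M (k * h) e (k • x) - f x / (Λ * B ^ (q + 1))) := by
        field_simp
      rw [h2, abs_mul, abs_of_pos hS]
      calc Λ * B ^ (q + 1) * |fullNet q M (k * h) e (k • x) - f x / (Λ * B ^ (q + 1))|
          ≤ Λ * B ^ (q + 1) * (Cb / (M : ℝ) ^ (2 * p)) := by gcongr
        _ = Λ * Cb * B ^ (q + 1) / (M : ℝ) ^ (2 * p) := by ring
        _ ≤ (Λ * Cb + d * D + 1) * B ^ (5 * q + 3) / (M : ℝ) ^ (2 * p) := by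
          have h3 : B ^ (q + 1) ≤ B ^ (5 * q + 3) := pow_le_pow_right₀ hB1 (by omega)
          have h4 : 0 ≤ (d : ℝ) * D := by positivity
          gcongr
          linarith
  · -- On the cube `f` varies by at most `d * D * (k * h)`, which is already small enough.
    push Not at hsmall
    have hkh : k * h ≤ 1 / (M : ℝ) ^ (2 * q + 2) := by
      rw [lt_div_iff₀ hr0] at hsmall
      rw [le_div_iff₀ (by positivity)]
      linarith
    refine ⟨fun _ => f 0, ⟨fun _ => fullNet q M 1 fun _ _ _ => 0, fun _ => 0, f 0, fun _ => ?_, ?_⟩,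
      ?_⟩
    · refine netClass_mono hparam (hnet M ((le_max_left _ _).trans hMM₀) 1 _ one_pos ?_ ?_)
      · rw [div_one]; exact one_le_pow₀ hM1
      · simp
    · funext x; simp
    · intro x hx
      rw [abs_sub_comm]
      refine (abs_sub_zero_le hq hf.1 hh0.le (fun β x hx => by
        simpa using hderD 1 hq β x hx) hx).trans ?_
      have h5 : (M : ℝ) ^ (2 * p) ≤ (M : ℝ) ^ (2 * q + 2) := by
        rw [← Real.rpow_natCast]
        exact Real.rpow_le_rpow_of_exponent_le hM1 (by push_cast; linarith)
      calc (d : ℝ) * (h * (D * k)) = d * D * (k * h) := by ring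
        _ ≤ d * D * (1 / (M : ℝ) ^ (2 * q + 2)) := by gcongr
        _ ≤ d * D * (1 / (M : ℝ) ^ (2 * p)) := by gcongr
        _ = d * D * 1 / (M : ℝ) ^ (2 * p) := by ring
        _ ≤ (Λ * Cb + d * D + 1) * B ^ (5 * q + 3) / (M : ℝ) ^ (2 * p) := by
          have h3 : (1 : ℝ) ≤ B ^ (5 * q + 3) := one_le_pow₀ hB1
          have h4 : 0 ≤ Λ * Cb := by positivity
          gcongr
          linarith
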